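/- Let $q\in\mathbb C\setminus\{0\}$ be not a root of unity and let $M>1$, $N\ge 1$ be integers. Put $l_i=1$ for $1\le i\le M$ and $l_i=-1$ for $M<i\le M+N$, $q_i=q^{l_i}$, $(\epsilon_i,\epsilon_j)=l_i\delta_{i,j}$, $c_{i,j}=(\epsilon_i-\epsilon_{i+1},\epsilon_j-\epsilon_{j+1})$. Let $U=U_q(\mathcal L\mathfrak{sl}(M,N))$ be the superalgebra over $\mathbb C$ with generators $X_{i,n}^{\pm},K_i^{\pm1},h_{i,s}$ ($1\le i\le M+N-1$, $n\in\mathbb Z$, $s\in\mathbb Z\setminus\{0\}$), where the $X_{M,n}^{\pm}$ are odd and all other generators even, and with relations, for all indices (where $[a,b]_u=ab-(-1)^{|a||b|}u\,ba$, $[a,b]=[a,b]_1$, $[n]_p=\frac{p^n-p^{-n}}{p-p^{-1}}$): $$K_iK_i^{-1}=K_i^{-1}K_i=1,\quad [K_i,K_j]=[K_i,h_{j,s}]=[h_{i,s},h_{j,t}]=0,$$ $$K_iX_{j,n}^{\pm}K_i^{-1}=q^{\pm c_{i,j}}X_{j,n}^{\pm},\quad [h_{i,s},X_{j,n}^{\pm}]=\pm\tfrac{[sl_ic_{i,j}]_{q_i}}{s}X_{j,n+s}^{\pm},\quad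 [X_{i,m}^+,X_{j,n}^-]=\delta_{i,j}\tfrac{\phi_{i,m+n}^+-\phi_{i,m+n}^-}{q_i-q_i^{-1}},$$ $$[X_{i,m}^{\pm},X_{j,n}^{\pm}]=0\ \ (c_{i,j}=0),$$ $$X_{i,m+1}^{\pm}X_{j,n}^{\pm}-q^{\pm c_{i,j}}X_{j,n}^{\pm}X_{i,m+1}^{\pm}=q^{\pm c_{i,j}}X_{i,m}^{\pm}X_{j,n+1}^{\pm}-X_{j,n+1}^{\pm}X_{i,m}^{\pm}\ \ (c_{i,j}\ne0),$$ $$[X_{i,m}^{\pm},[X_{i,n}^{\pm},X_{j,k}^{\pm}]_{q^{-1}}]_q+[X_{i,n}^{\pm},[X_{i,m}^{\pm},X_{j,k}^{\pm}]_{q^{-1}}]_q=0\ \ (c_{i,j}=\pm1,\ i\ne M),$$ $$[[[X_{M-1,m}^{\pm},X_{M,n}^{\pm}]_{q^{-1}},X_{M+1,k}^{\pm}]_q,X_{M,u}^{\pm}]+[[[X_{M-1,m}^{\pm},X_{M,u}^{\pm}]_{q^{-1}},X_{M+1,k}^{\pm}]_q,X_{M,n}^{\pm}]=0\ \ (M,N>1),$$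 where $\sum_n\phi_{i,n}^{\pm}z^n=K_i^{\pm1}\exp\big(\pm(q_i-q_i^{-1})\sum_{s>0}h_{i,\pm s}z^{\pm s}\big)$. Let $P=(P_i)_{1\le i\le M+N-1,\,i\ne M}$ with $P_i\in1+z\mathbb C[z]$, let $f=\sum_{n\in\mathbb Z}f_nz^n\in\mathbb C[[z,z^{-1}]]$ be annihilated by a non-zero polynomial, let $c\in\mathbb C\setminus\{0\}$ with $\frac{c-c^{-1}}{q-q^{-1}}=f_0$, and let $Q=\sum_{s=0}^da_sz^s\in1+z\mathbb C[z]$ have degree $d$ and satisfy $Qf=0$. The Weyl module $W=W(P,f,c;Q)$ is the $U$-module generated by an even vector $v$ subject to: $X_{i,n}^+v=0$ for all $i,n$; $\sum_n\phi_{i,n}^{\pm}z^nv=q_i^{\deg P_i}\frac{P_i(zq_i^{-1})}{P_i(zq_i)}v$ (expanded in $z^{\pm1}$) and $(X_{i,0}^-)^{1+\deg P_i}v=0$ for $i\ne M$; $K_Mv=cv$ and $\sum_n\frac{\phi_{M,n}^+-\phi_{M,n}^-}{q-q^{-1}}z^nv=f(z)v$; and $\sum_{s=0}^da_{d-s}X_{M,s}^-v=0$.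 Let $K_0$ act on $W$ by $K_0v=v$, $K_0X_{i,n}^{\pm}=q^{\pm\delta_{i,1}}X_{i,n}^{\pm}K_0$, $K_0K_i=K_iK_0$, $K_0h_{i,s}=h_{i,s}K_0$. For $\mu=(\mu(K_i))_{0\le i\le M+N-1}\in(\mathbb C^\times)^{M+N}$ put $W_\mu=\{w\in W: K_iw=\mu(K_i)w,\ 0\le i\le M+N-1\}$. Let $\lambda$ be given by $K_0\mapsto1$, $K_M\mapsto c$, $K_i\mapsto q_i^{\deg P_i}$ ($i\ne0,M$), and $\lambda-\alpha_M$ by $K_0\mapsto 1$, $K_i\mapsto\lambda(K_i)q^{-c_{M,i}}$ ($i\geq 1$). Then $\dim W_\lambda=1$ and $\dim W_{\lambda-\alpha_M}=d=\deg Q$. Moreover, the characteristic polynomial of $h_{M-1,1}$ acting on $W_{\lambda-\alpha_M}$ is $\widetilde Q(z-\theta_{M-1})$, where $\widetilde Q(z)=z^dQ(1/z)=\sum_{s=0}^da_{d-s}z^s$ and $-\theta_{M-1}$ is the coefficient of $z$ in $P_{M-1}(z)$. -/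

import Mathlib

noncomputable section

namespace QAffSuper

/-- Nodes of the Dynkin diagram of `sl(M,N)`: the integers `1 ≤ i ≤ M+N-1`. -/
abbrev Node (M N : ℕ) : Type := {i : ℕ // 1 ≤ i ∧ i ≤ M + N - 1}

/-- The odd node `M`. -/
def oddNode (M N : ℕ) (hM : 1 < M) (hN : 1 ≤ N) : Node M N := ⟨M, by omega, by omega⟩

/-- The even node `M-1`. -/
def prevNode (M N : ℕ) (hM : 1 < M) (hN : 1 ≤ N) : Node M N := ⟨M - 1, by omega, by omega⟩

/-- `l_i = 1` for `i ≤ M` and `l_i = -1` for `i > M`. -/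
def ell (M i : ℕ) : ℤ := if i ≤ M then 1 else -1

/-- The form `(ε_a, ε_b) = l_a δ_{ab}`. -/
def form (M a b : ℕ) : ℤ := if a = b then ell M a else 0

/-- `c_{ij} = (ε_i - ε_{i+1}, ε_j - ε_{j+1})`. -/
def cartan (M i j : ℕ) : ℤ :=
  form M i j - form M i (j + 1) - form M (i + 1) j + form M (i + 1) (j + 1)

/-- `q_i = q^{l_i}`. -/
def qn (q : ℂˣ) (M i : ℕ) : ℂˣ := q ^ ell M i

/-- The quantum integer `[n]_p = (p^n - p^{-n}) / (p - p^{-1})`. -/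
def qint (p : ℂˣ) (n : ℤ) : ℂ :=
  (((p ^ n : ℂˣ) : ℂ) - ((p ^ (-n) : ℂˣ) : ℂ)) / ((p : ℂ) - ((p⁻¹ : ℂˣ) : ℂ))

/-- The Drinfeld generators. A sign `±` is an element `ε` of `ℤˣ`:
`X 1 i n` is `X_{i,n}^+` and `X (-1) i n` is `X_{i,n}^-`. -/
inductive Gen (M N : ℕ) : Type
  | X (ε : ℤˣ) (i : Node M N) (n : ℤ)
  | K (i : Node M N)
  | Kinv (i : Node M N)
  | h (i : Node M N) (s : {s : ℤ // s ≠ 0})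

/-- The parity (0 or 1) of the generators `X_{i,n}^±`; all `K_i^{±1}`, `h_{i,s}` are even. -/
def par {M N : ℕ} (i : Node M N) : ℕ := if i.1 = M then 1 else 0

section Algebra

variable {A : Type} [Ring A] [Algebra ℂ A]

/-- The super-bracket `[a,b]_u = ab - (-1)^{|a||b|} u ba`, for `a`, `b` of parities `pa`, `pb`. -/
def sbr (pa pb : ℕ) (u : ℂ) (a b : A) : A := a * b - ((-1) ^ (pa * pb) * u) • (b * a)

/-- The coefficient of `z^n` in `exp(g(z))`, for a series `g` without constant term
(so that `g^k` does not contribute when `k > n`). -/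
def expCoeff (g : PowerSeries A) (n : ℕ) : A :=
  ∑ k ∈ Finset.range (n + 1), ((k.factorial : ℂ)⁻¹) • PowerSeries.coeff n (g ^ k)

/-- The series `±(q_i - q_i⁻¹) ∑_{s>0} h_{i,±s} t^s` (with `t = z^{±1}`), for elements `x` of an
algebra labelled by the Drinfeld generators. -/
def hSeries (q : ℂˣ) {M N : ℕ} (x : Gen M N → A) (ε : ℤˣ) (i : Node M N) : PowerSeries A :=
  PowerSeries.mk fun s : ℕ =>
    if hs : s = 0 then 0
    else (((ε : ℤ) : ℂ) * ((qn q M i.1 : ℂ) - ((qn q M i.1)⁻¹ : ℂˣ))) •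
      x (Gen.h i ⟨(ε : ℤ) * (s : ℤ), mul_ne_zero ε.ne_zero (by exact_mod_cast hs)⟩)

/-- `φ_{i,n}^±`, where
`∑_n φ_{i,n}^± z^n = K_i^{±1} exp(±(q_i - q_i⁻¹) ∑_{s>0} h_{i,±s} z^{±s})`.
In particular `φ_{i,n}^+ = 0` for `n < 0` and `φ_{i,n}^- = 0` for `n > 0`. -/
def phi (q : ℂˣ) {M N : ℕ} (x : Gen M N → A) (ε : ℤˣ) (i : Node M N) (n : ℤ) : A :=
  if 0 ≤ (ε : ℤ) * n then
    (if ε = 1 then x (Gen.K i) else x (Gen.Kinv i)) * expCoeff (hSeries q x ε i) n.natAbs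
  else 0

end Algebra

section Relations

open FreeAlgebra Gen

variable {M N : ℕ}

/-- The defining relations of the quantum affine superalgebra. -/
inductive Rel (q : ℂˣ) (M N : ℕ) : FreeAlgebra ℂ (Gen M N) → FreeAlgebra ℂ (Gen M N) → Prop
  | K_Kinv (i : Node M N) : Rel q M N (ι ℂ (K i) * ι ℂ (Kinv i)) 1
  | Kinv_K (i : Node M N) : Rel q M N (ι ℂ (Kinv i) * ι ℂ (K i)) 1
  | K_K (i j : Node M N) : Rel q M N (ι ℂ (K i) * ι ℂ (K j)) (ι ℂ (K j) * ι ℂ (K i))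
  | K_h (i j : Node M N) (s : {s : ℤ // s ≠ 0}) :
      Rel q M N (ι ℂ (K i) * ι ℂ (h j s)) (ι ℂ (h j s) * ι ℂ (K i))
  | h_h (i j : Node M N) (s t : {s : ℤ // s ≠ 0}) :
      Rel q M N (ι ℂ (h i s) * ι ℂ (h j t)) (ι ℂ (h j t) * ι ℂ (h i s))
  | K_X (ε : ℤˣ) (i j : Node M N) (n : ℤ) :
      Rel q M N (ι ℂ (K i) * ι ℂ (X ε j n) * ι ℂ (Kinv i))
        (((q ^ ((ε : ℤ) * cartan M i.1 j.1) : ℂˣ) : ℂ) • ι ℂ (X ε j n))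
  | h_X (ε : ℤˣ) (i j : Node M N) (s : {s : ℤ // s ≠ 0}) (n : ℤ) :
      Rel q M N (ι ℂ (h i s) * ι ℂ (X ε j n) - ι ℂ (X ε j n) * ι ℂ (h i s))
        ((((ε : ℤ) : ℂ) * (qint (qn q M i.1) (s.1 * ell M i.1 * cartan M i.1 j.1) / (s.1 : ℂ))) •
          ι ℂ (X ε j (n + s.1)))
  | X_X (i j : Node M N) (m n : ℤ) :
      Rel q M N (sbr (par i) (par j) 1 (ι ℂ (X 1 i m)) (ι ℂ (X (-1) j n)))
        (if i = j then ((qn q M i.1 : ℂ) - ((qn q M i.1)⁻¹ : ℂˣ))⁻¹ •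
            (phi q (ι ℂ) 1 i (m + n) - phi q (ι ℂ) (-1) i (m + n))
          else 0)
  | quad_zero (ε : ℤˣ) (i j : Node M N) (m n : ℤ) (hc : cartan M i.1 j.1 = 0) :
      Rel q M N (sbr (par i) (par j) 1 (ι ℂ (X ε i m)) (ι ℂ (X ε j n))) 0
  | quad (ε : ℤˣ) (i j : Node M N) (m n : ℤ) (hc : cartan M i.1 j.1 ≠ 0) :
      Rel q M N
        (ι ℂ (X ε i (m + 1)) * ι ℂ (X ε j n)
          - ((q ^ ((ε : ℤ) * cartan M i.1 j.1) : ℂˣ) : ℂ) • (ι ℂ (X ε j n) * ι ℂ (X ε i (m + 1))))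
        (((q ^ ((ε : ℤ) * cartan M i.1 j.1) : ℂˣ) : ℂ) • (ι ℂ (X ε i m) * ι ℂ (X ε j (n + 1)))
          - ι ℂ (X ε j (n + 1)) * ι ℂ (X ε i m))
  | serre (ε : ℤˣ) (i j : Node M N) (m n k : ℤ)
      (hc : cartan M i.1 j.1 = 1 ∨ cartan M i.1 j.1 = -1) (hi : i.1 ≠ M) :
      Rel q M N
        (sbr (par i) (par i + par j) q (ι ℂ (X ε i m))
            (sbr (par i) (par j) ((q⁻¹ : ℂˣ) : ℂ) (ι ℂ (X ε i n)) (ι ℂ (X ε j k)))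
          + sbr (par i) (par i + par j) q (ι ℂ (X ε i n))
            (sbr (par i) (par j) ((q⁻¹ : ℂˣ) : ℂ) (ι ℂ (X ε i m)) (ι ℂ (X ε j k))))
        0
  /- Here `a`, `b`, `c` are the nodes `M-1`, `M`, `M+1`; they exist exactly when `M, N > 1`. -/
  | osc (ε : ℤˣ) (a b c : Node M N) (m n k u : ℤ)
      (ha : a.1 + 1 = M) (hb : b.1 = M) (hc : c.1 = M + 1) :
      Rel q M N
        (sbr (par a + par b + par c) (par b) 1
            (sbr (par a + par b) (par c) q
              (sbr (par a) (par b) ((q⁻¹ : ℂˣ) : ℂ) (ι ℂ (X ε a m)) (ι ℂ (X ε b n)))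
              (ι ℂ (X ε c k)))
            (ι ℂ (X ε b u))
          + sbr (par a + par b + par c) (par b) 1
            (sbr (par a + par b) (par c) q
              (sbr (par a) (par b) ((q⁻¹ : ℂˣ) : ℂ) (ι ℂ (X ε a m)) (ι ℂ (X ε b u)))
              (ι ℂ (X ε c k)))
            (ι ℂ (X ε b n)))
        0

/-- The quantum affine superalgebra `U_q(L sl(M,N))` in Drinfeld's presentation. Its relations are
homogeneous for the parity of the generators; the underlying algebra is recorded here, the signs
of the super-brackets being written out through `par`. -/
def U (q : ℂˣ) (M N : ℕ) : Type := RingQuot (Rel q M N)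

instance (q : ℂˣ) (M N : ℕ) : Ring (U q M N) := inferInstanceAs (Ring (RingQuot (Rel q M N)))

instance (q : ℂˣ) (M N : ℕ) : Algebra ℂ (U q M N) :=
  inferInstanceAs (Algebra ℂ (RingQuot (Rel q M N)))

/-- The projection from the free algebra on the Drinfeld generators. -/
def toU (q : ℂˣ) (M N : ℕ) : FreeAlgebra ℂ (Gen M N) →ₐ[ℂ] U q M N :=
  RingQuot.mkAlgHom ℂ (Rel q M N)

theorem toU_rel (q : ℂˣ) {M N : ℕ} {a b : FreeAlgebra ℂ (Gen M N)} (h : Rel q M N a b) :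
    toU q M N a = toU q M N b :=
  RingQuot.mkAlgHom_rel ℂ h

/-- An algebra homomorphism out of `U_q(L sl(M,N))` from one respecting the relations. -/
def liftU (q : ℂˣ) {M N : ℕ} {A : Type} [Ring A] [Algebra ℂ A]
    (f : FreeAlgebra ℂ (Gen M N) →ₐ[ℂ] A) (hf : ∀ a b, Rel q M N a b → f a = f b) :
    U q M N →ₐ[ℂ] A :=
  RingQuot.liftAlgHom ℂ ⟨f, fun a b h => hf a b h⟩

theorem liftU_toU (q : ℂˣ) {M N : ℕ} {A : Type} [Ring A] [Algebra ℂ A]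
    (f : FreeAlgebra ℂ (Gen M N) →ₐ[ℂ] A) (hf : ∀ a b, Rel q M N a b → f a = f b)
    (a : FreeAlgebra ℂ (Gen M N)) : liftU q f hf (toU q M N a) = f a :=
  RingQuot.liftAlgHom_mkAlgHom_apply ℂ f _ a

/-- The generators of `U_q(L sl(M,N))`. -/
def gen (q : ℂˣ) {M N : ℕ} (g : Gen M N) : U q M N := toU q M N (ι ℂ g)

end Relations

section Twist

variable {A B : Type} [Ring A] [Algebra ℂ A] [Ring B] [Algebra ℂ B]

theorem map_sbr (f : A →ₐ[ℂ] B) (pa pb : ℕ) (u : ℂ) (a b : A) :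
    f (sbr pa pb u a b) = sbr pa pb u (f a) (f b) := by
  simp [sbr]

theorem sbr_smul (pa pb : ℕ) (u s t : ℂ) (a b : A) :
    sbr pa pb u (s • a) (t • b) = (s * t) • sbr pa pb u a b := by
  simp only [sbr, smul_mul_smul_comm, smul_sub, smul_smul]
  congr 2
  ring

theorem map_expCoeff (f : A →ₐ[ℂ] B) (g : PowerSeries A) (n : ℕ) :
    f (expCoeff g n) = expCoeff (PowerSeries.map (f : A →+* B) g) n := by
  simp only [expCoeff, map_sum, map_smul, ← map_pow, PowerSeries.coeff_map]
  rfl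

theorem map_phi (q : ℂˣ) {M N : ℕ} (f : A →ₐ[ℂ] B) (x : Gen M N → A) (ε : ℤˣ) (i : Node M N)
    (n : ℤ) : f (phi q x ε i n) = phi q (fun g => f (x g)) ε i n := by
  have hs : PowerSeries.map (f : A →+* B) (hSeries q x ε i) = hSeries q (fun g => f (x g)) ε i := by
    ext s
    by_cases h0 : s = 0 <;> simp [hSeries, h0]
  unfold phi
  split_ifs <;> simp [map_expCoeff, hs]

variable (q : ℂˣ) {M N : ℕ}

/-- The generators of `U_q(L sl(M,N))`, with `X_{i,n}^±` rescaled by `(u i)^{±1}`. -/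
def twistGen (u : Node M N → ℂˣ) : Gen M N → U q M N
  | .X ε i n => ((u i ^ (ε : ℤ) : ℂˣ) : ℂ) • gen q (.X ε i n)
  | .K i => gen q (.K i)
  | .Kinv i => gen q (.Kinv i)
  | .h i s => gen q (.h i s)

theorem phi_twistGen (u : Node M N → ℂˣ) (ε : ℤˣ) (i : Node M N) (n : ℤ) :
    phi q (twistGen q u) ε i n = phi q (gen q) ε i n := rfl

theorem mk_rel {a b : FreeAlgebra ℂ (Gen M N)} (h : Rel q M N a b) :
    FreeAlgebra.lift ℂ (gen q) a = FreeAlgebra.lift ℂ (gen q) b := by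
  have e : FreeAlgebra.lift ℂ (gen q) = toU q M N := by
    ext g
    simp [gen]
  rw [e]
  exact toU_rel q h

theorem twist_rel (u : Node M N → ℂˣ) {a b : FreeAlgebra ℂ (Gen M N)} (hab : Rel q M N a b) :
    FreeAlgebra.lift ℂ (twistGen q u) a = FreeAlgebra.lift ℂ (twistGen q u) b := by
  have key := mk_rel q hab
  cases hab with
  | K_Kinv i => simpa [twistGen] using key
  | Kinv_K i => simpa [twistGen] using key
  | K_K i j => simpa [twistGen] using key
  | K_h i j s => simpa [twistGen] using key
  | h_h i j s t => simpa [twistGen] using key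
  | K_X ε i j n =>
    simp only [map_mul, map_smul, FreeAlgebra.lift_ι_apply, twistGen] at key ⊢
    rw [mul_smul_comm, smul_mul_assoc, key, smul_comm]
  | h_X ε i j s n =>
    simp only [map_mul, map_sub, map_smul, FreeAlgebra.lift_ι_apply, twistGen] at key ⊢
    rw [mul_smul_comm, smul_mul_assoc, ← smul_sub, key, smul_comm]
  | X_X i j m n =>
    by_cases hij : i = j
    · subst hij
      simp only [map_sbr, if_true, map_sub, map_smul, map_phi, FreeAlgebra.lift_ι_apply] at key ⊢
      rw [show phi q (fun g => twistGen q u g) 1 i (m + n) = phi q (gen q) 1 i (m + n) from rfl,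
        show phi q (fun g => twistGen q u g) (-1) i (m + n) = phi q (gen q) (-1) i (m + n) from rfl]
      simp only [twistGen, sbr_smul, key]
      simp
    · simp only [map_sbr, if_neg hij, map_zero, FreeAlgebra.lift_ι_apply, twistGen,
        sbr_smul] at key ⊢
      rw [key, smul_zero]
  | quad_zero ε i j m n hc =>
    simp only [map_sbr, map_zero, FreeAlgebra.lift_ι_apply, twistGen, sbr_smul] at key ⊢
    rw [key, smul_zero]
  | quad ε i j m n hc =>
    simp only [map_mul, map_sub, map_smul, FreeAlgebra.lift_ι_apply, twistGen,
      smul_mul_smul_comm] at key ⊢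
    rw [mul_comm ((u j ^ (ε : ℤ) : ℂˣ) : ℂ), smul_comm _ (_ * _ : ℂ), ← smul_sub, key, smul_sub,
      smul_comm _ (_ * _ : ℂ)]
  | serre ε i j m n k hc hi =>
    simp only [map_sbr, map_add, map_zero, FreeAlgebra.lift_ι_apply, twistGen, sbr_smul] at key ⊢
    rw [← smul_add, key, smul_zero]
  | osc ε a b c m n k u' ha hb hc =>
    simp only [map_sbr, map_add, map_zero, FreeAlgebra.lift_ι_apply, twistGen, sbr_smul] at key ⊢
    rw [← smul_add, key, smul_zero]

/-- The endomorphism of `U_q(L sl(M,N))` fixing all `K_i^{±1}`, `h_{i,s}` and multiplying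
`X_{i,n}^±` by `(u i)^{±1}`. -/
def twist (u : Node M N → ℂˣ) : U q M N →ₐ[ℂ] U q M N :=
  liftU q (FreeAlgebra.lift ℂ (twistGen q u)) fun _ _ h => twist_rel q u h

theorem twist_gen (u : Node M N → ℂˣ) (g : Gen M N) : twist q u (gen q g) = twistGen q u g := by
  simp [twist, gen, liftU_toU]

/-- The action of the extra generator `K_0` on `U_q(L sl(M,N))`:
`K_0 X_{i,n}^± K_0⁻¹ = q^{±δ_{i,1}} X_{i,n}^±`, and `K_0` commutes with the `K_i`, `h_{i,s}`.
The enlarged algebra is `U_q(L' sl(M,N)) = U_q(L sl(M,N)) ⋊ ℂ[K_0, K_0⁻¹]`. -/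
def sigma (M N : ℕ) : U q M N →ₐ[ℂ] U q M N := twist q fun i => if i.1 = 1 then q else 1

end Twist

/-- `Q(z) f(z) = 0` for a polynomial `Q` and a formal series `f = ∑_{n ∈ ℤ} f_n z^n`. -/
def Annihilates (Q : Polynomial ℂ) (f : ℤ → ℂ) : Prop :=
  ∀ n : ℤ, ∑ s ∈ Finset.range (Q.natDegree + 1), Q.coeff s * f (n - s) = 0

/-- The set of highest weights `(P, f, c)`. -/
structure HighestWeight (q : ℂˣ) (M N : ℕ) where
  P : {i : Node M N // i.1 ≠ M} → Polynomial ℂ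
  P_zero : ∀ i, (P i).coeff 0 = 1
  f : ℤ → ℂ
  f_torsion : ∃ R : Polynomial ℂ, R ≠ 0 ∧ Annihilates R f
  c : ℂˣ
  f_zero : ((c : ℂ) - ((c⁻¹ : ℂˣ) : ℂ)) / ((q : ℂ) - ((q⁻¹ : ℂˣ) : ℂ)) = f 0

/-- The expansion of `p^{deg P} P(z p⁻¹) / P(z p)` as a power series in `z` (`ε = 1`, expansion at
`z = 0`), respectively in `z⁻¹` (`ε = -1`, expansion at `z = ∞`: numerator and denominator have the
same degree, and `Polynomial.reverse` is their expression in `z⁻¹` after dividing by `z^{deg}`). -/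
def evenSeries (p : ℂˣ) (P : Polynomial ℂ) (ε : ℤˣ) : PowerSeries ℂ :=
  let num : Polynomial ℂ := P.comp (Polynomial.C ((p⁻¹ : ℂˣ) : ℂ) * Polynomial.X)
  let den : Polynomial ℂ := P.comp (Polynomial.C (p : ℂ) * Polynomial.X)
  if ε = 1 then
    PowerSeries.C ((p : ℂ) ^ P.natDegree) * ((num : PowerSeries ℂ) * (den : PowerSeries ℂ)⁻¹)
  else
    PowerSeries.C ((p : ℂ) ^ P.natDegree) *
      ((num.reverse : PowerSeries ℂ) * (den.reverse : PowerSeries ℂ)⁻¹)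

section WeylModule

variable {q : ℂˣ} {M N : ℕ}

/-- The elements of `U_q(L sl(M,N))` that the defining relations of the Weyl module `W(P,f,c;Q)`
send the generator `v` to zero by. -/
inductive WeylRel (Λ : HighestWeight q M N) (Q : Polynomial ℂ) : U q M N → Prop
  | raise (i : Node M N) (n : ℤ) : WeylRel Λ Q (gen q (.X 1 i n))
  | even (i : {i : Node M N // i.1 ≠ M}) (ε : ℤˣ) (n : ℕ) :
      WeylRel Λ Q (phi q (gen q) ε i.1 ((ε : ℤ) * n) -
        algebraMap ℂ (U q M N)
          (PowerSeries.coeff n (evenSeries (qn q M i.1.1) (Λ.P i) ε)))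
  | odd_K (i : Node M N) (hi : i.1 = M) :
      WeylRel Λ Q (gen q (.K i) - algebraMap ℂ (U q M N) (Λ.c : ℂ))
  | odd_phi (i : Node M N) (hi : i.1 = M) (n : ℤ) :
      WeylRel Λ Q (((q : ℂ) - ((q⁻¹ : ℂˣ) : ℂ))⁻¹ •
          (phi q (gen q) 1 i n - phi q (gen q) (-1) i n) - algebraMap ℂ (U q M N) (Λ.f n))
  | lower_even (i : {i : Node M N // i.1 ≠ M}) :
      WeylRel Λ Q (gen q (.X (-1) i.1 0) ^ (1 + (Λ.P i).natDegree))
  /- `∑_s a_{d-s} X_{M,s+n}^- v = 0`, required for `n = 0` only, unless `M = N = 1`. -/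
  | lower_odd (i : Node M N) (hi : i.1 = M) (n : ℤ) (hn : n = 0 ∨ (M = 1 ∧ N = 1)) :
      WeylRel Λ Q (∑ s ∈ Finset.range (Q.natDegree + 1),
        Q.coeff (Q.natDegree - s) • gen q (.X (-1) i (s + n)))

/-- The left ideal annihilating the generator of the Weyl module. -/
def weylIdeal (Λ : HighestWeight q M N) (Q : Polynomial ℂ) : Submodule (U q M N) (U q M N) :=
  Submodule.span (U q M N) {x | WeylRel Λ Q x}

/-- The Weyl module `W(P,f,c;Q)`: the `U_q(L sl(M,N))`-module generated by a vector `v` (the class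
of `1`) subject to the relations above. -/
abbrev Weyl (Λ : HighestWeight q M N) (Q : Polynomial ℂ) : Type := U q M N ⧸ weylIdeal Λ Q

/-- The generating vector `v`. -/
def hwVector (Λ : HighestWeight q M N) (Q : Polynomial ℂ) : Weyl Λ Q :=
  Submodule.Quotient.mk 1

theorem twist_phi (u : Node M N → ℂˣ) (ε : ℤˣ) (i : Node M N) (n : ℤ) :
    twist q u (phi q (gen q) ε i n) = phi q (gen q) ε i n := by
  rw [map_phi]
  simp only [twist_gen]
  rfl

theorem twist_weylIdeal (u : Node M N → ℂˣ) (Λ : HighestWeight q M N) (Q : Polynomial ℂ)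
    (x : U q M N) (hx : x ∈ weylIdeal Λ Q) : twist q u x ∈ weylIdeal Λ Q := by
  have smul_mem : ∀ (a : ℂ) (y : U q M N), WeylRel Λ Q y → a • y ∈ weylIdeal Λ Q := by
    intro a y hy
    rw [Algebra.smul_def]
    exact Submodule.smul_mem _ _ (Submodule.subset_span hy)
  induction hx using Submodule.span_induction with
  | zero => simp
  | add x y _ _ hx hy => rw [map_add]; exact Submodule.add_mem _ hx hy
  | smul a x _ hx =>
    rw [smul_eq_mul, map_mul]
    exact Submodule.smul_mem _ (twist q u a) hx
  | mem x hx =>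
    have hx' : WeylRel Λ Q x := hx
    cases hx' with
    | raise i n =>
      rw [twist_gen]
      exact smul_mem _ _ (WeylRel.raise i n)
    | even i ε n =>
      rw [map_sub, twist_phi, AlgHom.commutes]
      exact Submodule.subset_span hx
    | odd_K i hi =>
      rw [map_sub, twist_gen, AlgHom.commutes]
      exact Submodule.subset_span hx
    | odd_phi i hi n =>
      rw [map_sub, map_smul, map_sub, twist_phi, twist_phi, AlgHom.commutes]
      exact Submodule.subset_span hx
    | lower_even i =>
      rw [map_pow, twist_gen]
      simp only [twistGen, smul_pow]
      exact smul_mem _ _ (WeylRel.lower_even i)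
    | lower_odd i hi n hn =>
      have := smul_mem (((u i) ^ ((-1 : ℤˣ) : ℤ) : ℂˣ) : ℂ) _ (WeylRel.lower_odd i hi n hn)
      rw [Finset.smul_sum] at this
      simp only [map_sum, map_smul, twist_gen, twistGen]
      simpa only [smul_comm (((u i) ^ ((-1 : ℤˣ) : ℤ) : ℂˣ) : ℂ)] using this

/-- The endomorphism `sigma` as a semilinear self-map of the regular module. -/
def sigmaSemilinear (q : ℂˣ) (M N : ℕ) :
    U q M N →ₛₗ[(sigma q M N : U q M N →+* U q M N)] U q M N where
  toFun x := sigma q M N x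
  map_add' x y := map_add _ x y
  map_smul' a x := by simp [smul_eq_mul]

/-- The map `x v ↦ sigma(x) v` on the Weyl module. -/
def KzeroSemilinear (Λ : HighestWeight q M N) (Q : Polynomial ℂ) :
    Weyl Λ Q →ₛₗ[(sigma q M N : U q M N →+* U q M N)] Weyl Λ Q :=
  Submodule.mapQ (weylIdeal Λ Q) (weylIdeal Λ Q) (sigmaSemilinear q M N)
    (fun x hx => twist_weylIdeal _ Λ Q x hx)

/-- The action of `K_0` on the Weyl module: `K_0 (x v) = (K_0 x K_0⁻¹) v`, so `K_0 v = v`. -/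
def Kzero (Λ : HighestWeight q M N) (Q : Polynomial ℂ) : Module.End ℂ (Weyl Λ Q) where
  toFun := KzeroSemilinear Λ Q
  map_add' x y := map_add _ x y
  map_smul' a w := by
    rw [← algebraMap_smul (U q M N) a w, LinearMap.map_smulₛₗ, RingHom.coe_coe, AlgHom.commutes,
      algebraMap_smul, RingHom.id_apply]

theorem Kzero_hwVector (Λ : HighestWeight q M N) (Q : Polynomial ℂ) :
    Kzero Λ Q (hwVector Λ Q) = hwVector Λ Q := by
  change Submodule.Quotient.mk (sigma q M N 1) = _
  rw [map_one]
  rfl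

theorem Kzero_smul (Λ : HighestWeight q M N) (Q : Polynomial ℂ) (x : U q M N) (w : Weyl Λ Q) :
    Kzero Λ Q (x • w) = sigma q M N x • Kzero Λ Q w :=
  LinearMap.map_smulₛₗ (KzeroSemilinear Λ Q) x w

/-- The action of an element of `U_q(L sl(M,N))` on the Weyl module. -/
def act (Λ : HighestWeight q M N) (Q : Polynomial ℂ) (x : U q M N) : Module.End ℂ (Weyl Λ Q) :=
  Algebra.lsmul ℂ ℂ (Weyl Λ Q) x

/-- The operators `K_0` (for `none`) and `K_i`, `1 ≤ i ≤ M+N-1`, on the Weyl module. -/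
def Kop (Λ : HighestWeight q M N) (Q : Polynomial ℂ) : Option (Node M N) → Module.End ℂ (Weyl Λ Q)
  | none => Kzero Λ Q
  | some i => act Λ Q (gen q (.K i))

end WeylModule

/-- Weights: characters of the Laurent polynomial algebra in `K_0, K_1, …, K_{M+N-1}`, given by
the images of `K_0` (`none`) and of the `K_i` (`some i`). The group law is written
multiplicatively. -/
abbrev Weight (M N : ℕ) : Type := Option (Node M N) → ℂˣ

/-- The simple root `α_i`: `K_0 ↦ q^{δ_{i,1}}`, `K_j ↦ q^{c_{ij}}`. -/
def simpleRoot (q : ℂˣ) {M N : ℕ} (i : Node M N) : Weight M N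
  | none => if i.1 = 1 then q else 1
  | some j => q ^ cartan M i.1 j.1

section WeightSpaces

variable {q : ℂˣ} {M N : ℕ}

/-- The weight `λ` of the generator: `K_0 ↦ 1`, `K_M ↦ c`, `K_i ↦ q_i^{deg P_i}` for `i ≠ M`. -/
def HighestWeight.wt (Λ : HighestWeight q M N) : Weight M N
  | none => 1
  | some i => if hi : i.1 = M then Λ.c else qn q M i.1 ^ (Λ.P ⟨i, hi⟩).natDegree

/-- The weight space `W_μ = {w | K_i w = μ(K_i) w for 0 ≤ i ≤ M+N-1}`. -/
def weightSpace (Λ : HighestWeight q M N) (Q : Polynomial ℂ) (μ : Weight M N) :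
    Submodule ℂ (Weyl Λ Q) :=
  ⨅ k : Option (Node M N), (Kop Λ Q k).eigenspace (μ k : ℂ)

theorem h_mem_weightSpace (Λ : HighestWeight q M N) (Q : Polynomial ℂ) (μ : Weight M N)
    (i : Node M N) (s : {s : ℤ // s ≠ 0}) (w : Weyl Λ Q) (hw : w ∈ weightSpace Λ Q μ) :
    act Λ Q (gen q (.h i s)) w ∈ weightSpace Λ Q μ := by
  simp only [weightSpace, Submodule.mem_iInf, Module.End.mem_eigenspace_iff] at hw ⊢
  intro k
  have hk := hw k
  cases k with
  | none =>
    change Kzero Λ Q (gen q (.h i s) • w) = _ • (gen q (.h i s) • w)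
    change Kzero Λ Q w = _ at hk
    rw [Kzero_smul, sigma, twist_gen, hk, smul_comm]
    rfl
  | some j =>
    change gen q (.K j) • (gen q (.h i s) • w) = _ • (gen q (.h i s) • w)
    change gen q (.K j) • w = _ at hk
    have e := mk_rel q (Rel.K_h j i s)
    simp only [map_mul, FreeAlgebra.lift_ι_apply] at e
    rw [smul_smul, e, mul_smul, hk, smul_comm]

/-- The operator `h_{i,s}` on the weight space `W_μ`. -/
def hOnWeightSpace (Λ : HighestWeight q M N) (Q : Polynomial ℂ) (μ : Weight M N)
    (i : Node M N) (s : {s : ℤ // s ≠ 0}) : Module.End ℂ (weightSpace Λ Q μ) :=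
  (act Λ Q (gen q (.h i s))).restrict (h_mem_weightSpace Λ Q μ i s)

/-- `θ_i = - Res(z^{-2} P_i(z) dz)`, minus the coefficient of `z` in `P_i`. -/
def HighestWeight.theta (Λ : HighestWeight q M N) (i : {i : Node M N // i.1 ≠ M}) : ℂ :=
  -(Λ.P i).coeff 1

end WeightSpaces

end QAffSuper

end

/-! The upper bound is a spanning argument. Commuting generators to the right shows that the
monomials in the `X_{i,n}^-` applied to `v` span `W` (`wordSpan_eq_top`). Since `q` is not a root of
unity and `K_0` is available, the weight of a monomial determines how often each node occurs in it,
so `W_λ` is spanned by `v` and `W_{λ-α_M}` by the vectors `X_{M,n}^- v`, `n ∈ ℤ` (`weightSpace_wt`,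
`weightSpace_wt_div`). On these vectors `h_{M-1,±1}` acts as a scalar plus the shift `n ↦ n ± 1`;
the node `M-1` exists because `M > 1`. The single odd lowering relation therefore propagates to all
its shifts (`sum_X_smul_hwVector`). As the first and last coefficients of `Q` are nonzero, `d`
consecutive vectors suffice.

The lower bound needs a module in which nothing more collapses, and it is obtained without any PBW
theorem. On the space of all words in free letters `X_{i,n}^-`, let the `K_i`, `h_{i,s}` act by
moving through the letters and let `X_{i,n}^+` act by removing letters at the cost of `φ^+ - φ^-`.
This satisfies the Cartan relations and the relations between `X^+` and `X^-`, but none among the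
`X^-` or among the `X^+` (`basicRels_wordOp`). Let `R` be `ℂ[z]` modulo the reverse of `Q`, and `ζ`
the class of `z`, a unit because the constant term of the reverse is the leading coefficient of `Q`.
The map `top` sends the empty word to `(1,0)`, the word `X_{M,n}^-` to `(0, ζ^n)` and every other
word to zero. Let `maxSub` be the largest subspace of its kernel stable under the `X^+`; it is
stable under all generators.

On the quotient by `maxSub` the missing relations hold automatically. An operator killing `v` and
super-commuting with all `X^-` is zero, since `v` generates; an operator with image in the kernel of
`top` and super-commuting with all `X^+` is zero, by maximality of `maxSub`. So for each quadratic,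
Serre or degree four relation it is enough that its left side super-commutes with the opposite
currents (`BasicRels.lift_eq`). Such a commutator replaces one current `X_i` by `φ_i^±`, and the
resulting identity follows from the exchange relation of `φ_i^±` with the other currents, because
`φ_i^±` is a one-sided series, on which the polynomial factors needed to clear poles act injectively
(`eq_zero_of_halfSupported`).

It remains to see that the vacuum satisfies the relations of `v`. The odd lowering vector is killed
by every `X^+` because `Q f = 0`, and by `top` because `ζ` is a root of the reverse of `Q`
(`sum_down_mem_maxSub`). For an even node, `(X_{i,0}^-)^{1+deg P_i}` applied to the vacuum must lie
in `maxSub`. This is a statement about one node; it is read off from an explicit module with basis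
the subsets of a set with `deg P_i` elements (`raiseOp_lowOp_phi`), whose formulas require distinct
spectral parameters, and the general case follows by continuity
(`upProd_pow_down_apply_nil_eq_zero`).

Altogether there is a linear map on `W` sending `v` to `(1,0)` and `X_{M,n}^- v` to `(0, ζ^n)`
(`exists_detect`). Powers of `ζ` span `R`, of dimension `d`, so together with the upper bound
`W_{λ-α_M} ≅ R`. Under this isomorphism `h_{M-1,1}` is multiplication by `ζ + θ_{M-1}`, and
multiplication by `ζ` has the reverse of `Q` as characteristic polynomial. -/

noncomputable section

namespace QAffSuper

/-! ### Exponentials of power series over a noncommutative ring, through their Euler equation. -/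

section Theta

variable {A : Type} [Ring A] [Algebra ℂ A]

/-- The Euler operator `t d/dt` on power series over a not necessarily commutative ring. -/
def theta (f : PowerSeries A) : PowerSeries A :=
  PowerSeries.mk fun n => (n : ℂ) • PowerSeries.coeff n f

@[simp] theorem coeff_theta (f : PowerSeries A) (n : ℕ) :
    PowerSeries.coeff n (theta f) = (n : ℂ) • PowerSeries.coeff n f := by
  simp [theta]

theorem theta_mul (f g : PowerSeries A) : theta (f * g) = theta f * g + f * theta g := by
  ext n
  simp only [coeff_theta, map_add, PowerSeries.coeff_mul, Finset.smul_sum, ← Finset.sum_add_distrib]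
  refine Finset.sum_congr rfl fun p hp => ?_
  rw [← Finset.HasAntidiagonal.mem_antidiagonal.mp hp, Nat.cast_add, add_smul, smul_mul_assoc,
    mul_smul_comm]

theorem theta_one : theta (1 : PowerSeries A) = 0 := by
  ext n
  cases n <;> simp [PowerSeries.coeff_one]

theorem theta_C (a : A) : theta (PowerSeries.C a) = 0 := by
  ext n
  cases n <;> simp [PowerSeries.coeff_C]

theorem theta_pow (g : PowerSeries A) (hg : Commute (theta g) g) (k : ℕ) :
    theta (g ^ k) = (k : ℂ) • (theta g * g ^ (k - 1)) := by
  induction k with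
  | zero => simp [theta_one]
  | succ k ih =>
    rw [pow_succ, theta_mul, ih, smul_mul_assoc, mul_assoc, ← (hg.pow_right k).eq]
    cases k with
    | zero => simp
    | succ k =>
      simp only [Nat.add_sub_cancel, ← pow_succ]
      rw [Nat.cast_succ (k + 1), add_smul, one_smul]

theorem commute_theta {g : PowerSeries A}
    (hg : ∀ m n, Commute (PowerSeries.coeff m g) (PowerSeries.coeff n g)) :
    Commute (theta g) g := by
  ext n
  rw [PowerSeries.coeff_mul, PowerSeries.coeff_mul, ← Finset.Nat.sum_antidiagonal_swap]
  refine Finset.sum_congr rfl fun p _ => ?_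
  simp only [coeff_theta, Prod.fst_swap, Prod.snd_swap, smul_mul_assoc, mul_smul_comm]
  rw [(hg p.2 p.1).eq]

omit [Algebra ℂ A] in
theorem coeff_pow_eq_zero {g : PowerSeries A} (h0 : PowerSeries.coeff 0 g = 0) {n k : ℕ}
    (h : n < k) : PowerSeries.coeff n (g ^ k) = 0 := by
  induction k generalizing n with
  | zero => omega
  | succ k ih =>
    rw [pow_succ, PowerSeries.coeff_mul]
    refine Finset.sum_eq_zero fun p hp => ?_
    have := Finset.HasAntidiagonal.mem_antidiagonal.mp hp
    rcases Nat.lt_or_ge p.1 k with h1 | h1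
    · rw [ih h1, zero_mul]
    · rw [show p.2 = 0 by omega, h0, mul_zero]

/-- The power series `exp g`, for `g` without constant term. -/
def expSeries (g : PowerSeries A) : PowerSeries A := PowerSeries.mk (expCoeff g)

/-- Powers `g ^ k` with `k > n` do not reach degree `n`, so the truncation of the exponential sum
may be moved to any bound `N ≥ n`. -/
theorem expCoeff_eq {g : PowerSeries A} (h0 : PowerSeries.coeff 0 g = 0) {n N : ℕ} (h : n ≤ N) :
    expCoeff g n =
      ∑ k ∈ Finset.range (N + 1), ((k.factorial : ℂ)⁻¹) • PowerSeries.coeff n (g ^ k) := by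
  refine Finset.sum_subset (Finset.range_subset_range.mpr (by omega)) fun k _ hk => ?_
  rw [coeff_pow_eq_zero h0 (by simpa using hk), smul_zero]

theorem expCoeff_zero (g : PowerSeries A) : expCoeff g 0 = 1 := by
  simp [expCoeff]

theorem theta_expSeries {g : PowerSeries A} (h0 : PowerSeries.coeff 0 g = 0)
    (hg : Commute (theta g) g) : theta (expSeries g) = theta g * expSeries g := by
  ext n
  have key : PowerSeries.coeff n (theta g * expSeries g) =
      PowerSeries.coeff n (theta g *
        ∑ k ∈ Finset.range (n + 1), ((k.factorial : ℂ)⁻¹) • g ^ k) := by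
    rw [PowerSeries.coeff_mul, PowerSeries.coeff_mul]
    refine Finset.sum_congr rfl fun p hp => ?_
    have := Finset.HasAntidiagonal.mem_antidiagonal.mp hp
    rw [expSeries, PowerSeries.coeff_mk, expCoeff_eq h0 (show p.2 ≤ n by omega)]
    simp
  -- The left side is truncated one term later than the right: its `k = 0` term is killed by the
  -- Euler operator, and the others, lowered by one, match the right side term by term.
  rw [key, coeff_theta, expSeries, PowerSeries.coeff_mk,
    expCoeff_eq h0 (show n ≤ n + 1 by omega), Finset.sum_range_succ']
  have hz : (n : ℂ) • ((((0 : ℕ).factorial : ℂ)⁻¹) • PowerSeries.coeff n (g ^ 0)) = 0 := by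
    cases n <;> simp [PowerSeries.coeff_one]
  rw [smul_add, hz, add_zero, Finset.smul_sum, Finset.mul_sum, map_sum]
  refine Finset.sum_congr rfl fun k _ => ?_
  rw [smul_comm, ← coeff_theta, theta_pow g hg, Nat.add_sub_cancel, mul_smul_comm]
  simp only [PowerSeries.coeff_smul, smul_smul]
  congr 1
  rw [Nat.factorial_succ]
  have : (k.factorial : ℂ) ≠ 0 := by exact_mod_cast k.factorial_ne_zero
  have : (k : ℂ) + 1 ≠ 0 := by exact_mod_cast k.succ_ne_zero
  push_cast
  field_simp

/-- A linear Euler equation has at most one solution with given constant term. -/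
theorem eq_of_theta_eq {H F G : PowerSeries A} (hH : PowerSeries.coeff 0 H = 0)
    (hF : theta F = H * F) (hG : theta G = H * G)
    (h0 : PowerSeries.coeff 0 F = PowerSeries.coeff 0 G) : F = G := by
  ext n
  induction n using Nat.strong_induction_on with
  | _ n ih =>
    rcases Nat.eq_zero_or_pos n with rfl | hn
    · exact h0
    · have e : (n : ℂ) • PowerSeries.coeff n F = (n : ℂ) • PowerSeries.coeff n G := by
        rw [← coeff_theta, ← coeff_theta, hF, hG, PowerSeries.coeff_mul, PowerSeries.coeff_mul]
        refine Finset.sum_congr rfl fun p hp => ?_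
        have := Finset.HasAntidiagonal.mem_antidiagonal.mp hp
        rcases Nat.eq_zero_or_pos p.1 with h | h
        · rw [h, hH, zero_mul, zero_mul]
        · rw [ih p.2 (by omega)]
      have hn' : (n : ℂ) ≠ 0 := by exact_mod_cast hn.ne'
      simpa [smul_smul, inv_mul_cancel₀ hn'] using congrArg ((n : ℂ)⁻¹ • ·) e

/-- The coefficients of `(1 - b⁻¹ t) / (1 - b t)`. -/
def moebiusCoeff (b : ℂˣ) (k : ℕ) : ℂ :=
  if k = 0 then 1 else (b : ℂ) ^ k - ((b⁻¹ : ℂˣ) : ℂ) * (b : ℂ) ^ (k - 1)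

theorem moebiusCoeff_succ_succ (b : ℂˣ) (k : ℕ) :
    moebiusCoeff b (k + 2) = b * moebiusCoeff b (k + 1) := by
  simp [moebiusCoeff]; ring

/-- This is the logarithmic derivative of `(1 - b⁻¹ t)/(1 - b t)`, namely `∑ (b^s - b^{-s}) t^s`, in
coefficients. -/
theorem moebiusCoeff_theta (b : ℂˣ) (m : ℕ) :
    (m : ℂ) * moebiusCoeff b m = ∑ p ∈ Finset.HasAntidiagonal.antidiagonal m,
      ((b : ℂ) ^ p.1 - ((b⁻¹ : ℂˣ) : ℂ) ^ p.1) * moebiusCoeff b p.2 := by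
  have hb : (b : ℂ) ≠ 0 := b.ne_zero
  -- Multiplying by `1/(1 - b⁻¹ t)` cancels the numerator and leaves `1/(1 - b t)`.
  have h2 : ∀ m : ℕ, ∑ p ∈ Finset.HasAntidiagonal.antidiagonal m, ((b⁻¹ : ℂˣ) : ℂ) ^ p.1 * moebiusCoeff b p.2
      = (b : ℂ) ^ m := by
    intro m
    induction m with
    | zero => simp [moebiusCoeff]
    | succ m ih =>
      rw [Finset.Nat.sum_antidiagonal_succ]
      simp only [pow_succ' ((b⁻¹ : ℂˣ) : ℂ), mul_assoc, ← Finset.mul_sum, ih]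
      simp [moebiusCoeff]
  have h1 : ∀ m : ℕ, ∑ p ∈ Finset.HasAntidiagonal.antidiagonal m, (b : ℂ) ^ p.1 * moebiusCoeff b p.2
      = (b : ℂ) ^ m + (m : ℂ) * moebiusCoeff b m := by
    intro m
    induction m with
    | zero => simp [moebiusCoeff]
    | succ m ih =>
      rw [Finset.Nat.sum_antidiagonal_succ]
      simp only [pow_succ' (b : ℂ), mul_assoc, ← Finset.mul_sum, ih]
      cases m with
      | zero => simp [moebiusCoeff]; ring
      | succ m =>
        rw [moebiusCoeff_succ_succ]
        simp [moebiusCoeff]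
        field_simp
        ring
  simp only [sub_mul, Finset.sum_sub_distrib]
  rw [h1, h2]
  ring

/-- Conjugation by an exponential of operators acting by shifts. -/
theorem exp_mul_shift {g : PowerSeries A} (h0 : PowerSeries.coeff 0 g = 0)
    (hg : Commute (theta g) g) (b : ℂˣ) (e : ℤ) (Y : ℤ → A)
    (hY : ∀ s n, PowerSeries.coeff s (theta g) * Y n - Y n * PowerSeries.coeff s (theta g)
      = ((b : ℂ) ^ s - ((b⁻¹ : ℂˣ) : ℂ) ^ s) • Y (n + e * s)) (m : ℕ) (n : ℤ) :
    expCoeff g (m + 1) * Y n - (b : ℂ) • (expCoeff g m * Y (n + e)) =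
      Y n * expCoeff g (m + 1) - ((b⁻¹ : ℂˣ) : ℂ) • (Y (n + e) * expCoeff g m) := by
  set E := expSeries g with hE
  set S : ℤ → PowerSeries A := fun n => PowerSeries.mk fun k => moebiusCoeff b k • Y (n + e * k)
    with hS
  have hEt := theta_expSeries h0 hg
  rw [← hE] at hEt
  -- Conjugating `Y n` by `exp g` gives the series `S n`. No inverse is needed: both sides solve `θ
  -- F = θ(g) F` with constant term `Y n`.
  have key : ∀ n, E * PowerSeries.C (Y n) = S n * E := by
    intro n
    refine eq_of_theta_eq (H := theta g) (by simp) ?_ ?_ ?_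
    · rw [theta_mul, theta_C, hEt, mul_zero, add_zero, mul_assoc]
    · rw [theta_mul, hEt, ← mul_assoc, ← mul_assoc, ← add_mul]
      congr 1
      ext m
      have h1 : PowerSeries.coeff m (theta (S n)) = ∑ p ∈ Finset.HasAntidiagonal.antidiagonal m,
          (((b : ℂ) ^ p.1 - ((b⁻¹ : ℂˣ) : ℂ) ^ p.1) * moebiusCoeff b p.2) • Y (n + e * m) := by
        rw [← Finset.sum_smul, ← moebiusCoeff_theta]
        simp [hS, smul_smul]
      have h2 : PowerSeries.coeff m (S n * theta g) =
          ∑ p ∈ Finset.HasAntidiagonal.antidiagonal m,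
            PowerSeries.coeff p.2 (S n) * PowerSeries.coeff p.1 (theta g) := by
        rw [PowerSeries.coeff_mul, ← Finset.Nat.sum_antidiagonal_swap]
        rfl
      rw [map_add, h1, h2, PowerSeries.coeff_mul, ← Finset.sum_add_distrib]
      refine Finset.sum_congr rfl fun p hp => ?_
      have hp' := Finset.HasAntidiagonal.mem_antidiagonal.mp hp
      have := hY p.1 (n + e * p.2)
      simp only [hS, PowerSeries.coeff_mk, smul_mul_assoc, mul_smul_comm]
      rw [show n + e * (m : ℤ) = n + e * p.2 + e * p.1 by rw [← hp']; push_cast; ring,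
        mul_comm (_ - _), mul_smul, ← this, smul_sub, sub_add_cancel]
    · rw [PowerSeries.coeff_mul_C, PowerSeries.coeff_mul]
      simp [hS, moebiusCoeff, hE, expSeries, expCoeff_zero]
  -- Clearing the denominator `1 - b t` of `(1 - b⁻¹ t)/(1 - b t)`, where `t` also moves the index
  -- of `Y` by `e`.
  have hS2 : S n - (b : ℂ) • (PowerSeries.X * S (n + e)) =
      PowerSeries.C (Y n) - ((b⁻¹ : ℂˣ) : ℂ) • (PowerSeries.X * PowerSeries.C (Y (n + e))) := by
    ext k
    rcases k with _ | _ | k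
    · simp [hS, moebiusCoeff]
    · simp [hS, moebiusCoeff, PowerSeries.coeff_succ_X_mul, sub_smul]
    · simp only [map_sub, PowerSeries.coeff_smul, PowerSeries.coeff_succ_X_mul, hS,
        PowerSeries.coeff_mk, moebiusCoeff_succ_succ]
      rw [show n + e + e * ((k + 1 : ℕ) : ℤ) = n + e * ((k + 1 + 1 : ℕ) : ℤ) by push_cast; ring]
      simp [smul_smul]
  have e1 : (S n - (b : ℂ) • (PowerSeries.X * S (n + e))) * E =
      E * PowerSeries.C (Y n) - (b : ℂ) • (PowerSeries.X * (E * PowerSeries.C (Y (n + e)))) := by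
    rw [sub_mul, smul_mul_assoc, mul_assoc PowerSeries.X, key, key]
  rw [hS2, sub_mul, smul_mul_assoc, mul_assoc] at e1
  have := congrArg (PowerSeries.coeff (m + 1)) e1
  simp only [map_sub, PowerSeries.coeff_smul, PowerSeries.coeff_succ_X_mul,
    PowerSeries.coeff_mul_C, PowerSeries.coeff_C_mul, hE, expSeries, PowerSeries.coeff_mk] at this
  exact this.symm

end Theta

/-! ### Consequences of `q` not being a root of unity. -/

section Scalars

variable {q : ℂˣ} (hq : ∀ n : ℕ, 0 < n → q ^ n ≠ 1)
include hq

theorem zpow_ne_one {n : ℤ} (hn : n ≠ 0) : q ^ n ≠ 1 := by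
  intro h
  refine hq n.natAbs (Int.natAbs_pos.mpr hn) ?_
  rcases Int.natAbs_eq n with e | e
  · rw [e, zpow_natCast] at h; exact h
  · rw [e, zpow_neg, inv_eq_one, zpow_natCast] at h; exact h

theorem zpow_injective : Function.Injective fun n : ℤ => q ^ n := by
  intro m n h
  by_contra hne
  refine zpow_ne_one hq (sub_ne_zero.mpr hne) ?_
  have h' : q ^ m = q ^ n := h
  rw [zpow_sub, h', mul_inv_cancel]

theorem qn_sub_inv_ne_zero (M i : ℕ) : (qn q M i : ℂ) - ((qn q M i)⁻¹ : ℂˣ) ≠ 0 := by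
  intro h
  have h' : qn q M i = (qn q M i)⁻¹ := Units.ext (sub_eq_zero.mp h)
  have := zpow_injective hq (a₁ := ell M i) (a₂ := - ell M i) (by simpa [qn, zpow_neg] using h')
  unfold ell at this
  split_ifs at this <;> omega

theorem qn_sub_inv_mul_qint (M i : ℕ) (s c : ℤ) :
    ((qn q M i : ℂ) - ((qn q M i)⁻¹ : ℂˣ)) * qint (qn q M i) (s * ell M i * c) =
      ((q ^ (s * c) : ℂˣ) : ℂ) - ((q ^ (-(s * c)) : ℂˣ) : ℂ) := by
  have hl : ell M i * ell M i = 1 := by unfold ell; split_ifs <;> norm_num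
  rw [qint, mul_div_cancel₀ _ (qn_sub_inv_ne_zero hq M i), qn, ← zpow_mul, ← zpow_mul]
  rw [show ell M i * (s * ell M i * c) = s * c by linear_combination (s * c) * hl,
    show ell M i * -(s * ell M i * c) = -(s * c) by linear_combination -(s * c) * hl]

end Scalars

/-! ### Exchange relation between `φ_i^±(z)` and the currents `X_j^±(w)`. -/

section Basic

variable {A : Type} [Ring A] [Algebra ℂ A]

/-- The relations of `U_q(L sl(M,N))` involving the `K_i` and the `h_{i,s}`. -/
structure CartanRels (q : ℂˣ) {M N : ℕ} (x : Gen M N → A) : Prop where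
  K_Kinv (i : Node M N) : x (.K i) * x (.Kinv i) = 1
  Kinv_K (i : Node M N) : x (.Kinv i) * x (.K i) = 1
  K_K (i j : Node M N) : x (.K i) * x (.K j) = x (.K j) * x (.K i)
  K_h (i j : Node M N) (s : {s : ℤ // s ≠ 0}) : x (.K i) * x (.h j s) = x (.h j s) * x (.K i)
  h_h (i j : Node M N) (s t : {s : ℤ // s ≠ 0}) :
    x (.h i s) * x (.h j t) = x (.h j t) * x (.h i s)
  K_X (ε : ℤˣ) (i j : Node M N) (n : ℤ) : x (.K i) * x (.X ε j n) =
    ((q ^ ((ε : ℤ) * cartan M i.1 j.1) : ℂˣ) : ℂ) • (x (.X ε j n) * x (.K i))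
  h_X (ε : ℤˣ) (i j : Node M N) (s : {s : ℤ // s ≠ 0}) (n : ℤ) :
    x (.h i s) * x (.X ε j n) - x (.X ε j n) * x (.h i s) =
      (((ε : ℤ) : ℂ) * (qint (qn q M i.1) (s.1 * ell M i.1 * cartan M i.1 j.1) / (s.1 : ℂ))) •
        x (.X ε j (n + s.1))

theorem coeff_zero_hSeries (q : ℂˣ) {M N : ℕ} (x : Gen M N → A) (ε : ℤˣ) (i : Node M N) :
    PowerSeries.coeff 0 (hSeries q x ε i) = 0 := by
  simp [hSeries]

theorem coeff_hSeries (q : ℂˣ) {M N : ℕ} (x : Gen M N → A) (ε : ℤˣ) (i : Node M N) {s : ℕ}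
    (hs : s ≠ 0) : PowerSeries.coeff s (hSeries q x ε i) =
      (((ε : ℤ) : ℂ) * ((qn q M i.1 : ℂ) - ((qn q M i.1)⁻¹ : ℂˣ))) •
      x (Gen.h i ⟨(ε : ℤ) * (s : ℤ), mul_ne_zero ε.ne_zero (by exact_mod_cast hs)⟩) := by
  simp [hSeries, hs]

theorem phi_of_neg (q : ℂˣ) {M N : ℕ} (x : Gen M N → A) (ε : ℤˣ) (i : Node M N) {n : ℤ}
    (hn : (ε : ℤ) * n < 0) : phi q x ε i n = 0 := by
  simp [phi, not_le.mpr hn]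

theorem phi_one_natCast (q : ℂˣ) {M N : ℕ} (x : Gen M N → A) (i : Node M N) (n : ℕ) :
    phi q x 1 i n = x (.K i) * expCoeff (hSeries q x 1 i) n := by
  simp [phi]

theorem phi_neg_one_neg_natCast (q : ℂˣ) {M N : ℕ} (x : Gen M N → A) (i : Node M N) (n : ℕ) :
    phi q x (-1) i (-(n : ℤ)) = x (.Kinv i) * expCoeff (hSeries q x (-1) i) n := by
  have : (-1 : ℤˣ) ≠ 1 := by decide
  simp [phi, this]

namespace CartanRels

variable {q : ℂˣ} {M N : ℕ} {x : Gen M N → A} (hx : CartanRels q x)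
include hx

theorem commute_theta_hSeries (ε : ℤˣ) (i : Node M N) :
    Commute (theta (hSeries q x ε i)) (hSeries q x ε i) := by
  refine commute_theta fun m n => ?_
  by_cases hm : m = 0
  · rw [hm, coeff_zero_hSeries]; exact Commute.zero_left _
  by_cases hn : n = 0
  · rw [hn, coeff_zero_hSeries]; exact Commute.zero_right _
  rw [coeff_hSeries _ _ _ _ hm, coeff_hSeries _ _ _ _ hn]
  exact ((show Commute _ _ from hx.h_h _ _ _ _).smul_left _).smul_right _

theorem Kinv_X (ε : ℤˣ) (i j : Node M N) (n : ℤ) : x (.Kinv i) * x (.X ε j n) =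
    ((q ^ ((ε : ℤ) * cartan M i.1 j.1) : ℂˣ)⁻¹ : ℂ) • (x (.X ε j n) * x (.Kinv i)) := by
  have h := congrArg (fun y => x (.Kinv i) * y * x (.Kinv i)) (hx.K_X ε i j n)
  simp only [mul_smul_comm, smul_mul_assoc] at h
  rw [← mul_assoc, hx.Kinv_K, one_mul, mul_assoc _ _ (x (.Kinv i)), mul_assoc _ _ (x (.Kinv i)),
    hx.K_Kinv, mul_one] at h
  rw [h, smul_smul, inv_mul_cancel₀ (Units.ne_zero _), one_smul]

/-- The factor `s` from the Euler operator cancels the `1/s` in the `h`-`X` relation, and `q_i -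
q_i⁻¹` cancels the denominator of the quantum integer. What is left is `b^s - b^{-s}`, the
hypothesis of `exp_mul_shift`. -/
theorem theta_hSeries_X (hq : ∀ n : ℕ, 0 < n → q ^ n ≠ 1) (ε' ε : ℤˣ) (i j : Node M N) (s : ℕ)
    (n : ℤ) :
    PowerSeries.coeff s (theta (hSeries q x ε' i)) * x (.X ε j n)
      - x (.X ε j n) * PowerSeries.coeff s (theta (hSeries q x ε' i))
      = ((((q ^ ((ε : ℤ) * cartan M i.1 j.1)) ^ (ε' : ℤ) : ℂˣ) : ℂ) ^ s -
          ((((q ^ ((ε : ℤ) * cartan M i.1 j.1)) ^ (ε' : ℤ))⁻¹ : ℂˣ) : ℂ) ^ s) •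
        x (.X ε j (n + ε' * s)) := by
  by_cases hs : s = 0
  · simp [hs]
  rw [coeff_theta, coeff_hSeries _ _ _ _ hs, smul_mul_assoc, smul_mul_assoc, mul_smul_comm,
    mul_smul_comm, ← smul_sub, ← smul_sub, hx.h_X, smul_smul, smul_smul]
  congr 1
  have hs' : (s : ℂ) ≠ 0 := by exact_mod_cast hs
  have hε' : (((ε' : ℤ) : ℂ)) ≠ 0 := by exact_mod_cast ε'.ne_zero
  have h1 := qn_sub_inv_mul_qint hq M i.1 ((ε' : ℤ) * s) (cartan M i.1 j.1)
  have h2 : (s : ℂ) * (((ε' : ℤ) : ℂ) * ((qn q M i.1 : ℂ) - ((qn q M i.1)⁻¹ : ℂˣ)) *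
      (((ε : ℤ) : ℂ) * (qint (qn q M i.1) ((ε' : ℤ) * s * ell M i.1 * cartan M i.1 j.1) /
        (((ε' : ℤ) * s : ℤ) : ℂ)))) =
      ((ε : ℤ) : ℂ) * (((q ^ (((ε' : ℤ) * s) * cartan M i.1 j.1) : ℂˣ) : ℂ) -
        ((q ^ (-(((ε' : ℤ) * s) * cartan M i.1 j.1)) : ℂˣ) : ℂ)) := by
    rw [← h1]
    push_cast
    field_simp
  rw [mul_assoc]
  refine h2.trans ?_
  rcases Int.units_eq_one_or ε with rfl | rfl <;> rcases Int.units_eq_one_or ε' with rfl | rfl <;>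
    simp [zpow_mul']

/-- The commutation of `φ_i^±(z)` with `X_j^±(w)`. -/
theorem phi_X (hq : ∀ n : ℕ, 0 < n → q ^ n ≠ 1) (ε' ε : ℤˣ) (i j : Node M N) (r n : ℤ) :
    phi q x ε' i r * x (.X ε j n) - ((q ^ ((ε : ℤ) * cartan M i.1 j.1) : ℂˣ) : ℂ) •
        (phi q x ε' i (r - 1) * x (.X ε j (n + 1))) =
      ((q ^ ((ε : ℤ) * cartan M i.1 j.1) : ℂˣ) : ℂ) • (x (.X ε j n) * phi q x ε' i r) -
        x (.X ε j (n + 1)) * phi q x ε' i (r - 1) := by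
  have hK := hx.K_X ε i j
  have hKi := hx.Kinv_X ε i j
  set a : ℂˣ := q ^ ((ε : ℤ) * cartan M i.1 j.1) with ha
  have ha0 : (a : ℂ) ≠ 0 := a.ne_zero
  have key := exp_mul_shift (coeff_zero_hSeries q x ε' i) (hx.commute_theta_hSeries ε' i)
    (a ^ (ε' : ℤ)) ε' (fun n => x (.X ε j n)) (hx.theta_hSeries_X hq ε' ε i j)
  rcases Int.units_eq_one_or ε' with rfl | rfl
  · obtain ⟨m, rfl | rfl⟩ := Int.eq_nat_or_neg r
    -- At `r = 0` only the constant term `K_i` of `φ^+` contributes, because `φ^+` vanishes in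
    -- negative degree; the relation is then the one between `K_i` and `X`.
    · rcases m with _ | m
      · rw [phi_of_neg q x 1 i (n := ((0 : ℕ) : ℤ) - 1) (by simp), phi_one_natCast, expCoeff_zero]
        simp [hK]
      · have k := key m n
        rw [show ((m + 1 : ℕ) : ℤ) - 1 = (m : ℤ) by push_cast; ring, phi_one_natCast,
          phi_one_natCast]
        simp only [Units.val_one, zpow_one] at k
        have k2 := congrArg (fun y => x (.K i) * y) k
        simp only [mul_sub, mul_smul_comm, ← mul_assoc, hK, smul_mul_assoc] at k2
        rw [smul_smul, Units.inv_mul, one_smul] at k2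
        simpa only [mul_assoc] using k2
    · rw [phi_of_neg q x 1 i (n := -(m : ℤ) - 1) (by simp; omega)]
      rcases m with _ | m
      · have := phi_one_natCast q x i 0
        simp only [Nat.cast_zero] at this
        simp [this, expCoeff_zero, hK]
      · rw [phi_of_neg q x 1 i (n := -((m + 1 : ℕ) : ℤ)) (by simp; omega)]
        simp
  · rcases lt_trichotomy r 1 with h | h | h
    -- For `φ^-` the expansion is in `z⁻¹`: `r` and `r - 1` correspond to the exponential
    -- coefficients `m` and `m + 1`. Hence the exponential identity is used at `n + 1` with
    -- parameter `a⁻¹` and multiplied by `a K_i⁻¹`. The case `r = 1` below is the boundary case.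
    · obtain ⟨m, rfl⟩ : ∃ m : ℕ, r = -(m : ℤ) := ⟨(-r).toNat, by omega⟩
      have k := key m (n + 1)
      rw [show -(m : ℤ) - 1 = -((m + 1 : ℕ) : ℤ) by push_cast; ring, phi_neg_one_neg_natCast,
        phi_neg_one_neg_natCast]
      simp only [Units.val_neg, Units.val_one, zpow_neg, zpow_one, inv_inv] at k
      have k2 := congrArg (fun y => (a : ℂ) • (x (.Kinv i) * y)) k
      simp only [add_neg_cancel_right, mul_sub, mul_smul_comm, ← mul_assoc, hKi, smul_mul_assoc,
        smul_sub, smul_smul, Units.mul_inv, one_smul, mul_inv_cancel₀ ha0] at k2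
      simp only [mul_assoc] at k2 ⊢
      rw [← neg_inj, neg_sub, neg_sub, k2]
    · subst h
      have := phi_neg_one_neg_natCast q x i 0
      simp only [Nat.cast_zero, neg_zero] at this
      rw [phi_of_neg q x (-1) i (n := 1) (by simp), sub_self, this]
      simp [expCoeff_zero, hKi, smul_smul, ha0]
    · rw [phi_of_neg q x (-1) i (n := r) (by simp; omega),
        phi_of_neg q x (-1) i (n := r - 1) (by simp; omega)]
      simp

end CartanRels

end Basic

end QAffSuper
end

noncomputable section

namespace QAffSuper

/-! ### Cubic and quartic identities for a one-sided series exchanging with currents. -/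

section Identities

variable {A : Type} [Ring A] [Algebra ℂ A]

/-- The quadratic relation `(z - a w) X(z) Y(w) = (a z - w) Y(w) X(z)`, in components. -/
def QuadRel (a : ℂ) (X Y : ℤ → A) : Prop :=
  ∀ m n, X (m + 1) * Y n - a • (Y n * X (m + 1)) = a • (X m * Y (n + 1)) - Y (n + 1) * X m

theorem QuadRel.symm {a : ℂ} {X Y : ℤ → A} (h : QuadRel a X Y) : QuadRel a Y X := by
  intro m n
  linear_combination (norm := module) h n m

theorem QuadRel.sub_eq_zero {a : ℂ} {X Y : ℤ → A} (h : QuadRel a X Y) (m n : ℤ) :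
    X m * Y n - a • (X (m - 1) * Y (n + 1)) - a • (Y n * X m) + Y (n + 1) * X (m - 1) = 0 := by
  have := h (m - 1) n
  rw [sub_add_cancel] at this
  linear_combination (norm := module) this

/-- A family is supported on one half of the integers. -/
def HalfSupported {β : Type} [Zero β] (F : ℤ → β) : Prop :=
  (∀ r < 0, F r = 0) ∨ (∀ r > 0, F r = 0)

/-- In generating series the hypothesis says that `(1 - a z w₁⁻¹)(1 - b z w₂⁻¹)` annihilates `T(z,
w₁, w₂)`. On series one-sided in `z` this factor is injective: vanishing propagates away from the
edge of the support, upwards by solving for the first term, downwards by solving for the last one,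
which needs `a b ≠ 0`. -/
theorem eq_zero_of_halfSupported {T : ℤ → ℤ → ℤ → A} {a b : ℂ} (ha : a ≠ 0) (hb : b ≠ 0)
    (hT : HalfSupported T)
    (h : ∀ r m n, T r m n - a • T (r - 1) (m + 1) n - b • T (r - 1) m (n + 1)
      + (a * b) • T (r - 1 - 1) (m + 1) (n + 1) = 0) (r m n : ℤ) : T r m n = 0 := by
  rcases hT with h0 | h0
  · have key : ∀ k : ℕ, ∀ r < (k : ℤ), ∀ m n, T r m n = 0 := by
      intro k
      induction k with
      | zero => intro r hr m n; rw [h0 r (by simpa using hr)]; rfl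
      | succ k ih =>
        intro r hr m n
        have := h r m n
        rw [ih (r - 1) (by push_cast at hr; omega), ih (r - 1) (by push_cast at hr; omega),
          ih (r - 1 - 1) (by push_cast at hr; omega)] at this
        simpa using this
    exact key (r.toNat + 1) r (by omega) m n
  · have key : ∀ k : ℕ, ∀ r > -(k : ℤ), ∀ m n, T r m n = 0 := by
      intro k
      induction k with
      | zero => intro r hr m n; rw [h0 r (by simpa using hr)]; rfl
      | succ k ih =>
        intro r hr m n
        have := h (r + 1 + 1) (m - 1) (n - 1)
        rw [ih (r + 1 + 1) (by push_cast at hr; omega),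
          ih (r + 1 + 1 - 1) (by push_cast at hr; omega),
          ih (r + 1 + 1 - 1) (by push_cast at hr; omega)] at this
        simpa [ha, hb] using this
    exact key ((-r).toNat + 1) r (by omega) m n

/-- For `a = 1` the exchange relation makes the commutator of `F r` and `X n` depend only on `r +
n`, so one-sidedness of `F` forces it to vanish. The third index of the general recursion is a dummy
here. -/
theorem commute_of_quadRel_one {F X : ℤ → A} (hF : HalfSupported F) (h : QuadRel 1 F X)
    (r n : ℤ) : F r * X n = X n * F r := by
  have key := eq_zero_of_halfSupported (T := fun r n _ => F r * X n - X n * F r) (a := 1) (b := 1)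
    one_ne_zero one_ne_zero
    (hF.imp (fun h r hr => by funext; simp [h r hr]) (fun h r hr => by funext; simp [h r hr]))
    (fun r m n => by
      have h1 := h.sub_eq_zero r m
      have h2 := h.sub_eq_zero (r - 1) m
      linear_combination (norm := module) h1 - h2) r n 0
  exact sub_eq_zero.mp key

/-- This is the Serre expression with the neighbouring current `X_j` replaced by `φ_j`, as it arises
from commuting with the opposite current of node `j`. -/
theorem serre_neighbour {F X : ℤ → A} {a : ℂ} (ha : a ≠ 0) (hF : HalfSupported F)
    (hFX : QuadRel a F X) (hX : QuadRel (a⁻¹ ^ 2) X X) (r m n : ℤ) :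
    X m * X n * F r - (a + a⁻¹) • (X m * F r * X n) + F r * X n * X m
      + (X n * X m * F r - (a + a⁻¹) • (X n * F r * X m) + F r * X m * X n) = 0 := by
  refine eq_zero_of_halfSupported (a := a) (b := a) ha ha
    (T := fun r m n => X m * X n * F r - (a + a⁻¹) • (X m * F r * X n) + F r * X n * X m
      + (X n * X m * F r - (a + a⁻¹) • (X n * F r * X m) + F r * X m * X n))
    (hF.imp (fun h r hr => by funext; simp [h r hr]) (fun h r hr => by funext; simp [h r hr]))
    (fun r m n => ?_) r m n
  have R := hFX.sub_eq_zero
  -- The terms in `R` carry `F` past the currents after the poles are cleared. The last term is the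
  -- multiple of the exchange relation of `X` with itself that the remainder requires.
  linear_combination (norm := skip) R r n * X m - a • (R (r - 1) n * X (m + 1))
    + a • (X n * R r m) - X (n + 1) * R (r - 1) m
    + (R r m * X n - a • (R (r - 1) m * X (n + 1)) + a • (X m * R r n) - X (m + 1) * R (r - 1) n)
    - (a + a⁻¹) • (X m * R r n - a • (X (m + 1) * R (r - 1) n)
      + (X n * R r m - a • (X (n + 1) * R (r - 1) m)))
    + ((a - a⁻¹) * a ^ 2) • (hX m n * F (r - 1))
  simp only [mul_add, add_mul, mul_sub, sub_mul, smul_mul_assoc, mul_smul_comm, smul_add, smul_sub,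
    mul_assoc, mul_zero, zero_mul, smul_zero]
  match_scalars <;> field_simp <;> ring

/-- This is the Serre expression with one of the two currents `X_i` replaced by `φ_i`. Here `F`
meets two different currents, so the two clearing factors have parameters `a⁻²` and `a`. -/
theorem serre_self {F X Z : ℤ → A} {a : ℂ} (ha : a ≠ 0) (hF : HalfSupported F)
    (hFX : QuadRel (a⁻¹ ^ 2) F X) (hFZ : QuadRel a F Z) (hXZ : QuadRel a X Z) (r n k : ℤ) :
    F r * X n * Z k + X n * F r * Z k - (a + a⁻¹) • (F r * Z k * X n)
      - (a + a⁻¹) • (X n * Z k * F r) + Z k * F r * X n + Z k * X n * F r = 0 := by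
  refine eq_zero_of_halfSupported (a := a⁻¹ ^ 2) (b := a) (pow_ne_zero 2 (inv_ne_zero ha)) ha
    (T := fun r n k => F r * X n * Z k + X n * F r * Z k - (a + a⁻¹) • (F r * Z k * X n)
      - (a + a⁻¹) • (X n * Z k * F r) + Z k * F r * X n + Z k * X n * F r)
    (hF.imp (fun h r hr => by funext; simp [h r hr]) (fun h r hr => by funext; simp [h r hr]))
    (fun r n k => ?_) r n k
  have R := hFX.sub_eq_zero
  have S := hFZ.sub_eq_zero
  linear_combination (norm := skip) R r n * Z k - a • (R (r - 1) n * Z (k + 1))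
    + (a⁻¹ ^ 2) • (X n * S r k) - X (n + 1) * S (r - 1) k
    - (a + a⁻¹) • (S r k * X n - (a⁻¹ ^ 2) • (S (r - 1) k * X (n + 1)) + a • (Z k * R r n)
      - Z (k + 1) * R (r - 1) n)
    + (X n * S r k - (a⁻¹ ^ 2) • (X (n + 1) * S (r - 1) k))
    + (Z k * R r n - a • (Z (k + 1) * R (r - 1) n))
    - ((a + a⁻¹) * (a - a⁻¹) * a⁻¹) • (hXZ n k * F (r - 1))
  simp only [mul_add, add_mul, mul_sub, sub_mul, smul_mul_assoc, mul_smul_comm, smul_add, smul_sub,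
    mul_assoc, mul_zero, zero_mul, smul_zero]
  match_scalars <;> field_simp <;> ring

/-- This is the degree four relation with the current of an outer node replaced by `φ` of that node,
which commutes with the current of the other outer node. It serves for both `M-1` and `M+1`, with
`a` and `a⁻¹` exchanged. -/
theorem oscillation_even {F B C : ℤ → A} {a : ℂ} (ha : a ≠ 0) (hF : HalfSupported F)
    (hFB : QuadRel a F B) (hFC : ∀ r k, F r * C k = C k * F r) (hBC : QuadRel a⁻¹ B C)
    (hB : ∀ m n, B m * B n + B n * B m = 0) (r n u k : ℤ) :
    F r * B n * C k * B u + C k * B n * F r * B u + B u * F r * B n * C k + B u * C k * B n * F r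
      - (a + a⁻¹) • (B u * F r * C k * B n)
      + (F r * B u * C k * B n + C k * B u * F r * B n + B n * F r * B u * C k
        + B n * C k * B u * F r - (a + a⁻¹) • (B n * F r * C k * B u)) = 0 := by
  refine eq_zero_of_halfSupported (a := a) (b := a) ha ha
    (T := fun r n u => F r * B n * C k * B u + C k * B n * F r * B u + B u * F r * B n * C k
      + B u * C k * B n * F r - (a + a⁻¹) • (B u * F r * C k * B n)
      + (F r * B u * C k * B n + C k * B u * F r * B n + B n * F r * B u * C k
        + B n * C k * B u * F r - (a + a⁻¹) • (B n * F r * C k * B u)))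
    (hF.imp (fun h r hr => by funext; simp [h r hr]) (fun h r hr => by funext; simp [h r hr]))
    (fun r n u => ?_) r n u
  have R := hFB.sub_eq_zero
  linear_combination (norm := skip)
    R r n * C k * B u - a • (R (r - 1) n * C k * B (u + 1)) + a • (B n * C k * R r u)
      - B (n + 1) * C k * R (r - 1) u
    + (R r u * C k * B n - a • (R (r - 1) u * C k * B (n + 1)) + a • (B u * C k * R r n)
      - B (u + 1) * C k * R (r - 1) n)
    + (C k * B n * R r u - a • (C k * B (n + 1) * R (r - 1) u))
    + (C k * B u * R r n - a • (C k * B (u + 1) * R (r - 1) n))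
    + (B u * R r n * C k - a • (B (u + 1) * R (r - 1) n * C k))
    + (B n * R r u * C k - a • (B (n + 1) * R (r - 1) u * C k))
    - (a + a⁻¹) • (B u * C k * R r n - a • (B (u + 1) * C k * R (r - 1) n)
      + (B n * C k * R r u - a • (B (n + 1) * C k * R (r - 1) u)))
    + (C k * (a • (hB n u * F r) - hB (n + 1) u * F (r - 1) - (a ^ 2) • (hB n (u + 1) * F (r - 1))
      + a • (hB (n + 1) (u + 1) * F (r - 1 - 1))))
    + (a • (hB n u * C k * F r) - hB (n + 1) u * C k * F (r - 1)
      - (a ^ 2) • (hB n (u + 1) * C k * F (r - 1)) + a • (hB (n + 1) (u + 1) * C k * F (r - 1 - 1)))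
    + (a - a⁻¹) • ((a ^ 2) • (hBC n k * B u * F (r - 1)) + (a ^ 2) • (hBC u k * B n * F (r - 1))
      + a • (B u * hBC n k * F (r - 1)) + a • (B n * hBC u k * F (r - 1))
      + a • (C k * hB n (u + 1) * F (r - 1)) - a • (hB (n + 1) u * C k * F (r - 1))
      - (a ^ 2) • (C (k + 1) * hB n u * F (r - 1)) + hB n u * C (k + 1) * F (r - 1))
  simp only [mul_add, add_mul, mul_sub, sub_mul, smul_mul_assoc, mul_smul_comm, smul_add, smul_sub,
    mul_assoc, mul_zero, zero_mul, smul_zero, hFC]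
  match_scalars <;> field_simp <;> ring

/-- This is what remains of the degree four relation when one of the two odd currents is replaced by
`φ_M`; the signs come from the other odd factors. As `φ_M` commutes with `X_M`, the poles to be
cleared lie only between `F` and the two outer currents. -/
theorem oscillation_odd {F X B C : ℤ → A} {a : ℂ} (ha : a ≠ 0) (hF : HalfSupported F)
    (hFX : QuadRel a F X) (hFC : QuadRel a⁻¹ F C) (hFB : ∀ r u, F r * B u = B u * F r)
    (hXB : QuadRel a X B) (hCB : QuadRel a⁻¹ C B) (hXC : ∀ m k, X m * C k = C k * X m)
    (r m k u : ℤ) :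
    X m * F r * C k * B u - X m * B u * C k * F r + C k * F r * X m * B u - C k * B u * X m * F r
      - B u * X m * F r * C k + F r * X m * B u * C k - B u * C k * F r * X m
      + F r * C k * B u * X m + (a + a⁻¹) • (B u * X m * C k * F r)
      - (a + a⁻¹) • (F r * X m * C k * B u) = 0 := by
  refine eq_zero_of_halfSupported (a := a) (b := a⁻¹) ha (inv_ne_zero ha)
    (T := fun r m k => X m * F r * C k * B u - X m * B u * C k * F r + C k * F r * X m * B u
      - C k * B u * X m * F r - B u * X m * F r * C k + F r * X m * B u * C k
      - B u * C k * F r * X m + F r * C k * B u * X m + (a + a⁻¹) • (B u * X m * C k * F r)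
      - (a + a⁻¹) • (F r * X m * C k * B u))
    (hF.imp (fun h r hr => by funext; simp [h r hr]) (fun h r hr => by funext; simp [h r hr]))
    (fun r m k => ?_) r m k
  have R := hFX.sub_eq_zero
  have S := hFC.sub_eq_zero
  have hXC' : ∀ m k w, X m * (C k * w) = C k * (X m * w) := fun r k w => by
    rw [← mul_assoc, hXC, mul_assoc]
  linear_combination (norm := skip)
    X m * S r k * B u - a • (X (m + 1) * S (r - 1) k * B u)
    + (C k * R r m * B u - a⁻¹ • (C (k + 1) * R (r - 1) m * B u))
    - (B u * X m * S r k - a • (B u * X (m + 1) * S (r - 1) k))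
    - (B u * C k * R r m - a⁻¹ • (B u * C (k + 1) * R (r - 1) m))
    + (R r m * B u * C k - a⁻¹ • (R (r - 1) m * B u * C (k + 1)) + a • (X m * B u * S r k)
      - X (m + 1) * B u * S (r - 1) k)
    + (S r k * B u * X m - a • (S (r - 1) k * B u * X (m + 1)) + a⁻¹ • (C k * B u * R r m)
      - C (k + 1) * B u * R (r - 1) m)
    - (a + a⁻¹) • (R r m * C k * B u - a⁻¹ • (R (r - 1) m * C (k + 1) * B u)
      + a • (X m * S r k * B u) - X (m + 1) * S (r - 1) k * B u)
    + (a - a⁻¹) • (a • (X m * hCB k u * F (r - 1)) - a⁻¹ • (C k * hXB m u * F (r - 1))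
      - hCB k u * X m * F (r - 1) + hXB m u * C k * F (r - 1))
  simp only [mul_add, add_mul, mul_sub, sub_mul, smul_mul_assoc, mul_smul_comm, smul_add, smul_sub,
    mul_assoc, mul_zero, zero_mul, smul_zero, hFB, hXC, hXC']
  match_scalars <;> field_simp <;> ring

end Identities

end QAffSuper
end

noncomputable section

namespace QAffSuper

/-! ### The Cartan matrix of `sl(M,N)` and parity signs. -/

section Cartan

variable {M N : ℕ}

theorem cartan_comm (M i j : ℕ) : cartan M i j = cartan M j i := by
  have h : ∀ a b, form M a b = form M b a := fun a b => by
    unfold form; split_ifs with h1 h2 h2 <;> simp_all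
  simp only [cartan, h j, h (j + 1)]
  ring

theorem cartan_self (M i : ℕ) : cartan M i i = ell M i + ell M (i + 1) := by
  simp [cartan, form]

theorem cartan_succ (M i : ℕ) : cartan M i (i + 1) = -ell M (i + 1) := by
  simp [cartan, form, show i ≠ i + 1 + 1 by omega]

theorem cartan_of_lt {M i j : ℕ} (h : i + 1 < j) : cartan M i j = 0 := by
  simp [cartan, form, show i ≠ j by omega, show i ≠ j + 1 by omega, show i + 1 ≠ j by omega]

theorem ell_sq (M i : ℕ) : ell M i = 1 ∨ ell M i = -1 := by
  unfold ell; split_ifs <;> simp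

theorem cartan_self_of_ne {M i : ℕ} (h : i ≠ M) : cartan M i i = 2 * ell M i := by
  rw [cartan_self]
  unfold ell
  split_ifs <;> omega

theorem cartan_self_odd (M : ℕ) : cartan M M M = 0 := by
  simp [cartan_self, ell]

/-- With `a = q^{±c_{ij}}`, this makes the exchange parameter of `X_i` with itself equal to `a⁻²`,
the numerical coincidence behind the Serre identities. -/
theorem cartan_self_of_neighbour {M i j : ℕ} (hi : i ≠ M)
    (h : cartan M i j = 1 ∨ cartan M i j = -1) : cartan M i i = -2 * cartan M i j := by
  rw [cartan_self_of_ne hi]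
  rcases lt_trichotomy i j with h1 | h1 | h1
  · rcases Nat.lt_or_ge (i + 1) j with h2 | h2
    · rw [cartan_of_lt h2] at h; omega
    · obtain rfl : j = i + 1 := by omega
      rw [cartan_succ]
      unfold ell
      split_ifs <;> omega
  · subst h1
    rw [cartan_self_of_ne hi] at h
    rcases ell_sq M i with e | e <;> rw [e] at h <;> omega
  · rcases Nat.lt_or_ge (j + 1) i with h2 | h2
    · rw [cartan_comm, cartan_of_lt h2] at h; omega
    · obtain rfl : i = j + 1 := by omega
      rw [cartan_comm, cartan_succ]
      ring

/-- The sign `(-1)^{|X_i||X_j|}`. -/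
def sg (i j : Node M N) : ℂ := (-1) ^ (par i * par j)

theorem sg_comm (i j : Node M N) : sg i j = sg j i := by
  rw [sg, sg, mul_comm]

theorem sg_mul_self (i j : Node M N) : sg i j * sg i j = 1 := by
  rw [sg, ← mul_pow]
  simp

theorem sg_ne_zero (i j : Node M N) : sg i j ≠ 0 := by
  intro h
  simpa [h] using sg_mul_self i j

theorem sg_of_ne_left {i : Node M N} (hi : i.1 ≠ M) (j : Node M N) : sg i j = 1 := by
  simp [sg, par, hi]

theorem sg_of_ne_right {j : Node M N} (i : Node M N) (hj : j.1 ≠ M) : sg i j = 1 := by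
  simp [sg, par, hj]

theorem sg_odd {i j : Node M N} (hi : i.1 = M) (hj : j.1 = M) : sg i j = -1 := by
  simp [sg, par, hi, hj]

/-- The only pair of nodes with a sign is `(M, M)`, and there the Cartan entry is zero. Exchange
relations with `c_{ij} ≠ 0` therefore carry no sign. -/
theorem sg_eq_one {i j : Node M N} (h : cartan M i.1 j.1 ≠ 0) : sg i j = 1 := by
  by_cases hi : i.1 = M
  · by_cases hj : j.1 = M
    · rw [hi, hj, cartan_self_odd] at h
      exact absurd rfl h
    · exact sg_of_ne_right i hj
  · exact sg_of_ne_left hi j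

end Cartan

/-! ### The relations that hold before any relation among equal-sign currents is known. -/

section Relations

variable {A : Type} [Ring A] [Algebra ℂ A]

theorem sbr_eq {M N : ℕ} (i j : Node M N) (a b : A) :
    sbr (par i) (par j) 1 a b = a * b - sg i j • (b * a) := by
  simp [sbr, sg]

/-- The relations of `U_q(L sl(M,N))` other than those among the `X^+` or among the `X^-`. -/
structure BasicRels (q : ℂˣ) {M N : ℕ} (x : Gen M N → A) : Prop extends CartanRels q x where
  X_X (i j : Node M N) (m n : ℤ) :
    x (.X 1 i m) * x (.X (-1) j n) - sg i j • (x (.X (-1) j n) * x (.X 1 i m)) =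
      if i = j then ((qn q M i.1 : ℂ) - ((qn q M i.1)⁻¹ : ℂˣ))⁻¹ •
            (phi q x 1 i (m + n) - phi q x (-1) i (m + n))
          else 0

/-- The super-commutator of `X_{i,m}^{-ε}` and `X_{i,n}^ε` with `m + n = r`. -/
def psi (q : ℂˣ) {M N : ℕ} (x : Gen M N → A) (ε : ℤˣ) (i : Node M N) (r : ℤ) : A :=
  ((if ε = 1 then - sg i i else 1) * ((qn q M i.1 : ℂ) - ((qn q M i.1)⁻¹ : ℂˣ))⁻¹) •
    (phi q x 1 i r - phi q x (-1) i r)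

namespace CartanRels

variable {q : ℂˣ} {M N : ℕ} {x : Gen M N → A} (hx : CartanRels q x)
  (hq : ∀ n : ℕ, 0 < n → q ^ n ≠ 1)
include hx hq

theorem quadRel_phi (ε' ε : ℤˣ) (i j : Node M N) :
    QuadRel ((q ^ ((ε : ℤ) * cartan M i.1 j.1) : ℂˣ) : ℂ) (phi q x ε' i)
      (fun n => x (.X ε j n)) := by
  intro m n
  have h := hx.phi_X hq ε' ε i j (m + 1) n
  rw [add_sub_cancel_right] at h
  linear_combination (norm := module) h

omit hx hq in
theorem halfSupported_phi (ε : ℤˣ) (i : Node M N) : HalfSupported (phi q x ε i) := by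
  rcases Int.units_eq_one_or ε with rfl | rfl
  · exact Or.inl fun r hr => phi_of_neg q x 1 i (by simpa using hr)
  · exact Or.inr fun r hr => phi_of_neg q x (-1) i (by simpa using hr)

theorem phi_X_commute (ε' ε : ℤˣ) {i j : Node M N} (hc : cartan M i.1 j.1 = 0) (r n : ℤ) :
    phi q x ε' i r * x (.X ε j n) = x (.X ε j n) * phi q x ε' i r := by
  have h := hx.quadRel_phi hq ε' ε i j
  rw [hc, mul_zero, zpow_zero, Units.val_one] at h
  exact commute_of_quadRel_one (halfSupported_phi ε' i) h r n

theorem psi_X_commute (ε' ε : ℤˣ) {i j : Node M N} (hc : cartan M i.1 j.1 = 0) (r n : ℤ) :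
    psi q x ε' i r * x (.X ε j n) = x (.X ε j n) * psi q x ε' i r := by
  simp only [psi, smul_mul_assoc, mul_smul_comm, sub_mul, mul_sub, hx.phi_X_commute hq _ ε hc]

theorem quadRel_psi (ε' ε : ℤˣ) (i j : Node M N) :
    QuadRel ((q ^ ((ε : ℤ) * cartan M i.1 j.1) : ℂˣ) : ℂ) (psi q x ε' i)
      (fun n => x (.X ε j n)) := by
  intro m n
  have h1 := hx.quadRel_phi hq 1 ε i j m n
  have h2 := hx.quadRel_phi hq (-1) ε i j m n
  simp only [psi, smul_mul_assoc, mul_smul_comm, sub_mul, mul_sub]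
  linear_combination (norm := module)
    ((if ε' = 1 then - sg i i else 1) * ((qn q M i.1 : ℂ) - ((qn q M i.1)⁻¹ : ℂˣ))⁻¹) • h1 -
    ((if ε' = 1 then - sg i i else 1) * ((qn q M i.1 : ℂ) - ((qn q M i.1)⁻¹ : ℂˣ))⁻¹) • h2

end CartanRels

/-- Lets `simp` push an opposite current through a right-associated product, leaving the correction
term behind. -/
theorem mul_mul_of_comm {Y X d : A} {s : ℂ} (h : Y * X = s • (X * Y) + d) (w : A) :
    Y * (X * w) = s • (X * (Y * w)) + d * w := by
  rw [← mul_assoc, h, add_mul, smul_mul_assoc, mul_assoc]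

theorem mul_mul_of_smul_comm {Y X : A} {s : ℂ} (h : Y * X = s • (X * Y)) (w : A) :
    Y * (X * w) = s • (X * (Y * w)) := by
  rw [← mul_assoc, h, smul_mul_assoc, mul_assoc]

namespace BasicRels

variable {q : ℂˣ} {M N : ℕ} {x : Gen M N → A} (hx : BasicRels q x)
include hx

/-- One form for both signs, so that each relation need only be verified once for raising and
lowering currents together. For `ε = 1` the relation between `X^+` and `X^-` has to be solved for
the other product, whence the factor `-sg` in `psi`. -/
theorem comm_X (ε : ℤˣ) (k j : Node M N) (p n : ℤ) :
    x (.X (-ε) k p) * x (.X ε j n) = sg k j • (x (.X ε j n) * x (.X (-ε) k p)) +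
      if k = j then psi q x ε j (p + n) else 0 := by
  rcases Int.units_eq_one_or ε with rfl | rfl
  · have h := hx.X_X j k n p
    have h2 : x (.X (-1) k p) * x (.X 1 j n) = sg j k • (x (.X 1 j n) * x (.X (-1) k p)) -
        sg j k • (x (.X 1 j n) * x (.X (-1) k p)
          - sg j k • (x (.X (-1) k p) * x (.X 1 j n))) := by
      rw [smul_sub, smul_smul, sg_mul_self, one_smul]; abel
    rw [h2, h, sg_comm k j]
    by_cases hjk : j = k
    · subst hjk
      simp only [if_true, psi, add_comm p n, neg_mul, neg_smul, mul_smul]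
      abel
    · simp [hjk, Ne.symm hjk]
  · have h := hx.X_X k j p n
    have hne : (-1 : ℤˣ) ≠ 1 := by decide
    rw [neg_neg, ← sub_eq_iff_eq_add', h]
    by_cases hjk : k = j
    · subst hjk
      simp [psi, hne]
    · simp [hjk]

end BasicRels

end Relations
end QAffSuper
end

noncomputable section

namespace QAffSuper

/-! ### The relations among currents of equal sign, deduced from extremality. -/

section Extremal

variable {A : Type} [Ring A] [Algebra ℂ A] {q : ℂˣ} {M N : ℕ}

/-- An element of `L` that super-commutes with all `X_{k,p}^{-ε}` is zero; here `L` is a subspace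
containing all products of at least two of the `X_{i,n}^ε`. -/
structure Extremal (x : Gen M N → A) (ε : ℤˣ) (L : Submodule ℂ A) : Prop where
  X_mul_X (i j : Node M N) (m n : ℤ) : x (.X ε i m) * x (.X ε j n) ∈ L
  mul_X (a : A) (ha : a ∈ L) (i : Node M N) (m : ℤ) : a * x (.X ε i m) ∈ L
  eq_zero (a : A) (ha : a ∈ L) (σ : Node M N → ℂ) (hσ : ∀ k, σ k ≠ 0)
    (h : ∀ k p, x (.X (-ε) k p) * a = σ k • (a * x (.X (-ε) k p))) : a = 0

namespace BasicRels

variable {x : Gen M N → A} (hx : BasicRels q x) (hq : ∀ n : ℕ, 0 < n → q ^ n ≠ 1) {ε : ℤˣ}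
  {L : Submodule ℂ A} (hL : Extremal x ε L)
include hx hq hL

/-- Only the opposite currents of nodes `i` and `j` leave correction terms, and these cancel because
`φ_i` commutes with `X_j` when `c_{ij} = 0`. The case `i = j = M` is included. -/
theorem quad_zero {i j : Node M N} (hc : cartan M i.1 j.1 = 0) (m n : ℤ) :
    x (.X ε i m) * x (.X ε j n) - sg i j • (x (.X ε j n) * x (.X ε i m)) = 0 := by
  refine hL.eq_zero _ (sub_mem (hL.X_mul_X _ _ _ _) (L.smul_mem _ (hL.X_mul_X _ _ _ _)))
    (fun k => sg k i * sg k j)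
    (fun k => mul_ne_zero (sg_ne_zero k i) (sg_ne_zero k j)) fun k p => ?_
  have hi := hx.comm_X ε k i p m
  have hj := hx.comm_X ε k j p n
  have hi' := mul_mul_of_comm hi
  have hj' := mul_mul_of_comm hj
  have c1 : (if k = i then psi q x ε i (p + m) else 0) * x (.X ε j n) =
      (sg i j * sg k j) • (x (.X ε j n) * if k = i then psi q x ε i (p + m) else 0) := by
    split_ifs with h
    · rw [h, sg_mul_self, one_smul, hx.psi_X_commute hq ε ε hc]
    · simp
  have c2 : (if k = j then psi q x ε j (p + n) else 0) * x (.X ε i m) =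
      (sg i j * sg k i) • (x (.X ε i m) * if k = j then psi q x ε j (p + n) else 0) := by
    split_ifs with h
    · rw [h, sg_comm i j, sg_mul_self, one_smul,
        hx.psi_X_commute hq ε ε (by rw [cartan_comm]; exact hc)]
    · simp
  have s := sg_mul_self i j
  simp only [mul_sub, sub_mul, mul_smul_comm, smul_mul_assoc, mul_add, smul_add, mul_assoc, hi', hj',
    hi, hj, c1, c2]
  match_scalars <;> first | ring1 | linear_combination (-sg k i) * s

/-- The correction terms from node `i` and those from node `j` vanish separately: each group is the
exchange relation of `psi` with the remaining current. -/
theorem quad {i j : Node M N} (hc : cartan M i.1 j.1 ≠ 0) :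
    QuadRel ((q ^ ((ε : ℤ) * cartan M i.1 j.1) : ℂˣ) : ℂ) (fun m => x (.X ε i m))
      (fun n => x (.X ε j n)) := by
  have hij := hx.quadRel_psi hq ε ε i j
  have hji := hx.quadRel_psi hq ε ε j i
  rw [cartan_comm M j.1] at hji
  set a : ℂ := ((q ^ ((ε : ℤ) * cartan M i.1 j.1) : ℂˣ) : ℂ) with ha
  intro m n
  refine sub_eq_zero.mp (hL.eq_zero _ ?_ (fun k => sg k i * sg k j)
    (fun k => mul_ne_zero (sg_ne_zero k i) (sg_ne_zero k j)) fun k p => ?_)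
  · exact sub_mem (sub_mem (hL.X_mul_X _ _ _ _) (L.smul_mem _ (hL.X_mul_X _ _ _ _)))
      (sub_mem (L.smul_mem _ (hL.X_mul_X _ _ _ _)) (hL.X_mul_X _ _ _ _))
  have hi := hx.comm_X ε k i p
  have hj := hx.comm_X ε k j p
  have hi' := fun m => mul_mul_of_comm (hi m)
  have hj' := fun n => mul_mul_of_comm (hj n)
  set Di : ℤ → A := fun r => if k = i then psi q x ε i r else 0 with hDi
  set Dj : ℤ → A := fun r => if k = j then psi q x ε j r else 0 with hDj
  have c1 : Di (p + (m + 1)) * x (.X ε j n) - (a * sg k j) • (x (.X ε j n) * Di (p + (m + 1))) -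
      a • (Di (p + m) * x (.X ε j (n + 1))) + sg k j • (x (.X ε j (n + 1)) * Di (p + m)) = 0 := by
    by_cases h : k = i
    · have := hij (p + m) n
      simp only [hDi, h, if_true, sg_eq_one hc, ← add_assoc]
      linear_combination (norm := module) this
    · simp [hDi, h]
  have c2 : Dj (p + (n + 1)) * x (.X ε i m) - (a * sg k i) • (x (.X ε i m) * Dj (p + (n + 1))) -
      a • (Dj (p + n) * x (.X ε i (m + 1))) + sg k i • (x (.X ε i (m + 1)) * Dj (p + n)) = 0 := by
    by_cases h : k = j
    · have := hji (p + n) m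
      rw [cartan_comm] at hc
      simp only [hDj, h, if_true, sg_eq_one hc, ← add_assoc]
      linear_combination (norm := module) this
    · simp [hDj, h]
  simp only [mul_sub, sub_mul, mul_smul_comm, smul_mul_assoc, mul_add, smul_add, mul_assoc, hi', hj',
    hi, hj]
  linear_combination (norm := module) c1 + c2

/-- The Serre relation, with both `q`-commutators expanded. -/
theorem serre_expanded {i j : Node M N} (hi : i.1 ≠ M)
    (hc : cartan M i.1 j.1 = 1 ∨ cartan M i.1 j.1 = -1) (m n k : ℤ) :
    x (.X ε i m) * x (.X ε i n) * x (.X ε j k)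
      - ((q : ℂ) + (q : ℂ)⁻¹) • (x (.X ε i m) * x (.X ε j k) * x (.X ε i n))
      + x (.X ε j k) * x (.X ε i n) * x (.X ε i m)
      + (x (.X ε i n) * x (.X ε i m) * x (.X ε j k)
      - ((q : ℂ) + (q : ℂ)⁻¹) • (x (.X ε i n) * x (.X ε j k) * x (.X ε i m))
      + x (.X ε j k) * x (.X ε i m) * x (.X ε i n)) = 0 := by
  have hcii := cartan_self_of_neighbour hi hc
  have hc0 : cartan M i.1 j.1 ≠ 0 := by omega
  have hcii0 : cartan M i.1 i.1 ≠ 0 := by omega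
  have hij : i ≠ j := by rintro rfl; omega
  have hXZ := hx.quad hq hL hc0
  have hXX := hx.quad hq hL hcii0
  have pXZ := hx.quadRel_psi hq ε ε i j
  have fXZ := fun ε' => hx.quadRel_phi hq ε' ε i j
  have fZX := fun ε' => hx.quadRel_phi hq ε' ε j i
  have fXX := fun ε' => hx.quadRel_phi hq ε' ε i i
  set a : ℂ := ((q ^ ((ε : ℤ) * cartan M i.1 j.1) : ℂˣ) : ℂ) with ha
  have haa : ((q ^ ((ε : ℤ) * cartan M i.1 i.1) : ℂˣ) : ℂ) = a⁻¹ ^ 2 := by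
    rw [hcii, ha, show (ε : ℤ) * (-2 * cartan M i.1 j.1) = -((ε : ℤ) * cartan M i.1 j.1) * 2 by ring,
      zpow_mul, zpow_neg, Units.val_zpow_eq_zpow_val, Units.val_inv_eq_inv_val]
    rfl
  rw [haa] at hXX fXX
  rw [cartan_comm M j.1, ← ha] at fZX
  have ha0 : a ≠ 0 := Units.ne_zero _
  -- Since `a` is `q` or `q⁻¹`, the symmetric coefficient does not see the signs of `ε` and of
  -- `c_{ij}`.
  have hqa : (q : ℂ) + (q : ℂ)⁻¹ = a + a⁻¹ := by
    rcases Int.units_eq_one_or ε with rfl | rfl <;> rcases hc with h | h <;>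
      simp [ha, h, add_comm]
  rw [hqa]
  refine hL.eq_zero _ ?_ (fun k => sg k j) (fun k => sg_ne_zero k j) fun k' p => ?_
  · have h3 : ∀ i j k m n r, x (.X ε i m) * x (.X ε j n) * x (.X ε k r) ∈ L :=
      fun i j k m n r => hL.mul_X _ (hL.X_mul_X _ _ _ _) _ _
    exact add_mem (add_mem (sub_mem (h3 _ _ _ _ _ _) (L.smul_mem _ (h3 _ _ _ _ _ _)))
      (h3 _ _ _ _ _ _)) (add_mem (sub_mem (h3 _ _ _ _ _ _) (L.smul_mem _ (h3 _ _ _ _ _ _)))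
      (h3 _ _ _ _ _ _))
  have cX := hx.comm_X ε k' i p
  have cZ := hx.comm_X ε k' j p
  rw [sg_of_ne_right k' hi] at cX
  by_cases h1 : k' = i
  · have h2 : k' ≠ j := by rw [h1]; exact hij
    have hs : sg k' j = 1 := by rw [h1]; exact sg_of_ne_left hi j
    simp only [h1, if_true] at cX
    simp only [h2, if_false, add_zero] at cZ
    rw [h1] at hs cZ
    rw [h1, hs]
    rw [hs] at cZ
    have cX' := fun m => mul_mul_of_comm (cX m)
    have cZ' := fun n => mul_mul_of_smul_comm (cZ n)
    -- The difference `psi` is not one-sided, so the identity is applied to `φ^+` and `φ^-`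
    -- separately and then combined linearly.
    have t := fun ε' => serre_self ha0 (CartanRels.halfSupported_phi ε' i) (fXX ε') (fXZ ε') hXZ
    have t' : ∀ r n, psi q x ε i r * x (.X ε i n) * x (.X ε j k)
        + x (.X ε i n) * psi q x ε i r * x (.X ε j k)
        - (a + a⁻¹) • (psi q x ε i r * x (.X ε j k) * x (.X ε i n))
        - (a + a⁻¹) • (x (.X ε i n) * x (.X ε j k) * psi q x ε i r)
        + x (.X ε j k) * psi q x ε i r * x (.X ε i n)
        + x (.X ε j k) * x (.X ε i n) * psi q x ε i r = 0 := by
      intro r n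
      have t1 := t 1 r n k
      have t2 := t (-1) r n k
      simp only [psi, smul_mul_assoc, mul_smul_comm, sub_mul, mul_sub] at t1 t2 ⊢
      generalize ((if ε = 1 then -sg i i else 1) *
        ((qn q M i.1 : ℂ) - ((qn q M i.1)⁻¹ : ℂˣ))⁻¹) = κ
      linear_combination (norm := module) κ • t1 - κ • t2
    have t1 := t' (p + m) n
    have t2 := t' (p + n) m
    simp only [mul_sub, sub_mul, mul_smul_comm, smul_mul_assoc, mul_add, add_mul, smul_add,
      mul_assoc, cX', cZ', cX, cZ] at t1 t2 ⊢
    linear_combination (norm := module) t1 + t2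
  · simp only [h1, if_false, add_zero] at cX
    have cX' := fun n => mul_mul_of_smul_comm (cX n)
    have cZ' := fun n => mul_mul_of_comm (cZ n)
    -- Here the only correction terms replace `X_j`; for a node different from both `i` and `j`
    -- there are none at all.
    by_cases h2 : k' = j
    · simp only [h2, if_true] at cZ
      have t : ∀ ε', _ := fun ε' =>
        serre_neighbour ha0 (CartanRels.halfSupported_phi ε' j) (fZX ε') hXX
      have t1 := t 1 (p + k) m n
      have t2 := t (-1) (p + k) m n
      simp only [h2, if_true] at cZ' cX' cX
      simp only [h2, mul_sub, sub_mul, mul_smul_comm, smul_mul_assoc, mul_add, add_mul, smul_add,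
        mul_assoc, cX', cZ', cX, cZ, psi] at t1 t2 ⊢
      generalize ((if ε = 1 then -sg j j else 1) *
        ((qn q M j.1 : ℂ) - ((qn q M j.1)⁻¹ : ℂˣ))⁻¹) = κ
      linear_combination (norm := module) κ • t1 - κ • t2
    · simp only [h2, if_false, add_zero] at cZ
      have cZ' := fun n => mul_mul_of_smul_comm (cZ n)
      simp only [mul_sub, sub_mul, mul_smul_comm, smul_mul_assoc, mul_add, add_mul, smul_add,
        mul_assoc, cX', cZ', cX, cZ]
      module

/-- The degree four relation at the odd node, reduced by means of the quadratic relations. -/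
theorem osc_expanded {a b c : Node M N} (ha : a.1 + 1 = M) (hb : b.1 = M) (hc : c.1 = M + 1)
    (m n k u : ℤ) :
    x (.X ε a m) * x (.X ε b n) * x (.X ε c k) * x (.X ε b u)
      + x (.X ε c k) * x (.X ε b n) * x (.X ε a m) * x (.X ε b u)
      + x (.X ε b u) * x (.X ε a m) * x (.X ε b n) * x (.X ε c k)
      + x (.X ε b u) * x (.X ε c k) * x (.X ε b n) * x (.X ε a m)
      - ((q : ℂ) + (q : ℂ)⁻¹) • (x (.X ε b u) * x (.X ε a m) * x (.X ε c k) * x (.X ε b n))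
      + (x (.X ε a m) * x (.X ε b u) * x (.X ε c k) * x (.X ε b n)
      + x (.X ε c k) * x (.X ε b u) * x (.X ε a m) * x (.X ε b n)
      + x (.X ε b n) * x (.X ε a m) * x (.X ε b u) * x (.X ε c k)
      + x (.X ε b n) * x (.X ε c k) * x (.X ε b u) * x (.X ε a m)
      - ((q : ℂ) + (q : ℂ)⁻¹) • (x (.X ε b n) * x (.X ε a m) * x (.X ε c k) * x (.X ε b u)))
      = 0 := by
  have hell : ell M M = 1 := by simp [ell]
  have hell' : ell M (M + 1) = -1 := by simp [ell]
  have cab : cartan M a.1 b.1 = -1 := by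
    rw [show b.1 = a.1 + 1 by omega, cartan_succ, ha, hell]
  have cbc : cartan M b.1 c.1 = 1 := by rw [hb, hc, cartan_succ, hell', neg_neg]
  have cba : cartan M b.1 a.1 = -1 := by rw [cartan_comm, cab]
  have ccb : cartan M c.1 b.1 = 1 := by rw [cartan_comm, cbc]
  have cac : cartan M a.1 c.1 = 0 := cartan_of_lt (by omega)
  have cca : cartan M c.1 a.1 = 0 := by rw [cartan_comm, cac]
  have cbb : cartan M b.1 b.1 = 0 := by rw [hb, cartan_self_odd]
  have hab : a ≠ b := by rintro rfl; omega
  have hbc : b ≠ c := by rintro rfl; omega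
  have hac : a ≠ c := by rintro rfl; omega
  have haM : a.1 ≠ M := by omega
  have hcM : c.1 ≠ M := by omega
  have QAB := hx.quad hq hL (i := a) (j := b) (by omega)
  have QBC := hx.quad hq hL (i := b) (j := c) (by omega)
  have QCB := QBC.symm
  have QBB := hx.quad_zero hq hL cbb
  have QAC := hx.quad_zero hq hL cac
  have fAB := fun ε' => hx.quadRel_phi hq ε' ε a b
  have fBA := fun ε' => hx.quadRel_phi hq ε' ε b a
  have fBC := fun ε' => hx.quadRel_phi hq ε' ε b c
  have fCB := fun ε' => hx.quadRel_phi hq ε' ε c b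
  have fBB := fun ε' => hx.phi_X_commute hq ε' ε cbb
  have fAC := fun ε' => hx.phi_X_commute hq ε' ε cac
  have fCA := fun ε' => hx.phi_X_commute hq ε' ε cca
  rw [sg_odd hb hb] at QBB
  rw [sg_of_ne_left haM] at QAC
  simp only [neg_smul, one_smul, sub_neg_eq_add] at QBB
  simp only [one_smul, sub_eq_zero] at QAC
  obtain ⟨α, hα, hα0, hqα⟩ : ∃ α : ℂ, ((q ^ ((ε : ℤ) * -1) : ℂˣ) : ℂ) = α ∧ α ≠ 0 ∧
      (q : ℂ) + (q : ℂ)⁻¹ = α + α⁻¹ := by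
    refine ⟨_, rfl, Units.ne_zero _, ?_⟩
    rcases Int.units_eq_one_or ε with rfl | rfl <;> simp [add_comm]
  have hα' : ((q ^ ((ε : ℤ) * 1) : ℂˣ) : ℂ) = α⁻¹ := by
    rw [← hα, mul_neg, zpow_neg, Units.val_inv_eq_inv_val, inv_inv]
  simp only [cab, cbc, cba, ccb, hα, hα'] at QAB QBC QCB fAB fBA fBC fCB
  rw [hqα]
  refine hL.eq_zero _ ?_ (fun _ => 1) (fun _ => one_ne_zero) fun k' p => ?_
  · have h4 : ∀ i j k l m n r s,
        x (.X ε i m) * x (.X ε j n) * x (.X ε k r) * x (.X ε l s) ∈ L :=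
      fun i j k l m n r s => hL.mul_X _ (hL.mul_X _ (hL.X_mul_X _ _ _ _) _ _) _ _
    have h4' : ∀ m n k u, x (.X ε a m) * x (.X ε b n) * x (.X ε c k) * x (.X ε b u)
      + x (.X ε c k) * x (.X ε b n) * x (.X ε a m) * x (.X ε b u)
      + x (.X ε b u) * x (.X ε a m) * x (.X ε b n) * x (.X ε c k)
      + x (.X ε b u) * x (.X ε c k) * x (.X ε b n) * x (.X ε a m)
      - (α + α⁻¹) • (x (.X ε b u) * x (.X ε a m) * x (.X ε c k) * x (.X ε b n)) ∈ L :=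
      fun m n k u => sub_mem (add_mem (add_mem (add_mem (h4 _ _ _ _ _ _ _ _) (h4 _ _ _ _ _ _ _ _))
        (h4 _ _ _ _ _ _ _ _)) (h4 _ _ _ _ _ _ _ _)) (L.smul_mem _ (h4 _ _ _ _ _ _ _ _))
    exact add_mem (h4' _ _ _ _) (h4' _ _ _ _)
  have cA := hx.comm_X ε k' a p
  have cB := hx.comm_X ε k' b p
  have cC := hx.comm_X ε k' c p
  rw [sg_of_ne_right k' haM] at cA
  rw [sg_of_ne_right k' hcM] at cC
  rw [one_smul]
  by_cases hka : k' = a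
  · subst hka
    simp only [hab, hac, if_false, if_true, add_zero, sg_of_ne_left haM] at cA cB cC
    have cA' := fun m => mul_mul_of_comm (cA m)
    have cB' := fun m => mul_mul_of_smul_comm (cB m)
    have cC' := fun m => mul_mul_of_smul_comm (cC m)
    have t := fun ε' => oscillation_even hα0 (CartanRels.halfSupported_phi ε' _) (fAB ε') (fAC ε')
      QBC QBB (p + m) n u k
    have t1 := t 1
    have t2 := t (-1)
    simp only [mul_sub, sub_mul, mul_smul_comm, smul_mul_assoc, mul_add, add_mul, smul_add,
      mul_assoc, cA', cB', cC', cA, cB, cC, psi] at t1 t2 ⊢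
    generalize ((if ε = 1 then -sg k' k' else 1) *
      ((qn q M k'.1 : ℂ) - ((qn q M k'.1)⁻¹ : ℂˣ))⁻¹) = κ
    linear_combination (norm := module) κ • t1 - κ • t2
  by_cases hkc : k' = c
  · subst hkc
    simp only [hac.symm, hbc.symm, if_false, if_true, add_zero, sg_of_ne_left hcM] at cA cB cC
    have cA' := fun m => mul_mul_of_smul_comm (cA m)
    have cB' := fun m => mul_mul_of_smul_comm (cB m)
    have cC' := fun m => mul_mul_of_comm (cC m)
    have t := fun ε' => oscillation_even (inv_ne_zero hα0) (CartanRels.halfSupported_phi ε' _)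
      (fCB ε') (fCA ε') (by rw [inv_inv]; exact QAB.symm) QBB (p + k) n u m
    have t1 := t 1
    have t2 := t (-1)
    have cF := fun ε' r m w => mul_mul_of_smul_comm (s := 1) (by rw [fCA ε' r m, one_smul]) w
    -- The commutation `cF` is needed because the roles of the outer nodes are exchanged relative to
    -- the identity applied, which displaces `φ` with respect to the current of node `M-1`.
    simp only [mul_sub, sub_mul, mul_smul_comm, smul_mul_assoc, mul_add, add_mul, smul_add,
      mul_assoc, cA', cB', cC', cA, cB, cC, cF, psi, inv_inv] at t1 t2 ⊢
    generalize ((if ε = 1 then -sg k' k' else 1) *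
      ((qn q M k'.1 : ℂ) - ((qn q M k'.1)⁻¹ : ℂˣ))⁻¹) = κ
    linear_combination (norm := module) κ • t1 - κ • t2
  simp only [hka, hkc, if_false, add_zero] at cA cC
  have cA' := fun m => mul_mul_of_smul_comm (cA m)
  have cC' := fun m => mul_mul_of_smul_comm (cC m)
  by_cases hkb : k' = b
  · subst hkb
    simp only [if_true, sg_odd hb hb] at cB
    have cB' := fun m => mul_mul_of_comm (cB m)
    -- Both odd currents can be hit, so the identity is used twice, with `n` and `u` interchanged.
    have t := fun ε' r u => oscillation_odd hα0 (CartanRels.halfSupported_phi ε' _) (fBA ε')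
      (fBC ε') (fBB ε') QAB QCB QAC (p + r) m k u
    have t1 := t 1 n u
    have t2 := t (-1) n u
    have t3 := t 1 u n
    have t4 := t (-1) u n
    simp only [mul_sub, sub_mul, mul_smul_comm, smul_mul_assoc, mul_add, add_mul, smul_add,
      mul_assoc, cA', cB', cC', cA, cB, cC, psi] at t1 t2 t3 t4 ⊢
    generalize ((if ε = 1 then -sg k' k' else 1) *
      ((qn q M k'.1 : ℂ) - ((qn q M k'.1)⁻¹ : ℂˣ))⁻¹) = κ
    linear_combination (norm := module) κ • t1 - κ • t2 + κ • t3 - κ • t4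
  · have hkM : k'.1 ≠ M := fun h => hkb (Subtype.ext (h.trans hb.symm))
    simp only [hkb, if_false, add_zero, sg_of_ne_left hkM] at cB
    have cB' := fun m => mul_mul_of_smul_comm (cB m)
    simp only [mul_sub, sub_mul, mul_smul_comm, smul_mul_assoc, mul_add, add_mul, mul_assoc,
      cA', cB', cC', cA, cB, cC]
    module

end BasicRels

/-- All defining relations of `U_q(L sl(M,N))` hold if the basic ones do and the raising, as well
as the lowering, operators are governed by an extremality principle. -/
theorem BasicRels.lift_eq {x : Gen M N → A} (hx : BasicRels q x)
    (hq : ∀ n : ℕ, 0 < n → q ^ n ≠ 1) (hL : ∀ ε, ∃ L, Extremal x ε L)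
    {a b : FreeAlgebra ℂ (Gen M N)} (hab : Rel q M N a b) :
    FreeAlgebra.lift ℂ x a = FreeAlgebra.lift ℂ x b := by
  have hphi : ∀ ε i n, FreeAlgebra.lift ℂ x (phi q (FreeAlgebra.ι ℂ) ε i n) = phi q x ε i n := by
    intro ε i n
    rw [map_phi]
    simp only [FreeAlgebra.lift_ι_apply]
  cases hab with
  | K_Kinv i => simpa using hx.K_Kinv i
  | Kinv_K i => simpa using hx.Kinv_K i
  | K_K i j => simpa using hx.K_K i j
  | K_h i j s => simpa using hx.K_h i j s
  | h_h i j s t => simpa using hx.h_h i j s t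
  | K_X ε i j n =>
    simp only [map_mul, map_smul, FreeAlgebra.lift_ι_apply]
    rw [hx.K_X, smul_mul_assoc, mul_assoc, hx.K_Kinv, mul_one]
  | h_X ε i j s n =>
    simp only [map_mul, map_sub, map_smul, FreeAlgebra.lift_ι_apply]
    exact hx.h_X ε i j s n
  | X_X i j m n =>
    rw [map_sbr, FreeAlgebra.lift_ι_apply, FreeAlgebra.lift_ι_apply, sbr_eq, hx.X_X]
    split_ifs
    · rw [map_smul, map_sub, hphi, hphi]
    · rw [map_zero]
  | quad_zero ε i j m n hc =>
    obtain ⟨L, hL⟩ := hL ε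
    rw [map_sbr, FreeAlgebra.lift_ι_apply, FreeAlgebra.lift_ι_apply, sbr_eq, map_zero]
    exact hx.quad_zero hq hL hc m n
  | quad ε i j m n hc =>
    obtain ⟨L, hL⟩ := hL ε
    simp only [map_mul, map_sub, map_smul, FreeAlgebra.lift_ι_apply]
    exact hx.quad hq hL hc m n
  | serre ε i j m n k hc hi =>
    obtain ⟨L, hL⟩ := hL ε
    have h := hx.serre_expanded hq hL hi hc m n k
    simp only [map_sbr, map_add, map_zero, FreeAlgebra.lift_ι_apply]
    simp only [sbr, par, if_neg hi, zero_mul,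
      pow_zero, one_mul, Units.val_inv_eq_inv_val]
    simp only [mul_sub, sub_mul, mul_smul_comm, smul_mul_assoc, mul_assoc] at h ⊢
    have hq0 : (q : ℂ) ≠ 0 := q.ne_zero
    linear_combination (norm := skip) h
    match_scalars <;> field_simp <;> ring
  | osc ε a b c m n k u ha hb hc =>
    obtain ⟨L, hL⟩ := hL ε
    have h := hx.osc_expanded hq hL ha hb hc m n k u
    have cbb : cartan M b.1 b.1 = 0 := by rw [hb, cartan_self_odd]
    have cca : cartan M c.1 a.1 = 0 := by rw [cartan_comm]; exact cartan_of_lt (by omega)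
    have haM : a.1 ≠ M := by omega
    have hcM : c.1 ≠ M := by omega
    have h1 := hx.quad_zero hq hL cbb n u
    have h2 := hx.quad_zero hq hL cca k m
    rw [sg_odd hb hb] at h1
    rw [sg_of_ne_left hcM, one_smul, sub_eq_zero] at h2
    have h2' := fun w => mul_mul_of_smul_comm (s := 1) (by rw [h2, one_smul]) w
    simp only [map_sbr, map_add, map_zero, FreeAlgebra.lift_ι_apply]
    simp only [sbr, par, if_neg haM,
      if_pos hb, if_neg hcM, zero_mul, pow_zero, one_mul, Units.val_inv_eq_inv_val]
    -- The expanded brackets differ from the reduced expression only by terms in which the two odd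
    -- currents stand next to each other. They are removed by the anticommutation `h1`, once the
    -- currents of `M-1` and `M+1` are commuted by `h2`.
    linear_combination (norm := skip) h - (q : ℂ) • (x (.X ε c k) * x (.X ε a m) * h1)
      - (q : ℂ)⁻¹ • (h1 * x (.X ε a m) * x (.X ε c k))
    simp only [mul_sub, sub_mul, mul_smul_comm, smul_mul_assoc, mul_assoc, add_mul, smul_sub,
      h2, h2', mul_zero, zero_mul]
    have hq0 : (q : ℂ) ≠ 0 := q.ne_zero
    match_scalars <;> field_simp <;> ring

end Extremal
end QAffSuper
end

noncomputable section

namespace QAffSuper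

/-! ### The `φ_{i,n}^±` as elements of the algebra generated by the Cartan generators. -/

section PhiMem

variable {A : Type} [Ring A] [Algebra ℂ A] {M N : ℕ}

theorem phi_congr (q : ℂˣ) {x y : Gen M N → A} {i : Node M N} (hK : x (.K i) = y (.K i))
    (hKinv : x (.Kinv i) = y (.Kinv i)) (hh : ∀ s, x (.h i s) = y (.h i s)) (ε : ℤˣ) (n : ℤ) :
    phi q x ε i n = phi q y ε i n := by
  simp only [phi, hSeries, hK, hKinv, hh]

/-- Naturality of `phi` along the inclusion of the subalgebra: the Cartan generators of node `i`
lift to it, and any generator outside it may be replaced by zero, because `phi` at the node `i` does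
not use it. -/
theorem phi_mem (q : ℂˣ) {x : Gen M N → A} {i : Node M N} (S : Subalgebra ℂ A)
    (hK : x (.K i) ∈ S) (hKinv : x (.Kinv i) ∈ S) (hh : ∀ s, x (.h i s) ∈ S) (ε : ℤˣ) (n : ℤ) :
    phi q x ε i n ∈ S := by
  classical
  let y : Gen M N → S := fun g => if hg : x g ∈ S then ⟨x g, hg⟩ else 0
  have e := map_phi q S.val y ε i n
  rw [phi_congr q (y := x) (by simp [y, hK]) (by simp [y, hKinv]) (by simp [y, hh])] at e
  rw [← e]
  exact (phi q y ε i n).2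

theorem phi_commute (q : ℂˣ) {x : Gen M N → A} {i : Node M N} {T : A}
    (hK : T * x (.K i) = x (.K i) * T) (hKinv : T * x (.Kinv i) = x (.Kinv i) * T)
    (hh : ∀ s, T * x (.h i s) = x (.h i s) * T) (ε : ℤˣ) (n : ℤ) :
    T * phi q x ε i n = phi q x ε i n * T := by
  have := phi_mem q (x := x) (i := i) (Subalgebra.centralizer ℂ {T})
    (by simpa [Subalgebra.mem_centralizer_iff] using hK)
    (by simpa [Subalgebra.mem_centralizer_iff] using hKinv)
    (by simpa [Subalgebra.mem_centralizer_iff] using hh) ε n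
  simpa [Subalgebra.mem_centralizer_iff] using this

variable {V W : Type} [AddCommGroup V] [Module ℂ V] [AddCommGroup W] [Module ℂ W]

/-- Pairs of operators intertwined by `Θ` form a subalgebra of the product of the endomorphism
algebras, to which `phi_mem` applies. -/
theorem phi_intertwine (q : ℂˣ) {x : Gen M N → Module.End ℂ V} {y : Gen M N → Module.End ℂ W}
    {i : Node M N} (Θ : V →ₗ[ℂ] W) (hK : ∀ v, Θ (x (.K i) v) = y (.K i) (Θ v))
    (hKinv : ∀ v, Θ (x (.Kinv i) v) = y (.Kinv i) (Θ v))
    (hh : ∀ s v, Θ (x (.h i s) v) = y (.h i s) (Θ v)) (ε : ℤˣ) (n : ℤ) (v : V) :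
    Θ (phi q x ε i n v) = phi q y ε i n (Θ v) := by
  let S : Subalgebra ℂ (Module.End ℂ V × Module.End ℂ W) :=
    { carrier := {T | ∀ v, Θ (T.1 v) = T.2 (Θ v)}
      mul_mem' := fun {a b} ha hb v => by
        simp only [Prod.fst_mul, Prod.snd_mul, Module.End.mul_apply]
        rw [ha, hb]
      add_mem' := fun {a b} ha hb v => by
        simp only [Prod.fst_add, Prod.snd_add, LinearMap.add_apply, map_add]
        rw [ha, hb]
      algebraMap_mem' := fun c v => by simp [Algebra.algebraMap_eq_smul_one] }
  have h := phi_mem q (x := fun g => (x g, y g)) (i := i) S hK hKinv hh ε n v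
  have h1 := map_phi q (AlgHom.fst ℂ (Module.End ℂ V) (Module.End ℂ W)) (fun g => (x g, y g)) ε i n
  have h2 := map_phi q (AlgHom.snd ℂ (Module.End ℂ V) (Module.End ℂ W)) (fun g => (x g, y g)) ε i n
  simp only [AlgHom.fst_apply, AlgHom.snd_apply] at h1 h2
  rwa [h1, h2] at h

/-- The same device with pairs consisting of an operator and its eigenvalue on `v`. -/
theorem phi_eigen (q : ℂˣ) {x : Gen M N → Module.End ℂ V} {y : Gen M N → ℂ}
    {i : Node M N} {v : V} (hK : x (.K i) v = y (.K i) • v)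
    (hKinv : x (.Kinv i) v = y (.Kinv i) • v)
    (hh : ∀ s, x (.h i s) v = y (.h i s) • v) (ε : ℤˣ) (n : ℤ) :
    phi q x ε i n v = phi q y ε i n • v := by
  let S : Subalgebra ℂ (Module.End ℂ V × ℂ) :=
    { carrier := {T | T.1 v = T.2 • v}
      mul_mem' := fun {a b} ha hb => by
        simp only [Set.mem_ofPred_eq, Prod.fst_mul, Prod.snd_mul, Module.End.mul_apply] at *
        rw [hb, map_smul, ha, smul_smul, mul_comm]
      add_mem' := fun {a b} ha hb => by
        simp only [Set.mem_ofPred_eq, Prod.fst_add, Prod.snd_add, LinearMap.add_apply] at *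
        rw [ha, hb, add_smul]
      algebraMap_mem' := fun c => by simp [Algebra.algebraMap_eq_smul_one] }
  have h : _ = _ := phi_mem q (x := fun g => (x g, y g)) (i := i) S hK hKinv hh ε n
  have h1 := map_phi q (AlgHom.fst ℂ (Module.End ℂ V) ℂ) (fun g => (x g, y g)) ε i n
  have h2 := map_phi q (AlgHom.snd ℂ (Module.End ℂ V) ℂ) (fun g => (x g, y g)) ε i n
  simp only [AlgHom.fst_apply, AlgHom.snd_apply] at h1 h2
  rwa [h1, h2] at h

end PhiMem

/-- Eigenvalues of the `K_i` and of the `h_{i,s}`. -/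
structure HData (M N : ℕ) where
  κ : Node M N → ℂˣ
  η : Node M N → {s : ℤ // s ≠ 0} → ℂ

/-- The scalars attached to the generators by an eigenvalue datum. -/
def HData.val {M N : ℕ} (D : HData M N) : Gen M N → ℂ
  | .X _ _ _ => 0
  | .K i => D.κ i
  | .Kinv i => ((D.κ i)⁻¹ : ℂˣ)
  | .h i s => D.η i s

/-! ### The module of words in free lowering letters. -/

section Words

/-- The space with basis the words in the letters `X_{j,n}^-`. -/
abbrev Words (M N : ℕ) : Type := List (Node M N × ℤ) →₀ ℂ

variable {M N : ℕ}

/-- The empty word. -/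
def vac (M N : ℕ) : Words M N := Finsupp.single [] 1

/-- Left multiplication by a letter. -/
def down (l : Node M N × ℤ) : Module.End ℂ (Words M N) := Finsupp.lmapDomain ℂ ℂ (List.cons l)

theorem down_single (l : Node M N × ℤ) (w : List (Node M N × ℤ)) (c : ℂ) :
    down l (Finsupp.single w c) = Finsupp.single (l :: w) c := by
  simp [down]

theorem words_ext {V : Type} [AddCommGroup V] [Module ℂ V] {T T' : Words M N →ₗ[ℂ] V}
    (h0 : T (vac M N) = T' (vac M N))
    (hs : ∀ l w, T w = T' w → T (down l w) = T' (down l w)) (w : Words M N) : T w = T' w := by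
  have : T = T' := by
    refine Finsupp.lhom_ext' fun w => LinearMap.ext_ring ?_
    simp only [LinearMap.comp_apply, Finsupp.lsingle_apply]
    induction w with
    | nil => exact h0
    | cons l w ih =>
      rw [← down_single]
      exact hs l _ ih
  rw [this]

/-- The coefficient of `X_{j,n+s}^-` in `[h_{i,s}, X_{j,n}^-]`. -/
def gam (q : ℂˣ) (i j : Node M N) (s : {s : ℤ // s ≠ 0}) : ℂ :=
  qint (qn q M i.1) (s.1 * ell M i.1 * cartan M i.1 j.1) / (s.1 : ℂ)

variable (q : ℂˣ) (D : HData M N)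

/-- The action of `h_{i,s}` on words. -/
def hList (i : Node M N) (s : {s : ℤ // s ≠ 0}) : List (Node M N × ℤ) → Words M N
  | [] => D.η i s • vac M N
  | l :: w => down l (hList i s w) - gam q i l.1 s • Finsupp.single ((l.1, l.2 + s.1) :: w) 1

/-- The action of `h_{i,s}` on the space of words. -/
def hOp (i : Node M N) (s : {s : ℤ // s ≠ 0}) : Module.End ℂ (Words M N) :=
  Finsupp.linearCombination ℂ (hList q D i s)

theorem hOp_vac (i : Node M N) (s : {s : ℤ // s ≠ 0}) :
    hOp q D i s (vac M N) = D.η i s • vac M N := by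
  simp [hOp, vac, hList]

theorem linearMap_eq_of_single {V : Type} [AddCommGroup V] [Module ℂ V]
    {T T' : Words M N →ₗ[ℂ] V} (h : ∀ w, T (Finsupp.single w 1) = T' (Finsupp.single w 1))
    (w : Words M N) : T w = T' w := by
  have : T = T' := Finsupp.lhom_ext' fun w => LinearMap.ext_ring (h w)
  rw [this]

theorem hOp_down (i : Node M N) (s : {s : ℤ // s ≠ 0}) (l : Node M N × ℤ) (w : Words M N) :
    hOp q D i s (down l w) =
      down l (hOp q D i s w) - gam q i l.1 s • down (l.1, l.2 + s.1) w := by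
  refine linearMap_eq_of_single (T := hOp q D i s ∘ₗ down l)
    (T' := down l ∘ₗ hOp q D i s - gam q i l.1 s • down (l.1, l.2 + s.1)) (fun w => ?_) w
  simp only [LinearMap.comp_apply, LinearMap.sub_apply, LinearMap.smul_apply, down_single]
  simp [hOp, hList]

/-- The eigenvalue of `K_i` on a word. -/
def kScal (i : Node M N) : List (Node M N × ℤ) → ℂˣ
  | [] => D.κ i
  | l :: w => (q ^ cartan M i.1 l.1.1)⁻¹ * kScal i w

/-- The action of `K_i^{±1}` on words. -/
def kOp (i : Node M N) (e : ℤˣ) : Module.End ℂ (Words M N) :=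
  Finsupp.linearCombination ℂ fun w => ((kScal q D i w ^ (e : ℤ) : ℂˣ) : ℂ) • Finsupp.single w 1

theorem kOp_single (i : Node M N) (e : ℤˣ) (w : List (Node M N × ℤ)) :
    kOp q D i e (Finsupp.single w 1) =
      ((kScal q D i w ^ (e : ℤ) : ℂˣ) : ℂ) • Finsupp.single w 1 := by
  simp [kOp]

theorem kOp_vac (i : Node M N) (e : ℤˣ) :
    kOp q D i e (vac M N) = ((D.κ i ^ (e : ℤ) : ℂˣ) : ℂ) • vac M N :=
  kOp_single q D i e []

theorem kOp_down (i : Node M N) (e : ℤˣ) (l : Node M N × ℤ) (w : Words M N) :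
    kOp q D i e (down l w) =
      ((((q ^ cartan M i.1 l.1.1)⁻¹) ^ (e : ℤ) : ℂˣ) : ℂ) • down l (kOp q D i e w) := by
  refine linearMap_eq_of_single (T := kOp q D i e ∘ₗ down l)
    (T' := ((((q ^ cartan M i.1 l.1.1)⁻¹) ^ (e : ℤ) : ℂˣ) : ℂ) • (down l ∘ₗ kOp q D i e))
    (fun w => ?_) w
  simp only [LinearMap.comp_apply, LinearMap.smul_apply, down_single, kOp_single, map_smul,
    smul_smul]
  rw [kScal, mul_zpow, Units.val_mul]

theorem kOp_mul_kOp (i : Node M N) (e : ℤˣ) : kOp q D i e * kOp q D i (-e) = 1 := by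
  refine LinearMap.ext fun w => linearMap_eq_of_single (fun w => ?_) w
  simp only [Module.End.mul_apply, kOp_single, map_smul, smul_smul, ← Units.val_mul,
    ← zpow_add, Units.val_neg, neg_add_cancel, zpow_zero, Units.val_one, one_smul,
    Module.End.one_apply]

/-- The operators of the Cartan part and the lowering operators on words. -/
def borelOp : Gen M N → Module.End ℂ (Words M N)
  | .X _ i n => down (i, n)
  | .K i => kOp q D i 1
  | .Kinv i => kOp q D i (-1)
  | .h i s => hOp q D i s

/-- The operator `(φ_{k,r}^+ - φ_{k,r}^-) / (q_k - q_k⁻¹)` on words. -/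
def psiOp (k : Node M N) (r : ℤ) : Module.End ℂ (Words M N) :=
  ((qn q M k.1 : ℂ) - ((qn q M k.1)⁻¹ : ℂˣ))⁻¹ •
    (phi q (borelOp q D) 1 k r - phi q (borelOp q D) (-1) k r)

/-- The action of `X_{k,p}^+` on words. -/
def upList (k : Node M N × ℤ) : List (Node M N × ℤ) → Words M N
  | [] => 0
  | l :: w => sg k.1 l.1 • down l (upList k w) +
      if k.1 = l.1 then psiOp q D k.1 (k.2 + l.2) (Finsupp.single w 1) else 0

/-- The action of `X_{k,p}^+` on the space of words. -/
def up (k : Node M N × ℤ) : Module.End ℂ (Words M N) :=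
  Finsupp.linearCombination ℂ (upList q D k)

theorem up_vac (k : Node M N × ℤ) : up q D k (vac M N) = 0 := by
  simp [up, vac, upList]

theorem up_down (k l : Node M N × ℤ) (w : Words M N) :
    up q D k (down l w) = sg k.1 l.1 • down l (up q D k w) +
      if k.1 = l.1 then psiOp q D k.1 (k.2 + l.2) w else 0 := by
  by_cases h : k.1 = l.1
  · simp only [h, if_true]
    refine linearMap_eq_of_single (T := up q D k ∘ₗ down l)
      (T' := sg l.1 l.1 • (down l ∘ₗ up q D k) + psiOp q D l.1 (k.2 + l.2)) (fun w => ?_) w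
    simp only [LinearMap.comp_apply, LinearMap.add_apply, LinearMap.smul_apply, down_single]
    simp [up, upList, h]
  · simp only [h, if_false, add_zero]
    refine linearMap_eq_of_single (T := up q D k ∘ₗ down l)
      (T' := sg k.1 l.1 • (down l ∘ₗ up q D k)) (fun w => ?_) w
    simp only [LinearMap.comp_apply, LinearMap.smul_apply, down_single]
    simp [up, upList, h]

/-- The operators on words labelled by the Drinfeld generators. -/
def wordOp : Gen M N → Module.End ℂ (Words M N)
  | .X ε i n => if ε = 1 then up q D (i, n) else down (i, n)
  | .K i => kOp q D i 1
  | .Kinv i => kOp q D i (-1)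
  | .h i s => hOp q D i s

/-- `phi` reads only the Cartan generators, so the provisional family `borelOp`, available before
`up` is defined, gives the final answer. -/
theorem phi_wordOp (ε : ℤˣ) (i : Node M N) (n : ℤ) :
    phi q (wordOp q D) ε i n = phi q (borelOp q D) ε i n := rfl

theorem hOp_hOp (i j : Node M N) (s t : {s : ℤ // s ≠ 0}) :
    hOp q D i s * hOp q D j t = hOp q D j t * hOp q D i s := by
  refine LinearMap.ext fun w => words_ext ?_ (fun l w h => ?_) w
  · simp only [Module.End.mul_apply, hOp_vac, map_smul]
    rw [smul_comm]
  · simp only [Module.End.mul_apply, hOp_down, map_sub, map_smul] at h ⊢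
    rw [h, add_right_comm l.2]
    module

theorem kOp_hOp (i j : Node M N) (e : ℤˣ) (t : {s : ℤ // s ≠ 0}) :
    kOp q D i e * hOp q D j t = hOp q D j t * kOp q D i e := by
  refine LinearMap.ext fun w => words_ext ?_ (fun l w h => ?_) w
  · simp only [Module.End.mul_apply, hOp_vac, kOp_vac, map_smul]
    rw [smul_comm]
  · simp only [Module.End.mul_apply, hOp_down, kOp_down, map_sub, map_smul] at h ⊢
    rw [h]
    module

theorem kOp_kOp (i j : Node M N) (e e' : ℤˣ) :
    kOp q D i e * kOp q D j e' = kOp q D j e' * kOp q D i e := by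
  refine LinearMap.ext fun w => linearMap_eq_of_single (fun w => ?_) w
  simp only [Module.End.mul_apply, kOp_single, map_smul]
  rw [smul_comm]

theorem hOp_psiOp (i k : Node M N) (s : {s : ℤ // s ≠ 0}) (r : ℤ) (w : Words M N) :
    hOp q D i s (psiOp q D k r w) = psiOp q D k r (hOp q D i s w) := by
  have h : ∀ ε, hOp q D i s * phi q (borelOp q D) ε k r =
      phi q (borelOp q D) ε k r * hOp q D i s := fun ε =>
    phi_commute q (kOp_hOp q D k i 1 s).symm (kOp_hOp q D k i (-1) s).symm
      (fun t => hOp_hOp q D i k s t) ε r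
  have h1 := LinearMap.congr_fun (h 1) w
  have h2 := LinearMap.congr_fun (h (-1)) w
  simp only [Module.End.mul_apply] at h1 h2
  simp only [psiOp, LinearMap.smul_apply, LinearMap.sub_apply, map_smul, map_sub, h1, h2]

theorem kOp_psiOp (i k : Node M N) (e : ℤˣ) (r : ℤ) (w : Words M N) :
    kOp q D i e (psiOp q D k r w) = psiOp q D k r (kOp q D i e w) := by
  have h : ∀ ε, kOp q D i e * phi q (borelOp q D) ε k r =
      phi q (borelOp q D) ε k r * kOp q D i e := fun ε =>
    phi_commute q (kOp_kOp q D i k e 1) (kOp_kOp q D i k e (-1))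
      (fun t => kOp_hOp q D i k e t) ε r
  have h1 := LinearMap.congr_fun (h 1) w
  have h2 := LinearMap.congr_fun (h (-1)) w
  simp only [Module.End.mul_apply] at h1 h2
  simp only [psiOp, LinearMap.smul_apply, LinearMap.sub_apply, map_smul, map_sub, h1, h2]

/-- By induction on the word. When the raising operator meets a letter of its own node, the shifts
of the letter and of the raising operator both produce `ψ` with index raised by `s`, with opposite
signs; the rest is that `ψ` commutes with `h`. -/
theorem hOp_up (i : Node M N) (s : {s : ℤ // s ≠ 0}) (k : Node M N × ℤ) (w : Words M N) :
    hOp q D i s (up q D k w) =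
      up q D k (hOp q D i s w) + gam q i k.1 s • up q D (k.1, k.2 + s.1) w := by
  refine words_ext (T := hOp q D i s ∘ₗ up q D k)
    (T' := up q D k ∘ₗ hOp q D i s + gam q i k.1 s • up q D (k.1, k.2 + s.1)) ?_
    (fun l w h => ?_) w
  · simp [up_vac, hOp_vac]
  · simp only [LinearMap.comp_apply, LinearMap.add_apply, LinearMap.smul_apply] at h ⊢
    by_cases hkl : k.1 = l.1
    · simp only [up_down, hOp_down, map_add, map_sub, map_smul, h, hkl, if_true, hOp_psiOp]
      rw [show k.2 + s.1 + l.2 = k.2 + (l.2 + s.1) by ring]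
      module
    · simp only [up_down, hOp_down, map_add, map_sub, map_smul, h, hkl, if_false, add_zero]
      module

theorem kOp_up (i : Node M N) (e : ℤˣ) (k : Node M N × ℤ) (w : Words M N) :
    kOp q D i e (up q D k w) =
      (((q ^ cartan M i.1 k.1.1) ^ (e : ℤ) : ℂˣ) : ℂ) • up q D k (kOp q D i e w) := by
  refine words_ext (T := kOp q D i e ∘ₗ up q D k)
    (T' := (((q ^ cartan M i.1 k.1.1) ^ (e : ℤ) : ℂˣ) : ℂ) • (up q D k ∘ₗ kOp q D i e)) ?_
    (fun l w h => ?_) w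
  · simp [up_vac, kOp_vac]
  · simp only [LinearMap.comp_apply, LinearMap.smul_apply] at h ⊢
    by_cases hkl : k.1 = l.1
    · simp only [up_down, kOp_down, map_add, map_smul, h, hkl, if_true, kOp_psiOp]
      rw [smul_add, smul_add, smul_smul _ _ (psiOp _ _ _ _ _), ← Units.val_mul, ← mul_zpow,
        mul_inv_cancel, one_zpow, Units.val_one, one_smul]
      module
    · simp only [up_down, kOp_down, map_smul, h, hkl, if_false, add_zero]
      module

theorem basicRels_wordOp : BasicRels q (wordOp q D) where
  K_Kinv i := kOp_mul_kOp q D i 1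
  Kinv_K i := kOp_mul_kOp q D i (-1)
  K_K i j := kOp_kOp q D i j 1 1
  K_h i j s := kOp_hOp q D i j 1 s
  h_h i j s t := hOp_hOp q D i j s t
  K_X ε i j n := by
    refine LinearMap.ext fun w => ?_
    rcases Int.units_eq_one_or ε with rfl | rfl
    · have := kOp_up q D i 1 (j, n) w
      simpa [wordOp] using this
    · have := kOp_down q D i 1 (j, n) w
      simpa [wordOp, show (-1 : ℤˣ) ≠ 1 by decide] using this
  h_X ε i j s n := by
    refine LinearMap.ext fun w => ?_
    rcases Int.units_eq_one_or ε with rfl | rfl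
    · have := hOp_up q D i s (j, n) w
      simp [wordOp, this, gam]
    · have := hOp_down q D i s (j, n) w
      simp [wordOp, show (-1 : ℤˣ) ≠ 1 by decide, this, gam]
  X_X i j m n := by
    refine LinearMap.ext fun w => ?_
    have := up_down q D (i, m) (j, n) w
    simp only [wordOp, if_true, show (-1 : ℤˣ) ≠ 1 by decide, if_false, LinearMap.sub_apply,
      Module.End.mul_apply, LinearMap.smul_apply, this, phi_wordOp, add_sub_cancel_left]
    split_ifs <;> rfl

end Words
end QAffSuper
end

noncomputable section

namespace QAffSuper

/-! ### The quotient by the largest raising-stable subspace in the kernel of `top`. -/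

section MaxSub

variable {M N : ℕ} (q : ℂˣ) (D : HData M N) {R : Type} [CommRing R] [Algebra ℂ R]
  (o : Node M N) (ζ : Rˣ)

/-- The components of a word in the weight `λ` and in the weight `λ - α_o`, the latter being mapped
to `R` by `X_{o,n}^- v ↦ ζ^n`. -/
def topList : List (Node M N × ℤ) → ℂ × R
  | [] => (1, 0)
  | [l] => if l.1 = o then (0, ((ζ ^ l.2 : Rˣ) : R)) else 0
  | _ :: _ :: _ => 0

/-- The linear extension of `topList`. -/
def top : Words M N →ₗ[ℂ] ℂ × R := Finsupp.linearCombination ℂ (topList o ζ)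

theorem top_vac : top o ζ (vac M N) = (1, 0) := by
  simp [top, vac, topList]

theorem top_down (l : Node M N × ℤ) (w : Words M N) : top o ζ (down l w) =
    if l.1 = o then (0, (top o ζ w).1 • ((ζ ^ l.2 : Rˣ) : R)) else 0 := by
  by_cases h : l.1 = o
  · simp only [h, if_true]
    refine linearMap_eq_of_single (T := top o ζ ∘ₗ down l)
      (T' := (LinearMap.inr ℂ ℂ R ∘ₗ LinearMap.toSpanSingleton ℂ R ((ζ ^ l.2 : Rˣ) : R)) ∘ₗ
        LinearMap.fst ℂ ℂ R ∘ₗ top o ζ) (fun w => ?_) w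
    simp only [LinearMap.comp_apply, down_single]
    rcases w with _ | ⟨l', _ | ⟨l'', w⟩⟩
    · simp [top, topList, h]
    · by_cases h' : l'.1 = o <;> simp [top, topList, h', Prod.zero_eq_mk]
    · simp [top, topList, Prod.zero_eq_mk]
  · simp only [h, if_false]
    refine linearMap_eq_of_single (T := top o ζ ∘ₗ down l) (T' := 0) (fun w => ?_) w
    simp only [LinearMap.comp_apply, down_single]
    rcases w with _ | ⟨l', w⟩ <;> simp [top, topList, h]

theorem top_down_down (l l' : Node M N × ℤ) (w : Words M N) :
    top o ζ (down l (down l' w)) = 0 := by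
  rw [top_down, top_down]
  split_ifs <;> simp

/-- The Cartan operators descend along `top`, so they preserve its kernel. On the component `R`, the
shift of a letter by `s` is multiplication by `ζ^s`; negative `s` is why `ζ` must be a unit. -/
theorem top_hOp (i : Node M N) (s : {s : ℤ // s ≠ 0}) (w : Words M N) :
    top o ζ (hOp q D i s w) = (D.η i s * (top o ζ w).1,
      D.η i s • (top o ζ w).2 - gam q i o s • (((ζ ^ s.1 : Rˣ) : R) * (top o ζ w).2)) := by
  refine words_ext (T := top o ζ ∘ₗ hOp q D i s)
    (T' := LinearMap.prodMap (D.η i s • LinearMap.id) (D.η i s • LinearMap.id -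
      gam q i o s • LinearMap.mulLeft ℂ ((ζ ^ s.1 : Rˣ) : R)) ∘ₗ top o ζ) ?_ (fun l w h => ?_) w
  · simp [hOp_vac, top_vac]
  · simp only [LinearMap.comp_apply] at h ⊢
    rw [hOp_down, map_sub, map_smul, top_down, top_down, h, top_down]
    by_cases hl : l.1 = o
    · simp only [hl, if_true]
      refine Prod.ext ?_ ?_
      · simp
      · simp [zpow_add, mul_comm, mul_smul]
        module
    · simp [hl, Prod.zero_eq_mk]

theorem top_kOp (i : Node M N) (e : ℤˣ) (w : Words M N) :
    top o ζ (kOp q D i e w) = (((D.κ i ^ (e : ℤ) : ℂˣ) : ℂ) * (top o ζ w).1,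
      (((D.κ i ^ (e : ℤ) : ℂˣ) : ℂ) * (((q ^ cartan M i.1 o.1)⁻¹ ^ (e : ℤ) : ℂˣ) : ℂ)) •
        (top o ζ w).2) := by
  refine words_ext (T := top o ζ ∘ₗ kOp q D i e)
    (T' := LinearMap.prodMap (((D.κ i ^ (e : ℤ) : ℂˣ) : ℂ) • LinearMap.id)
      ((((D.κ i ^ (e : ℤ) : ℂˣ) : ℂ) * (((q ^ cartan M i.1 o.1)⁻¹ ^ (e : ℤ) : ℂˣ) : ℂ)) •
        LinearMap.id) ∘ₗ top o ζ) ?_ (fun l w h => ?_) w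
  · simp [kOp_vac, top_vac]
  · simp only [LinearMap.comp_apply] at h ⊢
    rw [kOp_down, map_smul, top_down, h, top_down]
    by_cases hl : l.1 = o
    · simp only [hl, if_true]
      refine Prod.ext ?_ ?_
      · simp
      · simp [smul_smul, mul_comm]
        rw [mul_assoc]
    · simp [hl, Prod.zero_eq_mk]

/-- The product of the raising operators labelled by the letters of a list, the head acting
first. -/
def upProd : List (Node M N × ℤ) → Module.End ℂ (Words M N)
  | [] => 1
  | k :: x => upProd x * up q D k

/-- The largest submodule of the space of words that does not meet the quotient defined by
`top`. -/
def maxSub : Submodule ℂ (Words M N) :=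
  ⨅ x, LinearMap.ker (top o ζ ∘ₗ upProd q D x)

theorem mem_maxSub {w : Words M N} :
    w ∈ maxSub q D o ζ ↔ ∀ x, top o ζ (upProd q D x w) = 0 := by
  simp [maxSub]

theorem up_mem_maxSub (k : Node M N × ℤ) {w : Words M N} (hw : w ∈ maxSub q D o ζ) :
    up q D k w ∈ maxSub q D o ζ := by
  rw [mem_maxSub] at hw ⊢
  exact fun x => hw (k :: x)

/-- The commutator of `h` with a raising operator is again a raising operator, so membership can be
tested by induction on the list of raising operators. -/
theorem hOp_mem_maxSub (i : Node M N) (s : {s : ℤ // s ≠ 0}) {w : Words M N}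
    (hw : w ∈ maxSub q D o ζ) : hOp q D i s w ∈ maxSub q D o ζ := by
  rw [mem_maxSub]
  intro x
  induction x generalizing w with
  | nil =>
    have h : top o ζ w = 0 := (mem_maxSub q D o ζ).mp hw []
    change top o ζ (hOp q D i s w) = 0
    rw [top_hOp, h]
    simp
  | cons k x ih =>
    change top o ζ (upProd q D x (up q D k (hOp q D i s w))) = 0
    rw [eq_sub_of_add_eq (hOp_up q D i s k w).symm, map_sub, map_sub, map_smul, map_smul,
      ih (up_mem_maxSub q D o ζ k hw),
      (mem_maxSub q D o ζ).mp (up_mem_maxSub q D o ζ (k.1, k.2 + s.1) hw) x, smul_zero, sub_zero]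

theorem kOp_mem_maxSub (i : Node M N) (e : ℤˣ) {w : Words M N}
    (hw : w ∈ maxSub q D o ζ) : kOp q D i e w ∈ maxSub q D o ζ := by
  rw [mem_maxSub]
  intro x
  induction x generalizing w with
  | nil =>
    have h : top o ζ w = 0 := (mem_maxSub q D o ζ).mp hw []
    change top o ζ (kOp q D i e w) = 0
    rw [top_kOp, h]
    simp
  | cons k x ih =>
    change top o ζ (upProd q D x (up q D k (kOp q D i e w))) = 0
    have h : up q D k (kOp q D i e w) =
        ((((q ^ cartan M i.1 k.1.1) ^ (e : ℤ))⁻¹ : ℂˣ) : ℂ) • kOp q D i e (up q D k w) := by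
      rw [kOp_up, smul_smul, Units.inv_mul, one_smul]
    rw [h, map_smul, map_smul, ih (up_mem_maxSub q D o ζ k hw), smul_zero]

theorem phi_mem_maxSub (ε : ℤˣ) (i : Node M N) (r : ℤ) {w : Words M N}
    (hw : w ∈ maxSub q D o ζ) : phi q (borelOp q D) ε i r w ∈ maxSub q D o ζ := by
  let S : Subalgebra ℂ (Module.End ℂ (Words M N)) :=
    { carrier := {T | ∀ w ∈ maxSub q D o ζ, T w ∈ maxSub q D o ζ}
      mul_mem' := fun ha hb w hw => ha _ (hb w hw)
      add_mem' := fun ha hb w hw => add_mem (ha w hw) (hb w hw)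
      algebraMap_mem' := fun c w hw => by
        simpa [Algebra.algebraMap_eq_smul_one] using Submodule.smul_mem _ c hw }
  have hK : borelOp q D (.K i) ∈ S := fun w hw => kOp_mem_maxSub q D o ζ i 1 hw
  have hKinv : borelOp q D (.Kinv i) ∈ S := fun w hw => kOp_mem_maxSub q D o ζ i (-1) hw
  have hh : ∀ s, borelOp q D (.h i s) ∈ S := fun s w hw => hOp_mem_maxSub q D o ζ i s hw
  have h := phi_mem (x := borelOp q D) q S hK hKinv hh ε r
  exact h w hw

theorem psiOp_mem_maxSub (i : Node M N) (r : ℤ) {w : Words M N}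
    (hw : w ∈ maxSub q D o ζ) : psiOp q D i r w ∈ maxSub q D o ζ :=
  Submodule.smul_mem _ _ (sub_mem (phi_mem_maxSub q D o ζ 1 i r hw)
    (phi_mem_maxSub q D o ζ (-1) i r hw))

/-- Moving a raising operator through the new letter gives that letter applied to a vector of
`maxSub`, plus a Cartan operator applied to one. The base case holds because `top` of a word with a
letter added depends only on `top` of the word. -/
theorem down_mem_maxSub (l : Node M N × ℤ) {w : Words M N}
    (hw : w ∈ maxSub q D o ζ) : down l w ∈ maxSub q D o ζ := by
  rw [mem_maxSub]
  intro x
  induction x generalizing w with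
  | nil =>
    have h : top o ζ w = 0 := (mem_maxSub q D o ζ).mp hw []
    change top o ζ (down l w) = 0
    rw [top_down, h]
    simp
  | cons k x ih =>
    change top o ζ (upProd q D x (up q D k (down l w))) = 0
    rw [up_down, map_add, map_add, map_smul, map_smul, ih (up_mem_maxSub q D o ζ k hw), smul_zero,
      zero_add]
    split_ifs
    · exact (mem_maxSub q D o ζ).mp (psiOp_mem_maxSub q D o ζ k.1 _ hw) x
    · simp

theorem wordOp_mem_maxSub (g : Gen M N) {w : Words M N}
    (hw : w ∈ maxSub q D o ζ) : wordOp q D g w ∈ maxSub q D o ζ := by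
  cases g with
  | X ε i n =>
    simp only [wordOp]
    split_ifs
    · exact up_mem_maxSub q D o ζ _ hw
    · exact down_mem_maxSub q D o ζ _ hw
  | K i => exact kOp_mem_maxSub q D o ζ i 1 hw
  | Kinv i => exact kOp_mem_maxSub q D o ζ i (-1) hw
  | h i s => exact hOp_mem_maxSub q D o ζ i s hw

/-- The quotient of the space of words by `maxSub`. -/
abbrev WordQuot : Type := Words M N ⧸ maxSub q D o ζ

/-- The operators on `WordQuot` labelled by the Drinfeld generators. -/
def quotOp (g : Gen M N) : Module.End ℂ (WordQuot q D o ζ) :=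
  Submodule.mapQ _ _ (wordOp q D g) fun _ hw => wordOp_mem_maxSub q D o ζ g hw

theorem quotOp_mk (g : Gen M N) (w : Words M N) :
    quotOp q D o ζ g (Submodule.Quotient.mk w) = Submodule.Quotient.mk (wordOp q D g w) := rfl

theorem phi_quotOp_mk (ε : ℤˣ) (i : Node M N) (n : ℤ) (w : Words M N) :
    phi q (quotOp q D o ζ) ε i n (Submodule.Quotient.mk w) =
      Submodule.Quotient.mk (phi q (wordOp q D) ε i n w) :=
  (phi_intertwine q (x := wordOp q D) (y := quotOp q D o ζ) (i := i) (maxSub q D o ζ).mkQ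
    (fun _ => rfl) (fun _ => rfl) (fun _ _ => rfl) ε n w).symm

theorem quot_ext {T T' : Module.End ℂ (WordQuot q D o ζ)}
    (h : ∀ w, T (Submodule.Quotient.mk w) = T' (Submodule.Quotient.mk w)) : T = T' :=
  LinearMap.ext fun v => Submodule.Quotient.induction_on _ v h

theorem basicRels_quotOp : BasicRels q (quotOp q D o ζ) := by
  have hx := basicRels_wordOp q D
  have mk := fun {w w' : Words M N} (h : w = w') =>
    congrArg (Submodule.Quotient.mk (p := maxSub q D o ζ)) h
  exact {
    K_Kinv := fun i => quot_ext q D o ζ fun w => mk (LinearMap.congr_fun (hx.K_Kinv i) w)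
    Kinv_K := fun i => quot_ext q D o ζ fun w => mk (LinearMap.congr_fun (hx.Kinv_K i) w)
    K_K := fun i j => quot_ext q D o ζ fun w => mk (LinearMap.congr_fun (hx.K_K i j) w)
    K_h := fun i j s => quot_ext q D o ζ fun w => mk (LinearMap.congr_fun (hx.K_h i j s) w)
    h_h := fun i j s t => quot_ext q D o ζ fun w => mk (LinearMap.congr_fun (hx.h_h i j s t) w)
    K_X := fun ε i j n => quot_ext q D o ζ fun w => mk (LinearMap.congr_fun (hx.K_X ε i j n) w)
    h_X := fun ε i j s n => quot_ext q D o ζ fun w =>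
      mk (LinearMap.congr_fun (hx.h_X ε i j s n) w)
    X_X := fun i j m n => quot_ext q D o ζ fun w => by
      have h := mk (LinearMap.congr_fun (hx.X_X i j m n) w)
      refine Eq.trans h ?_
      split_ifs
      · simp only [LinearMap.smul_apply, LinearMap.sub_apply, phi_quotOp_mk]
        rfl
      · rfl }

/-- The map induced by `top` on the quotient. -/
def quotTop : WordQuot q D o ζ →ₗ[ℂ] ℂ × R :=
  Submodule.liftQ _ (top o ζ) fun _ hw => (mem_maxSub q D o ζ).mp hw []

/-- Take for `L` the operators killing the vacuum. If such an operator super-commutes with every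
`X^-`, it kills every word, by induction on the length. -/
theorem extremal_quotOp_one :
    ∃ L, Extremal (quotOp q D o ζ) 1 L := by
  refine ⟨{ carrier := {T | T (Submodule.Quotient.mk (vac M N)) = 0}
            add_mem' := fun {a b} ha hb => ?_
            zero_mem' := rfl
            smul_mem' := fun c a ha => ?_ }, ?_⟩
  · have ha' : a (Submodule.Quotient.mk (vac M N)) = 0 := ha
    have hb' : b (Submodule.Quotient.mk (vac M N)) = 0 := hb
    change a _ + b _ = 0
    rw [ha', hb', add_zero]
  · have ha' : a (Submodule.Quotient.mk (vac M N)) = 0 := ha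
    change c • a _ = 0
    rw [ha', smul_zero]
  · have hvac : ∀ i m, quotOp q D o ζ (.X 1 i m) (Submodule.Quotient.mk (vac M N)) = 0 := by
      intro i m
      rw [quotOp_mk]
      change Submodule.Quotient.mk (up q D (i, m) (vac M N)) = _
      rw [up_vac]
      rfl
    refine ⟨fun i j m n => ?_, fun a ha i m => ?_, fun a ha σ hσ h => ?_⟩
    · exact (congrArg (quotOp q D o ζ (.X 1 i m)) (hvac j n)).trans (map_zero _)
    · exact (congrArg a (hvac i m)).trans (map_zero _)
    · refine quot_ext q D o ζ fun w => ?_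
      refine words_ext (T := a ∘ₗ (maxSub q D o ζ).mkQ) (T' := 0) ha (fun l w hw => ?_) w
      have h' := LinearMap.congr_fun (h l.1 l.2) (Submodule.Quotient.mk w)
      have hw' : a (Submodule.Quotient.mk w) = 0 := hw
      simp only [Module.End.mul_apply, LinearMap.smul_apply, hw', map_zero] at h'
      exact ((smul_eq_zero.mp h'.symm).resolve_left (hσ l.1))

/-- Take for `L` the operators with image in the kernel of `top`; words of length at least two lie
there. If such an operator super-commutes with every `X^+`, its image stays in that kernel after any
raising operators, hence is zero in the quotient by `maxSub`. -/
theorem extremal_quotOp_neg_one :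
    ∃ L, Extremal (quotOp q D o ζ) (-1) L := by
  refine ⟨{ carrier := {T | ∀ v, quotTop q D o ζ (T v) = 0}
            add_mem' := fun {a b} ha hb v => ?_
            zero_mem' := fun v => map_zero _
            smul_mem' := fun c a ha v => ?_ }, ?_⟩
  · change quotTop q D o ζ (a v + b v) = 0
    rw [map_add, ha, hb, add_zero]
  · change quotTop q D o ζ (c • a v) = 0
    rw [map_smul, ha, smul_zero]
  · refine ⟨fun i j m n v => ?_, fun a ha i m v => ha _, fun a ha σ hσ h => ?_⟩
    · induction v using Submodule.Quotient.induction_on with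
      | _ w =>
        exact top_down_down o ζ (i, m) (j, n) w
    · refine LinearMap.ext fun v => ?_
      obtain ⟨u, hu⟩ := Submodule.Quotient.mk_surjective _ (a v)
      rw [← hu, LinearMap.zero_apply, Submodule.Quotient.mk_eq_zero, mem_maxSub]
      intro x
      induction x generalizing v u with
      | nil =>
        have := ha v
        rw [← hu] at this
        exact this
      | cons k x ih =>
        have h' := LinearMap.congr_fun (h k.1 k.2) v
        simp only [Module.End.mul_apply, LinearMap.smul_apply] at h'
        rw [← hu] at h'
        obtain ⟨u', hu'⟩ := Submodule.Quotient.mk_surjective _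
          (a (quotOp q D o ζ (.X (- -1) k.1 k.2) v))
        have e : (Submodule.Quotient.mk (up q D k u) : WordQuot q D o ζ) =
            Submodule.Quotient.mk (σ k.1 • u') := by
          rw [Submodule.Quotient.mk_smul, hu', ← h']
          rfl
        have e2 := (mem_maxSub q D o ζ).mp ((Submodule.Quotient.eq _).mp e) x
        rw [map_sub, map_sub, map_smul, map_smul, ih _ u' hu', smul_zero, sub_zero] at e2
        exact e2

/-- The action of `U_q(L sl(M,N))` on `WordQuot`. -/
def quotRep (hq : ∀ n : ℕ, 0 < n → q ^ n ≠ 1) : U q M N →ₐ[ℂ] Module.End ℂ (WordQuot q D o ζ) :=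
  liftU q (FreeAlgebra.lift ℂ (quotOp q D o ζ)) fun _ _ h =>
    (basicRels_quotOp q D o ζ).lift_eq hq (fun ε => by
      rcases Int.units_eq_one_or ε with rfl | rfl
      · exact extremal_quotOp_one q D o ζ
      · exact extremal_quotOp_neg_one q D o ζ) h

theorem quotRep_gen (hq : ∀ n : ℕ, 0 < n → q ^ n ≠ 1) (g : Gen M N) :
    quotRep q D o ζ hq (gen q g) = quotOp q D o ζ g := by
  simp [quotRep, gen, liftU_toU]

theorem quotRep_phi (hq : ∀ n : ℕ, 0 < n → q ^ n ≠ 1) (ε : ℤˣ) (i : Node M N) (n : ℤ) :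
    quotRep q D o ζ hq (phi q (gen q) ε i n) = phi q (quotOp q D o ζ) ε i n := by
  rw [map_phi]
  simp only [quotRep_gen]

end MaxSub
end QAffSuper
end

noncomputable section

namespace QAffSuper

/-! ### Expansions of a rational function at zero and at infinity. -/

section RationalSeries

variable {ι : Type} [Fintype ι]

/-- The polynomial `∏_k (1 - a_k z)`. -/
def linProd (a : ι → ℂ) : Polynomial ℂ :=
  ∏ k, (1 - Polynomial.C (a k) * Polynomial.X)

theorem coeff_zero_linProd (a : ι → ℂ) : (linProd a).coeff 0 = 1 := by
  rw [Polynomial.coeff_zero_eq_eval_zero, linProd, Polynomial.eval_prod]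
  simp

theorem linProd_coe_ne_zero (a : ι → ℂ) : (linProd a : PowerSeries ℂ) ≠ 0 := by
  rw [Ne, Polynomial.coe_eq_zero_iff]
  intro h
  simpa [h] using coeff_zero_linProd a

/-- The series `∑_{s ≥ 1} a^s z^s`. -/
def geomTail (a : ℂ) : PowerSeries ℂ := PowerSeries.mk fun s => if s = 0 then 0 else a ^ s

theorem theta_one_sub (a : ℂ) : theta ((1 - Polynomial.C a * Polynomial.X : Polynomial ℂ) :
    PowerSeries ℂ) = -geomTail a * ((1 - Polynomial.C a * Polynomial.X : Polynomial ℂ) :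
    PowerSeries ℂ) := by
  ext n
  rw [Polynomial.coe_sub, Polynomial.coe_mul, Polynomial.coe_C, Polynomial.coe_X,
    Polynomial.coe_one, neg_mul, mul_sub, mul_one, mul_comm (PowerSeries.C a), ← mul_assoc]
  rcases n with _ | _ | n
  · simp [geomTail]
  · simp [geomTail, PowerSeries.coeff_one, mul_comm]
  · simp [geomTail, PowerSeries.coeff_succ_mul_X, PowerSeries.coeff_one, pow_succ,
      PowerSeries.coeff_X]

theorem theta_linProd (a : ι → ℂ) : theta (linProd a : PowerSeries ℂ) =
    -(∑ k, geomTail (a k)) * (linProd a : PowerSeries ℂ) := by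
  classical
  unfold linProd
  induction (Finset.univ : Finset ι) using Finset.induction_on with
  | empty => simp [theta_one]
  | insert k s hk ih =>
    rw [Finset.prod_insert hk, Finset.sum_insert hk, Polynomial.coe_mul, theta_mul, ih,
      theta_one_sub]
    ring

/-- Both sides have the logarithmic derivative of `∏ (1 - α_k z)` and constant term one. -/
theorem linProd_mul_expSeries (α β : ι → ℂ) {g : PowerSeries ℂ} (h0 : PowerSeries.coeff 0 g = 0)
    (hg : ∀ s : ℕ, s ≠ 0 → (s : ℂ) * PowerSeries.coeff s g = ∑ k, (β k ^ s - α k ^ s)) :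
    (linProd β : PowerSeries ℂ) * expSeries g = linProd α := by
  have hθ : theta g = ∑ k, geomTail (β k) - ∑ k, geomTail (α k) := by
    ext s
    by_cases hs : s = 0
    · simp [hs, geomTail]
    · simp [hg s hs, hs, geomTail, map_sum]
  refine eq_of_theta_eq (H := -∑ k, geomTail (α k)) ?_ ?_ (theta_linProd α) ?_
  · simp [geomTail, map_sum]
  · rw [theta_mul, theta_linProd, theta_expSeries h0 (Commute.all _ _), hθ]
    ring
  · rw [PowerSeries.coeff_mul, Finset.Nat.antidiagonal_zero, Finset.sum_singleton,
      Polynomial.coeff_coe, Polynomial.coeff_coe, coeff_zero_linProd, coeff_zero_linProd,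
      expSeries, PowerSeries.coeff_mk, expCoeff_zero, one_mul]

/-- The scalars by which the `h_{i,s}` act when the `φ_i^±` act by the expansions of a constant
times `∏_k (1 - α_k z)/(1 - β_k z)`, with `p = q_i`. -/
def rootEta (p : ℂˣ) (α β : ι → ℂˣ) (s : {s : ℤ // s ≠ 0}) : ℂ :=
  (∑ k, (((β k ^ s.1 : ℂˣ) : ℂ) - ((α k ^ s.1 : ℂˣ) : ℂ))) / (s.1 * ((p : ℂ) - (p⁻¹ : ℂˣ)))

theorem phi_natCast {A : Type} [Ring A] [Algebra ℂ A] (q : ℂˣ) {M N : ℕ} (x : Gen M N → A)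
    (ε : ℤˣ) (i : Node M N) (n : ℕ) : phi q x ε i ((ε : ℤ) * n) =
      (if ε = 1 then x (.K i) else x (.Kinv i)) * expCoeff (hSeries q x ε i) n := by
  rcases Int.units_eq_one_or ε with rfl | rfl
  · simpa using phi_one_natCast q x i n
  · simpa [show (-1 : ℤˣ) ≠ 1 by decide] using phi_neg_one_neg_natCast q x i n

variable {q : ℂˣ} (hq : ∀ n : ℕ, 0 < n → q ^ n ≠ 1) {M N : ℕ} {y : Gen M N → ℂ} {i : Node M N}
  {κ : ℂˣ} {α β : ι → ℂˣ} (hK : y (.K i) = κ) (hKinv : y (.Kinv i) = (κ⁻¹ : ℂˣ))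
  (hh : ∀ s, y (.h i s) = rootEta (qn q M i.1) α β s)
include hq hK hKinv hh

/-- The rational form of `φ_i^±`, with the denominator cleared. For `ε = -1` the variable is `z⁻¹`,
so the roots are inverted. -/
theorem linProd_mul_phi (ε : ℤˣ) :
    (linProd fun k => ((β k ^ (ε : ℤ) : ℂˣ) : ℂ) : PowerSeries ℂ) *
      PowerSeries.mk (fun n : ℕ => phi q y ε i ((ε : ℤ) * n)) =
    PowerSeries.C ((κ ^ (ε : ℤ) : ℂˣ) : ℂ) * (linProd fun k => ((α k ^ (ε : ℤ) : ℂˣ) : ℂ)) := by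
  rw [← linProd_mul_expSeries (g := hSeries q y ε i) (fun k => ((α k ^ (ε : ℤ) : ℂˣ) : ℂ))
    (fun k => ((β k ^ (ε : ℤ) : ℂˣ) : ℂ)) (coeff_zero_hSeries q y ε i), mul_left_comm]
  · congr 1
    ext n
    rw [PowerSeries.coeff_mk, phi_natCast, PowerSeries.coeff_C_mul, expSeries,
      PowerSeries.coeff_mk]
    congr 1
    rcases Int.units_eq_one_or ε with rfl | rfl
    · simp [hK]
    · simp [hKinv, show (-1 : ℤˣ) ≠ 1 by decide]
  · intro s hs
    rw [coeff_hSeries q y ε i hs, hh, rootEta]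
    have h1 := qn_sub_inv_ne_zero hq M i.1
    have h2 : (s : ℂ) ≠ 0 := by exact_mod_cast hs
    have h3 : ((ε : ℤ) : ℂ) ≠ 0 := by exact_mod_cast ε.ne_zero
    generalize (qn q M i.1 : ℂ) - ((qn q M i.1)⁻¹ : ℂˣ) = δ at h1
    push_cast [smul_eq_mul, ← zpow_natCast, ← zpow_mul]
    field_simp

omit hq hK hKinv hh in
theorem one_sub_mul_geom (a : ℂ) :
    ((1 - Polynomial.C a * Polynomial.X : Polynomial ℂ) : PowerSeries ℂ) *
      PowerSeries.mk (fun n => a ^ n) = 1 := by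
  ext n
  rw [Polynomial.coe_sub, Polynomial.coe_mul, Polynomial.coe_C, Polynomial.coe_X,
    Polynomial.coe_one, sub_mul, one_mul, mul_assoc]
  rcases n with _ | n
  · simp
  · simp [PowerSeries.coeff_succ_X_mul, PowerSeries.coeff_one, pow_succ, mul_comm]

/-- The residue at `z = 1/β_k` in the partial fraction expansion of
`∏_j (1 - α_j z)/(1 - β_j z)`. -/
def resid {ι : Type} [Fintype ι] [DecidableEq ι] (α β : ι → ℂ) (k : ι) : ℂ :=
  (∏ j, (1 - α j / β k)) / ∏ j ∈ Finset.univ.erase k, (1 - β j / β k)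

-- Partial fractions. The constant term on the right matches the leading coefficients, so the
-- difference has degree below the number of poles, and it vanishes at every `1/β_k`, where only one
-- summand survives.
omit hq hK hKinv hh in
theorem linProd_eq_sum_resid [DecidableEq ι] {α β : ι → ℂ} (hβ0 : ∀ k, β k ≠ 0)
    (hβ : Function.Injective β) :
    linProd α = Polynomial.C (∏ k, α k / β k) * linProd β +
      ∑ k, Polynomial.C (resid α β k) *
        ∏ j ∈ Finset.univ.erase k, (1 - Polynomial.C (β j) * Polynomial.X) := by
  have hinj : Function.Injective fun k => (β k)⁻¹ := fun k l h => hβ (inv_injective h)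
  have hdeg : ∀ (a : ι → ℂ) (s : Finset ι),
      (∏ j ∈ s, (1 - Polynomial.C (a j) * Polynomial.X)).degree ≤ ((s.card : ℕ) : WithBot ℕ) := by
    intro a s
    refine (Polynomial.degree_prod_le _ _).trans ?_
    refine (Finset.sum_le_card_nsmul s _ 1 fun j _ => ?_).trans (by simp)
    compute_degree
  have hcoeff : ∀ (a : ι → ℂ) (s : Finset ι),
      (∏ j ∈ s, (1 - Polynomial.C (a j) * Polynomial.X)).coeff s.card = ∏ j ∈ s, -a j := by
    intro a s
    have := Polynomial.coeff_prod_of_natDegree_le (s := s)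
      (f := fun j => 1 - Polynomial.C (a j) * Polynomial.X) 1 (fun j _ => by compute_degree)
    rw [mul_one] at this
    rw [this]
    refine Finset.prod_congr rfl fun j _ => ?_
    simp [Polynomial.coeff_one]
  refine Polynomial.eq_of_degree_sub_lt_of_eval_finset_eq
    (Finset.univ.image fun k => (β k)⁻¹) ?_ ?_
  · rw [Finset.card_image_of_injective _ hinj, Finset.card_univ, Polynomial.degree_lt_iff_coeff_zero]
    intro m hm
    have h2 : (∑ k, Polynomial.C (resid α β k) *
        ∏ j ∈ Finset.univ.erase k, (1 - Polynomial.C (β j) * Polynomial.X)).coeff m = 0 := by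
      rw [Polynomial.finsetSum_coeff]
      refine Finset.sum_eq_zero fun k _ => ?_
      rw [Polynomial.coeff_C_mul, Polynomial.coeff_eq_zero_of_degree_lt, mul_zero]
      refine (hdeg β _).trans_lt ?_
      have : (Finset.univ.erase k).card < Fintype.card ι :=
        Finset.card_lt_univ_of_notMem (Finset.notMem_erase k _)
      exact_mod_cast this.trans_le hm
    rw [Polynomial.coeff_sub, Polynomial.coeff_add, h2, add_zero, Polynomial.coeff_C_mul]
    rcases hm.eq_or_lt with rfl | hm
    · unfold linProd
      rw [← Finset.card_univ, hcoeff, hcoeff, ← Finset.prod_mul_distrib, sub_eq_zero]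
      refine Finset.prod_congr rfl fun k _ => ?_
      have := hβ0 k
      field_simp
    · unfold linProd
      rw [Polynomial.coeff_eq_zero_of_degree_lt, Polynomial.coeff_eq_zero_of_degree_lt, mul_zero,
        sub_zero]
      all_goals
        refine (hdeg _ _).trans_lt ?_
        rw [Finset.card_univ]
        exact_mod_cast hm
  · intro x hx
    obtain ⟨k, -, rfl⟩ := Finset.mem_image.mp hx
    have hev : ∀ (a : ι → ℂ) (s : Finset ι),
        (∏ j ∈ s, (1 - Polynomial.C (a j) * Polynomial.X)).eval (β k)⁻¹ =
          ∏ j ∈ s, (1 - a j / β k) := by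
      intro a s
      rw [Polynomial.eval_prod]
      simp [div_eq_mul_inv]
    have hz : ∀ s : Finset ι, k ∈ s → ∏ j ∈ s, (1 - β j / β k) = 0 := fun s hs =>
      Finset.prod_eq_zero hs (by rw [div_self (hβ0 k), sub_self])
    rw [linProd, linProd, hev, Polynomial.eval_add, Polynomial.eval_mul, hev,
      hz _ (Finset.mem_univ k), mul_zero, zero_add, Polynomial.eval_finsetSum,
      Finset.sum_eq_single k]
    · rw [Polynomial.eval_mul, Polynomial.eval_C, hev, resid, div_mul_cancel₀]
      refine Finset.prod_ne_zero_iff.mpr fun j hj h => (Finset.ne_of_mem_erase hj) (hβ ?_)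
      exact ((div_eq_one_iff_eq (hβ0 k)).mp (sub_eq_zero.mp h).symm)
    · intro l _ hl
      rw [Polynomial.eval_mul, hev, hz _ (Finset.mem_erase.mpr ⟨hl.symm, Finset.mem_univ _⟩),
        mul_zero]
    · simp

omit hq hK hKinv hh in
theorem eq_of_linProd_mul [DecidableEq ι] {α β : ι → ℂ} (hβ0 : ∀ k, β k ≠ 0)
    (hβ : Function.Injective β) {c : ℂ} {F : PowerSeries ℂ}
    (hF : (linProd β : PowerSeries ℂ) * F = PowerSeries.C c * linProd α) (n : ℕ) :
    PowerSeries.coeff n F = (if n = 0 then c * ∏ k, α k / β k else 0) +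
      ∑ k, c * resid α β k * β k ^ n := by
  have hG : F = PowerSeries.C (c * ∏ k, α k / β k) +
      ∑ k, PowerSeries.C (c * resid α β k) * PowerSeries.mk (fun n => β k ^ n) := by
    refine mul_left_cancel₀ (linProd_coe_ne_zero β) ?_
    rw [hF, linProd_eq_sum_resid hβ0 hβ, mul_add, Polynomial.coe_add, mul_add, Polynomial.coe_mul,
      Polynomial.coe_C, map_mul, Finset.mul_sum]
    congr 1
    · ring
    · rw [← Polynomial.coeToPowerSeries.ringHom_apply, map_sum, Finset.mul_sum]
      refine Finset.sum_congr rfl fun k _ => ?_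
      rw [Polynomial.coeToPowerSeries.ringHom_apply, Polynomial.coe_mul, Polynomial.coe_C, linProd,
        ← Finset.mul_prod_erase _ _ (Finset.mem_univ k), Polynomial.coe_mul, map_mul]
      linear_combination (-PowerSeries.C c * PowerSeries.C (resid α β k) *
        ((∏ j ∈ Finset.univ.erase k, (1 - Polynomial.C (β j) * Polynomial.X) : Polynomial ℂ) :
          PowerSeries ℂ)) * one_sub_mul_geom (β k)
  rw [hG, map_add, PowerSeries.coeff_C, map_sum]
  congr 1
  refine Finset.sum_congr rfl fun k _ => ?_
  rw [PowerSeries.coeff_C_mul, PowerSeries.coeff_mk]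

-- Compares the residues for the expansion in `z⁻¹` with those in `z`; the sign and the product
-- account for the change of variable and of leading constant.
omit hq hK hKinv hh in
theorem resid_inv [DecidableEq ι] {α β : ι → ℂ} (hα0 : ∀ k, α k ≠ 0) (hβ0 : ∀ k, β k ≠ 0) (k : ι) :
    resid (fun k => (α k)⁻¹) (fun k => (β k)⁻¹) k = -(∏ j, β j / α j) * resid α β k := by
  have e1 : ∀ j, 1 - (α j)⁻¹ / (β k)⁻¹ = -(β k / α j) * (1 - α j / β k) := fun j => by
    have := hα0 j
    have := hβ0 k
    field_simp
    ring
  have e2 : ∀ j, 1 - (β j)⁻¹ / (β k)⁻¹ = -(β k / β j) * (1 - β j / β k) := fun j => by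
    have := hβ0 j
    have := hβ0 k
    field_simp
    ring
  have e3 : ∏ j, -(β k / α j) =
      -(∏ j, β j / α j) * ∏ j ∈ Finset.univ.erase k, -(β k / β j) := by
    rw [← Finset.mul_prod_erase _ (fun j => -(β k / α j)) (Finset.mem_univ k),
      ← Finset.mul_prod_erase _ (fun j => β j / α j) (Finset.mem_univ k), ← neg_mul, mul_assoc,
      ← Finset.prod_mul_distrib]
    congr 1
    refine Finset.prod_congr rfl fun j _ => ?_
    have := hα0 j
    have := hβ0 j
    field_simp
  unfold resid
  simp only [e1, e2]
  rw [Finset.prod_mul_distrib, Finset.prod_mul_distrib, e3]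
  have h4 : ∏ j ∈ Finset.univ.erase k, -(β k / β j) ≠ 0 :=
    Finset.prod_ne_zero_iff.mpr fun j _ => neg_ne_zero.mpr (div_ne_zero (hβ0 _) (hβ0 _))
  rw [mul_comm (-∏ j, β j / α j), mul_assoc, mul_div_mul_left _ _ h4, mul_div_assoc]

/-- `φ^+` and `φ^-` expand the same rational function at zero and at infinity, so their difference
is a sum of delta functions at its simple poles. The condition on `κ²` says that the value at
infinity is `κ⁻¹`, the constant term of `φ^-`. -/
theorem phi_sub_phi [DecidableEq ι] (hβ : Function.Injective β) (hκ : κ ^ 2 = ∏ k, β k / α k)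
    (n : ℤ) : phi q y 1 i n - phi q y (-1) i n =
      ∑ k, (κ : ℂ) * resid (fun k => (α k : ℂ)) (fun k => (β k : ℂ)) k * ((β k ^ n : ℂˣ) : ℂ) := by
  have hβ' : Function.Injective fun k => (β k : ℂ) := fun k l h => hβ (Units.ext h)
  have hβi : Function.Injective fun k => (β k : ℂ)⁻¹ := fun k l h => hβ' (inv_injective h)
  have hκ2 : (κ : ℂ) ^ 2 = ∏ k, (β k : ℂ) / α k := by
    rw [← Units.val_pow_eq_pow_val, hκ]
    push_cast
    rfl
  have hαβ : (∏ k, (α k : ℂ) / β k) = ((κ : ℂ) ^ 2)⁻¹ := by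
    rw [hκ2, ← Finset.prod_inv_distrib]
    exact Finset.prod_congr rfl fun k _ => (inv_div _ _).symm
  have hκ0 : (κ : ℂ) ≠ 0 := κ.ne_zero
  have h1 := linProd_mul_phi hq hK hKinv hh 1
  have h2 := linProd_mul_phi hq hK hKinv hh (-1)
  simp only [Units.val_one, zpow_one, one_mul, Units.val_neg, zpow_neg, neg_mul,
    Units.val_inv_eq_inv_val] at h1 h2
  have p1 := eq_of_linProd_mul (fun k => (β k).ne_zero) hβ' h1
  have p2 := eq_of_linProd_mul (fun k => inv_ne_zero (β k).ne_zero) hβi h2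
  simp only [PowerSeries.coeff_mk, resid_inv (fun k => (α k).ne_zero) (fun k => (β k).ne_zero)]
    at p1 p2
  rw [hαβ] at p1
  rw [← hκ2] at p2
  rcases lt_trichotomy n 0 with hn | rfl | hn
  · obtain ⟨m, rfl⟩ : ∃ m : ℕ, n = -m := ⟨n.natAbs, by omega⟩
    rw [phi_of_neg q y 1 i (by simpa using hn), p2, if_neg (by omega), zero_add, zero_sub,
      ← Finset.sum_neg_distrib]
    refine Finset.sum_congr rfl fun k _ => ?_
    push_cast [zpow_neg, zpow_natCast, inv_pow]
    field_simp
  · have a1 := p1 0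
    have a2 : phi q y (-1) i 0 = (κ : ℂ)⁻¹ := by
      have := phi_neg_one_neg_natCast q y i 0
      simpa [expCoeff_zero, hKinv] using this
    simp only [Nat.cast_zero, if_true, pow_zero, mul_one] at a1
    rw [a1, a2]
    simp only [zpow_zero, Units.val_one, mul_one]
    field_simp
    ring
  · obtain ⟨m, rfl⟩ : ∃ m : ℕ, n = m := ⟨n.natAbs, by omega⟩
    rw [phi_of_neg q y (-1) i (by simpa using hn), p1, if_neg (by omega), zero_add, sub_zero]
    simp

end RationalSeries
end QAffSuper
end

noncomputable section

namespace QAffSuper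

/-! ### An explicit module for one even node, with basis the subsets of `Fin p`. -/

section RankOne

variable {p : ℕ} (r : ℂˣ) (a : Fin p → ℂˣ)

/-- The numerator roots of the eigenvalue of `φ` on the vector labelled by `S`. -/
def rootsNum (S : Finset (Fin p)) (k : Fin p) : ℂˣ :=
  if k ∈ S then r ^ 2 * a k else (r ^ 2)⁻¹ * a k

/-- The eigenvalue of `K` on the vector labelled by `S`. -/
def kapSet (S : Finset (Fin p)) : ℂˣ := ∏ k, if k ∈ S then r⁻¹ else r

theorem kapSet_sq (S : Finset (Fin p)) : kapSet r S ^ 2 = ∏ k, a k / rootsNum r a S k := by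
  rw [kapSet, ← Finset.prod_pow]
  refine Finset.prod_congr rfl fun k _ => ?_
  unfold rootsNum
  split_ifs <;> simp [div_eq_mul_inv]

/-- The structure constant `(r - r⁻¹ x)/(1 - x)` with `x = a_j / a_k`. -/
def fUp (j k : Fin p) : ℂ := (r - (r : ℂ)⁻¹ * (a j / a k)) / (1 - a j / a k)

/-- The structure constant `(r⁻¹ - r x)/(1 - x)` with `x = a_j / a_k`. -/
def fDown (j k : Fin p) : ℂ := ((r : ℂ)⁻¹ - r * (a j / a k)) / (1 - a j / a k)

theorem one_sub_div_ne_zero {a : Fin p → ℂˣ} (ha : Function.Injective a) {j k : Fin p}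
    (h : j ≠ k) : 1 - (a j : ℂ) / a k ≠ 0 := by
  intro e
  exact h (ha (Units.ext ((div_eq_one_iff_eq (a k).ne_zero).mp (sub_eq_zero.mp e).symm)))

/-- Replacing `x` by `1/x` exchanges the two structure constants. This symmetry is what makes the
off-diagonal terms of the commutator cancel. -/
theorem fDown_eq_fUp {a : Fin p → ℂˣ} (ha : Function.Injective a) {j k : Fin p} (h : j ≠ k) :
    fDown r a j k = fUp r a k j := by
  have h1 := one_sub_div_ne_zero ha h
  have h2 := one_sub_div_ne_zero ha h.symm
  have hj : (a j : ℂ) ≠ 0 := (a j).ne_zero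
  have hk : (a k : ℂ) ≠ 0 := (a k).ne_zero
  have hr : (r : ℂ) ≠ 0 := r.ne_zero
  rw [fDown, fUp, div_eq_div_iff h1 h2]
  field_simp
  ring

/-- The factor `j = k` of the residue gives `±(r - r⁻¹)`, according to whether `k` lies in `S`; each
other factor combines with one factor `r^{±1}` of `K` into a structure constant. -/
theorem kapSet_mul_resid {a : Fin p → ℂˣ} (ha : Function.Injective a) (S : Finset (Fin p))
    (k : Fin p) :
    (kapSet r S : ℂ) * resid (fun k => (rootsNum r a S k : ℂ)) (fun k => (a k : ℂ)) k =
      (if k ∈ S then -((r : ℂ) - (r⁻¹ : ℂˣ)) else (r : ℂ) - (r⁻¹ : ℂˣ)) *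
        ((∏ j ∈ S.erase k, fDown r a j k) * ∏ j ∈ Sᶜ.erase k, fUp r a j k) := by
  have hr : (r : ℂ) ≠ 0 := r.ne_zero
  have hk : (a k : ℂ) ≠ 0 := (a k).ne_zero
  have hprod : (∏ j ∈ S.erase k, fDown r a j k) * ∏ j ∈ Sᶜ.erase k, fUp r a j k =
      ∏ j ∈ Finset.univ.erase k, if j ∈ S then fDown r a j k else fUp r a j k := by
    rw [Finset.prod_ite]
    congr 1
    · refine Finset.prod_congr ?_ fun _ _ => rfl
      ext j; simp [and_comm]
    · refine Finset.prod_congr ?_ fun _ _ => rfl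
      ext j; simp [and_comm]
  rw [hprod, resid, kapSet, Units.coe_prod,
    ← Finset.mul_prod_erase _ (fun k => ((if k ∈ S then r⁻¹ else r : ℂˣ) : ℂ)) (Finset.mem_univ k),
    ← Finset.mul_prod_erase _ (fun j => 1 - (rootsNum r a S j : ℂ) / a k) (Finset.mem_univ k),
    mul_div_assoc, mul_mul_mul_comm, ← Finset.prod_div_distrib, ← Finset.prod_mul_distrib]
  congr 1
  · unfold rootsNum
    split_ifs
    · push_cast
      field_simp
      ring
    · push_cast
      field_simp
  · refine Finset.prod_congr rfl fun j hj => ?_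
    have := one_sub_div_ne_zero ha (Finset.ne_of_mem_erase hj)
    unfold rootsNum fDown fUp
    split_ifs
    · push_cast
      field_simp
    · push_cast
      field_simp

/-- The lowering operators. -/
def lowOp (n : ℤ) : Module.End ℂ (Finset (Fin p) →₀ ℂ) :=
  Finsupp.linearCombination ℂ fun S => ∑ k ∈ Sᶜ,
    (((a k ^ n : ℂˣ) : ℂ) * ∏ j ∈ S, fDown r a j k) • Finsupp.single (insert k S) 1

/-- The raising operators. -/
def raiseOp (m : ℤ) : Module.End ℂ (Finset (Fin p) →₀ ℂ) :=
  Finsupp.linearCombination ℂ fun S => ∑ k ∈ S,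
    (((a k ^ m : ℂˣ) : ℂ) * ∏ j ∈ Sᶜ, fUp r a j k) • Finsupp.single (S.erase k) 1

/-- Diagonal operators. -/
def diagOp (f : Finset (Fin p) → ℂ) : Module.End ℂ (Finset (Fin p) →₀ ℂ) :=
  Finsupp.linearCombination ℂ fun S => f S • Finsupp.single S 1

theorem lowOp_single (n : ℤ) (S : Finset (Fin p)) : lowOp r a n (Finsupp.single S 1) =
    ∑ k ∈ Sᶜ, (((a k ^ n : ℂˣ) : ℂ) * ∏ j ∈ S, fDown r a j k) •
      Finsupp.single (insert k S) 1 := by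
  simp [lowOp]

theorem raiseOp_single (m : ℤ) (S : Finset (Fin p)) : raiseOp r a m (Finsupp.single S 1) =
    ∑ k ∈ S, (((a k ^ m : ℂˣ) : ℂ) * ∏ j ∈ Sᶜ, fUp r a j k) •
      Finsupp.single (S.erase k) 1 := by
  simp [raiseOp]

theorem diagOp_single (f : Finset (Fin p) → ℂ) (S : Finset (Fin p)) :
    diagOp f (Finsupp.single S 1) = f S • Finsupp.single S 1 := by
  simp [diagOp]

theorem finsupp_end_ext {T T' : Module.End ℂ (Finset (Fin p) →₀ ℂ)}
    (h : ∀ S, T (Finsupp.single S 1) = T' (Finsupp.single S 1)) : T = T' :=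
  Finsupp.lhom_ext' fun S => LinearMap.ext_ring (h S)

/-- Adding `k` and removing `l ≠ k` can be done in either order and leads to the same set, with
equal coefficients. Only adding and removing the same element contributes to the commutator. -/
theorem raiseOp_lowOp {a : Fin p → ℂˣ} (ha : Function.Injective a) (m n : ℤ) :
    raiseOp r a m * lowOp r a n = lowOp r a n * raiseOp r a m + diagOp fun S =>
      ∑ k, (if k ∈ S then -1 else 1) * ((∏ j ∈ S.erase k, fDown r a j k) *
        ∏ j ∈ Sᶜ.erase k, fUp r a j k) * ((a k ^ (m + n) : ℂˣ) : ℂ) := by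
  refine finsupp_end_ext fun S => ?_
  have h1 : raiseOp r a m (lowOp r a n (Finsupp.single S 1)) =
      (∑ k ∈ Sᶜ, ((∏ j ∈ S.erase k, fDown r a j k) * (∏ j ∈ Sᶜ.erase k, fUp r a j k) *
        ((a k ^ (m + n) : ℂˣ) : ℂ)) • Finsupp.single S (1 : ℂ)) +
      ∑ k ∈ Sᶜ, ∑ l ∈ S, (((a k ^ n : ℂˣ) : ℂ) * ((a l ^ m : ℂˣ) : ℂ) *
        ((∏ j ∈ S, fDown r a j k) * ∏ j ∈ Sᶜ.erase k, fUp r a j l)) •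
          Finsupp.single ((insert k S).erase l) (1 : ℂ) := by
    rw [lowOp_single, map_sum, ← Finset.sum_add_distrib]
    refine Finset.sum_congr rfl fun k hk => ?_
    have hk' : k ∉ S := Finset.mem_compl.mp hk
    rw [map_smul, raiseOp_single, Finset.sum_insert hk', smul_add, Finset.erase_insert hk',
      Finset.compl_insert, smul_smul, Finset.smul_sum, Finset.erase_eq_of_notMem hk']
    congr 1
    · rw [zpow_add, Units.val_mul]
      congr 1
      ring
    · refine Finset.sum_congr rfl fun l _ => ?_
      rw [smul_smul]
      congr 1
      ring
  have h2 : lowOp r a n (raiseOp r a m (Finsupp.single S 1)) =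
      (∑ l ∈ S, ((∏ j ∈ S.erase l, fDown r a j l) * (∏ j ∈ Sᶜ.erase l, fUp r a j l) *
        ((a l ^ (m + n) : ℂˣ) : ℂ)) • Finsupp.single S (1 : ℂ)) +
      ∑ l ∈ S, ∑ k ∈ Sᶜ, (((a k ^ n : ℂˣ) : ℂ) * ((a l ^ m : ℂˣ) : ℂ) *
        ((∏ j ∈ S, fDown r a j k) * ∏ j ∈ Sᶜ.erase k, fUp r a j l)) •
          Finsupp.single ((insert k S).erase l) (1 : ℂ) := by
    rw [raiseOp_single, map_sum, ← Finset.sum_add_distrib]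
    refine Finset.sum_congr rfl fun l hl => ?_
    have hl' : l ∉ Sᶜ := fun h => Finset.mem_compl.mp h hl
    rw [map_smul, lowOp_single, Finset.compl_erase, Finset.sum_insert hl', smul_add,
      Finset.insert_erase hl, smul_smul, Finset.smul_sum, Finset.erase_eq_of_notMem hl']
    congr 1
    · rw [zpow_add, Units.val_mul]
      congr 1
      ring
    · refine Finset.sum_congr rfl fun k hk => ?_
      have hkl : l ≠ k := fun e => Finset.mem_compl.mp hk (e ▸ hl)
      -- The factor for the pair `(l, k)` occurs as `fDown` in one order and as `fUp` in the other.
      rw [smul_smul, Finset.erase_insert_of_ne hkl.symm, ← Finset.mul_prod_erase _ _ hl,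
        ← Finset.mul_prod_erase Sᶜ _ hk, fDown_eq_fUp r ha hkl]
      congr 1
      ring
  rw [LinearMap.add_apply, Module.End.mul_apply, Module.End.mul_apply, h1, h2, diagOp_single,
    Finset.sum_comm (s := S)]
  have h3 : ∑ k, (if k ∈ S then -1 else 1) * ((∏ j ∈ S.erase k, fDown r a j k) *
        ∏ j ∈ Sᶜ.erase k, fUp r a j k) * ((a k ^ (m + n) : ℂˣ) : ℂ) =
      ∑ k ∈ Sᶜ, (∏ j ∈ S.erase k, fDown r a j k) * (∏ j ∈ Sᶜ.erase k, fUp r a j k) *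
        ((a k ^ (m + n) : ℂˣ) : ℂ) -
      ∑ l ∈ S, (∏ j ∈ S.erase l, fDown r a j l) * (∏ j ∈ Sᶜ.erase l, fUp r a j l) *
        ((a l ^ (m + n) : ℂˣ) : ℂ) := by
    rw [← Finset.sum_add_sum_compl S, add_comm, sub_eq_add_neg, ← Finset.sum_neg_distrib]
    congr 1
    · exact Finset.sum_congr rfl fun k hk => by rw [if_neg (Finset.mem_compl.mp hk), one_mul]
    · exact Finset.sum_congr rfl fun k hk => by rw [if_pos hk]; ring
  rw [h3, ← Finset.sum_smul, ← Finset.sum_smul]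
  module

/-- The scalars by which the Cartan generators of the node `i` act on the vector labelled by `S`. -/
def setVal {M N : ℕ} (S : Finset (Fin p)) : Gen M N → ℂ
  | .X _ _ _ => 0
  | .K _ => kapSet r S
  | .Kinv _ => ((kapSet r S)⁻¹ : ℂˣ)
  | .h _ s => rootEta r (rootsNum r a S) a s

/-- The diagonal operators attached to the Cartan generators. -/
def setOp {M N : ℕ} (g : Gen M N) : Module.End ℂ (Finset (Fin p) →₀ ℂ) :=
  diagOp fun S => setVal r a S g

variable {q : ℂˣ} (hq : ∀ n : ℕ, 0 < n → q ^ n ≠ 1) {M N : ℕ} {i : Node M N}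

/-- Adding `k` to `S` moves one numerator root from `r⁻² a_k` to `r² a_k`, which changes the power
sum by a quantum integer. -/
theorem rootEta_insert {S : Finset (Fin p)} {k : Fin p} (hk : k ∉ S) (s : {s : ℤ // s ≠ 0}) :
    rootEta r (rootsNum r a (insert k S)) a s =
      rootEta r (rootsNum r a S) a s - qint r (2 * s.1) / s.1 * ((a k ^ s.1 : ℂˣ) : ℂ) := by
  have h : ∑ j, (((a j ^ s.1 : ℂˣ) : ℂ) - ((rootsNum r a (insert k S) j ^ s.1 : ℂˣ) : ℂ)) =
      ∑ j, (((a j ^ s.1 : ℂˣ) : ℂ) - ((rootsNum r a S j ^ s.1 : ℂˣ) : ℂ)) -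
        (((r ^ (2 * s.1) : ℂˣ) : ℂ) - ((r ^ (-(2 * s.1)) : ℂˣ) : ℂ)) * ((a k ^ s.1 : ℂˣ) : ℂ) := by
    rw [← Finset.add_sum_erase _ _ (Finset.mem_univ k),
      ← Finset.add_sum_erase Finset.univ (fun j => (((a j ^ s.1 : ℂˣ) : ℂ) -
        ((rootsNum r a S j ^ s.1 : ℂˣ) : ℂ))) (Finset.mem_univ k)]
    have h1 : ∑ j ∈ Finset.univ.erase k, (((a j ^ s.1 : ℂˣ) : ℂ) -
        ((rootsNum r a (insert k S) j ^ s.1 : ℂˣ) : ℂ)) =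
        ∑ j ∈ Finset.univ.erase k, (((a j ^ s.1 : ℂˣ) : ℂ) -
          ((rootsNum r a S j ^ s.1 : ℂˣ) : ℂ)) := by
      refine Finset.sum_congr rfl fun j hj => ?_
      simp [rootsNum, Finset.mem_insert, Finset.ne_of_mem_erase hj]
    have h2 : rootsNum r a (insert k S) k ^ s.1 = r ^ (2 * s.1) * a k ^ s.1 := by
      rw [rootsNum, if_pos (Finset.mem_insert_self k S), mul_zpow, ← zpow_natCast, ← zpow_mul]
      rfl
    have h3 : rootsNum r a S k ^ s.1 = r ^ (-(2 * s.1)) * a k ^ s.1 := by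
      rw [rootsNum, if_neg hk, mul_zpow, inv_zpow, ← zpow_natCast, ← zpow_mul, zpow_neg]
      rfl
    rw [h1, h2, h3, Units.val_mul, Units.val_mul]
    ring
  rw [rootEta, h, sub_div]
  unfold rootEta qint
  congr 1
  rw [div_div, mul_comm ((r : ℂ) - _)]
  ring

theorem setOp_h_lowOp (hr : r = qn q M i.1) (hi : i.1 ≠ M) (s : {s : ℤ // s ≠ 0}) (n : ℤ)
    (v : Finset (Fin p) →₀ ℂ) : setOp r a (.h i s) (lowOp r a n v) =
      lowOp r a n (setOp r a (.h i s) v) - gam q i i s • lowOp r a (n + s.1) v := by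
  have hg : gam q i i s = qint r (2 * s.1) / s.1 := by
    have : ell M i.1 * ell M i.1 = 1 := by rcases ell_sq M i.1 with h | h <;> rw [h] <;> norm_num
    rw [gam, cartan_self_of_ne hi, hr,
      show s.1 * ell M i.1 * (2 * ell M i.1) = 2 * s.1 by linear_combination 2 * s.1 * this]
  refine LinearMap.congr_fun (f := setOp r a (.h i s) * lowOp r a n)
    (g := lowOp r a n * setOp r a (.h i s) - gam q i i s • lowOp r a (n + s.1))
    (finsupp_end_ext fun S => ?_) v
  simp only [Module.End.mul_apply, LinearMap.sub_apply, LinearMap.smul_apply]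
  rw [setOp, diagOp_single, map_smul, lowOp_single, lowOp_single, map_sum, Finset.smul_sum,
    Finset.smul_sum, ← Finset.sum_sub_distrib]
  refine Finset.sum_congr rfl fun k hk => ?_
  rw [map_smul, diagOp_single, setVal, setVal, rootEta_insert r a (Finset.mem_compl.mp hk), hg,
    zpow_add, Units.val_mul]
  module

theorem kapSet_insert {S : Finset (Fin p)} {k : Fin p} (hk : k ∉ S) :
    kapSet r (insert k S) = (r ^ 2)⁻¹ * kapSet r S := by
  rw [kapSet, kapSet, ← Finset.mul_prod_erase _ _ (Finset.mem_univ k),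
    ← Finset.mul_prod_erase Finset.univ (fun k => if k ∈ S then r⁻¹ else r) (Finset.mem_univ k),
    if_pos (Finset.mem_insert_self k S), if_neg hk, ← mul_assoc]
  congr 1
  · group
  · refine Finset.prod_congr rfl fun j hj => ?_
    simp [Finset.mem_insert, Finset.ne_of_mem_erase hj]

theorem qpow_cartan_self (hi : i.1 ≠ M) : q ^ cartan M i.1 i.1 = qn q M i.1 ^ 2 := by
  rw [cartan_self_of_ne hi, qn, ← zpow_natCast, ← zpow_mul, mul_comm]
  rfl

theorem setOp_K_lowOp (hr : r = qn q M i.1) (hi : i.1 ≠ M) (n : ℤ) (v : Finset (Fin p) →₀ ℂ) :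
    setOp r a (.K i) (lowOp r a n v) =
      (((q ^ cartan M i.1 i.1)⁻¹ : ℂˣ) : ℂ) • lowOp r a n (setOp r a (.K i) v) := by
  refine LinearMap.congr_fun (f := setOp r a (.K i) * lowOp r a n)
    (g := (((q ^ cartan M i.1 i.1)⁻¹ : ℂˣ) : ℂ) • (lowOp r a n * setOp r a (.K i)))
    (finsupp_end_ext fun S => ?_) v
  simp only [Module.End.mul_apply, LinearMap.smul_apply]
  rw [setOp, diagOp_single, map_smul, lowOp_single, map_sum, Finset.smul_sum, Finset.smul_sum]
  refine Finset.sum_congr rfl fun k hk => ?_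
  rw [map_smul, diagOp_single, setVal, setVal, kapSet_insert r (Finset.mem_compl.mp hk),
    qpow_cartan_self hi, hr, Units.val_mul]
  module

theorem setOp_Kinv_lowOp (hr : r = qn q M i.1) (hi : i.1 ≠ M) (n : ℤ) (v : Finset (Fin p) →₀ ℂ) :
    setOp r a (.Kinv i) (lowOp r a n v) =
      ((q ^ cartan M i.1 i.1 : ℂˣ) : ℂ) • lowOp r a n (setOp r a (.Kinv i) v) := by
  refine LinearMap.congr_fun (f := setOp r a (.Kinv i) * lowOp r a n)
    (g := ((q ^ cartan M i.1 i.1 : ℂˣ) : ℂ) • (lowOp r a n * setOp r a (.Kinv i)))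
    (finsupp_end_ext fun S => ?_) v
  simp only [Module.End.mul_apply, LinearMap.smul_apply]
  rw [setOp, diagOp_single, map_smul, lowOp_single, map_sum, Finset.smul_sum, Finset.smul_sum]
  refine Finset.sum_congr rfl fun k hk => ?_
  rw [map_smul, diagOp_single, setVal, setVal, kapSet_insert r (Finset.mem_compl.mp hk),
    qpow_cartan_self hi, hr, mul_inv, inv_inv, Units.val_mul]
  module

-- The diagonal terms of the commutator are the delta function coefficients computed by partial
-- fractions in `phi_sub_phi`.
include hq in
theorem raiseOp_lowOp_phi {a : Fin p → ℂˣ} (ha : Function.Injective a) (hr : r = qn q M i.1)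
    (m n : ℤ) : raiseOp r a m * lowOp r a n = lowOp r a n * raiseOp r a m +
      ((r : ℂ) - (r⁻¹ : ℂˣ))⁻¹ • (phi q (setOp r a) 1 i (m + n) -
        phi q (setOp r a) (-1) i (m + n)) := by
  rw [raiseOp_lowOp r ha]
  congr 1
  refine finsupp_end_ext fun S => ?_
  have hphi : ∀ ε, phi q (setOp r a) ε i (m + n) (Finsupp.single S 1) =
      phi q (setVal r a S : Gen M N → ℂ) ε i (m + n) • Finsupp.single S (1 : ℂ) := fun ε =>
    phi_eigen q (x := setOp r a) (y := setVal r a S) (i := i) (diagOp_single _ S)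
      (diagOp_single _ S) (fun s => diagOp_single _ S) ε (m + n)
  have h0 : (r : ℂ) - (r⁻¹ : ℂˣ) ≠ 0 := hr ▸ qn_sub_inv_ne_zero hq M i.1
  rw [LinearMap.smul_apply, LinearMap.sub_apply, hphi, hphi, ← sub_smul, smul_smul, diagOp_single,
    phi_sub_phi hq (κ := kapSet r S) (α := rootsNum r a S) (β := a) (y := setVal r a S) rfl rfl
      (fun s => by rw [← hr]; rfl) ha (kapSet_sq r a S), Finset.mul_sum]
  congr 1
  refine Finset.sum_congr rfl fun k _ => ?_
  rw [kapSet_mul_resid r ha]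
  split_ifs
  · field_simp
  · field_simp

end RankOne
end QAffSuper
end

noncomputable section

namespace QAffSuper

/-! ### Comparison of words with the rank one module. -/

section Intertwiner

variable {p : ℕ} (r : ℂˣ) (a : Fin p → ℂˣ) {q : ℂˣ} (hq : ∀ n : ℕ, 0 < n → q ^ n ≠ 1) {M N : ℕ}
  (i : Node M N)

/-- The vector of the rank one module corresponding to a word; words with a letter not belonging to
the node `i` are sent to zero. -/
def toSetList : List (Node M N × ℤ) → Finset (Fin p) →₀ ℂ
  | [] => Finsupp.single ∅ 1
  | l :: w => if l.1 = i then lowOp r a l.2 (toSetList w) else 0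

/-- The linear map from the space of words to the rank one module. -/
def toSet : Words M N →ₗ[ℂ] Finset (Fin p) →₀ ℂ := Finsupp.linearCombination ℂ (toSetList r a i)

theorem toSet_vac : toSet r a i (vac M N) = Finsupp.single ∅ 1 := by
  simp [toSet, vac, toSetList]

theorem toSet_down (l : Node M N × ℤ) (w : Words M N) : toSet r a i (down l w) =
    if l.1 = i then lowOp r a l.2 (toSet r a i w) else 0 := by
  by_cases h : l.1 = i
  · simp only [h, if_true]
    refine linearMap_eq_of_single (T := toSet r a i ∘ₗ down l)
      (T' := lowOp r a l.2 ∘ₗ toSet r a i) (fun w => ?_) w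
    simp [down_single, toSet, toSetList, h]
  · simp only [h, if_false]
    refine linearMap_eq_of_single (T := toSet r a i ∘ₗ down l) (T' := 0) (fun w => ?_) w
    simp [down_single, toSet, toSetList, h]

theorem lowOp_apply_empty (n : ℤ) (v : Finset (Fin p) →₀ ℂ) : lowOp r a n v ∅ = 0 := by
  refine LinearMap.congr_fun (f := Finsupp.lapply ∅ ∘ₗ lowOp r a n) (g := 0)
    (Finsupp.lhom_ext' fun S => LinearMap.ext_ring ?_) v
  simp only [LinearMap.comp_apply, Finsupp.lsingle_apply, lowOp_single, LinearMap.zero_apply,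
    map_sum, map_smul]
  refine Finset.sum_eq_zero fun k _ => ?_
  rw [Finsupp.lapply_apply, Finsupp.single_apply, if_neg (Finset.insert_ne_empty k S), smul_zero]

/-- A lowering operator never produces the empty set, just as adding a letter never produces the
empty word. The coefficient of the empty word is thus visible in the rank one module. -/
theorem toSet_apply_empty (w : Words M N) : toSet r a i w ∅ = w [] := by
  refine words_ext (T := Finsupp.lapply ∅ ∘ₗ toSet r a i) (T' := Finsupp.lapply [])
    ?_ (fun l w _ => ?_) w
  · simp only [LinearMap.comp_apply, toSet_vac]
    simp [vac]
  · have h : down l w [] = 0 := by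
      refine linearMap_eq_of_single (T := Finsupp.lapply [] ∘ₗ down l) (T' := 0) (fun w => ?_) w
      simp [down_single]
    simp only [LinearMap.comp_apply, Finsupp.lapply_apply, toSet_down, h]
    split_ifs
    · exact lowOp_apply_empty r a _ _
    · rfl

/-- Each application enlarges the sets by one element, and `Fin p` has no subset with `p + 1`
elements. -/
theorem lowOp_pow_eq_zero (n : ℤ) : (lowOp r a n ^ (p + 1)) (Finsupp.single ∅ 1) = 0 := by
  have key : ∀ k, (lowOp r a n ^ k) (Finsupp.single ∅ 1) ∈
      Submodule.span ℂ {v | ∃ S : Finset (Fin p), S.card = k ∧ v = Finsupp.single S (1 : ℂ)} := by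
    intro k
    induction k with
    | zero => exact Submodule.subset_span ⟨∅, rfl, rfl⟩
    | succ k ih =>
      rw [pow_succ', Module.End.mul_apply]
      generalize (lowOp r a n ^ k) (Finsupp.single ∅ 1) = v at ih
      induction ih using Submodule.span_induction with
      | mem v hv =>
        obtain ⟨S, hS, rfl⟩ := hv
        rw [lowOp_single]
        refine Submodule.sum_mem _ fun l hl => Submodule.smul_mem _ _ (Submodule.subset_span
          ⟨_, ?_, rfl⟩)
        rw [Finset.card_insert_of_notMem (Finset.mem_compl.mp hl), hS]
      | zero => simp
      | add u v _ _ hu hv => rw [map_add]; exact add_mem hu hv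
      | smul c v _ hv => rw [map_smul]; exact Submodule.smul_mem _ _ hv
  have h := key (p + 1)
  have e : {v | ∃ S : Finset (Fin p), S.card = p + 1 ∧ v = Finsupp.single S (1 : ℂ)} = ∅ := by
    refine Set.eq_empty_of_forall_notMem fun v ⟨S, hS, _⟩ => ?_
    have := Finset.card_le_univ S
    rw [Fintype.card_fin] at this
    omega
  rw [e] at h
  simpa using h

variable {i} (D : HData M N) (hi : i.1 ≠ M) (hr : r = qn q M i.1) (hκ : D.κ i = r ^ p)
  (hη : ∀ s, D.η i s = rootEta r (fun k => (r ^ 2)⁻¹ * a k) a s)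

include hi hr hη in
theorem toSet_hOp (s : {s : ℤ // s ≠ 0}) (w : Words M N) :
    toSet r a i (hOp q D i s w) = setOp r a (.h i s) (toSet r a i w) := by
  refine words_ext (T := toSet r a i ∘ₗ hOp q D i s) (T' := setOp r a (.h i s) ∘ₗ toSet r a i)
    ?_ (fun l w h => ?_) w
  · simp only [LinearMap.comp_apply]
    rw [hOp_vac, map_smul, toSet_vac, setOp, diagOp_single, hη]
    congr 1
  · simp only [LinearMap.comp_apply] at h ⊢
    rw [hOp_down, map_sub, map_smul, toSet_down, toSet_down, toSet_down, h]
    by_cases hl : l.1 = i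
    · simp only [hl, if_true]
      rw [setOp_h_lowOp r a hr hi]
    · simp [hl]

theorem kapSet_empty : kapSet r (∅ : Finset (Fin p)) = r ^ p := by
  simp [kapSet]

include hi hr hκ in
theorem toSet_kOp_one (w : Words M N) :
    toSet r a i (kOp q D i 1 w) = setOp r a (.K i) (toSet r a i w) := by
  refine words_ext (T := toSet r a i ∘ₗ kOp q D i 1) (T' := setOp r a (.K i) ∘ₗ toSet r a i)
    ?_ (fun l w h => ?_) w
  · simp only [LinearMap.comp_apply]
    rw [kOp_vac, map_smul, toSet_vac, setOp, diagOp_single, hκ, setVal, kapSet_empty]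
    simp
  · simp only [LinearMap.comp_apply] at h ⊢
    rw [kOp_down, map_smul, toSet_down, toSet_down, h]
    by_cases hl : l.1 = i
    · simp only [hl, if_true]
      rw [setOp_K_lowOp r a hr hi]
      simp
    · simp [hl]

include hi hr hκ in
theorem toSet_kOp_neg_one (w : Words M N) :
    toSet r a i (kOp q D i (-1) w) = setOp r a (.Kinv i) (toSet r a i w) := by
  obtain ⟨e, he⟩ : ∃ e : ℤˣ, e = -1 := ⟨_, rfl⟩
  rw [← he]
  refine words_ext (T := toSet r a i ∘ₗ kOp q D i e)
    (T' := setOp r a (.Kinv i) ∘ₗ toSet r a i) ?_ (fun l w h => ?_) w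
  · simp only [LinearMap.comp_apply]
    rw [kOp_vac, map_smul, toSet_vac, setOp, diagOp_single, hκ, setVal, kapSet_empty]
    simp [he]
  · simp only [LinearMap.comp_apply] at h ⊢
    rw [kOp_down, map_smul, toSet_down, toSet_down, h]
    by_cases hl : l.1 = i
    · simp only [hl, if_true]
      rw [setOp_Kinv_lowOp r a hr hi]
      simp [he]
    · simp [hl]

-- Both sides obey the same recursion when a letter is added, because the commutators on words and
-- on sets are given by the same `φ^±`, which `toSet` intertwines.
include hq hi hr hκ hη in
theorem toSet_up (ha : Function.Injective a) (m : ℤ) (w : Words M N) :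
    toSet r a i (up q D (i, m) w) = raiseOp r a m (toSet r a i w) := by
  refine words_ext (T := toSet r a i ∘ₗ up q D (i, m)) (T' := raiseOp r a m ∘ₗ toSet r a i)
    ?_ (fun l w h => ?_) w
  · simp only [LinearMap.comp_apply]
    rw [up_vac, map_zero, toSet_vac, raiseOp_single, Finset.sum_empty]
  · simp only [LinearMap.comp_apply] at h ⊢
    rw [up_down, map_add, map_smul, toSet_down, toSet_down, h]
    by_cases hl : l.1 = i
    · have h2 := LinearMap.congr_fun (raiseOp_lowOp_phi r hq ha hr m l.2) (toSet r a i w)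
      have h3 : ∀ ε, toSet r a i (phi q (borelOp q D) ε i (m + l.2) w) =
          phi q (setOp r a) ε i (m + l.2) (toSet r a i w) := fun ε =>
        phi_intertwine q (x := borelOp q D) (y := setOp r a) (i := i) (toSet r a i)
          (toSet_kOp_one r a D hi hr hκ) (toSet_kOp_neg_one r a D hi hr hκ)
          (toSet_hOp r a D hi hr hη) ε _ w
      simp only [hl, if_true, sg_of_ne_left hi, one_smul]
      simp only [Module.End.mul_apply, LinearMap.add_apply] at h2
      rw [h2, psiOp, LinearMap.smul_apply, LinearMap.sub_apply, map_smul, map_sub, h3, h3, hr]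
      rfl
    · simp [hl, Ne.symm hl]

include hq hi hr hκ hη in
theorem upProd_pow_down_apply_nil (ha : Function.Injective a) (x : List ℤ) :
    upProd q D (x.map fun m => (i, m)) ((down (i, 0) ^ (p + 1)) (vac M N)) [] = 0 := by
  have h1 : ∀ k, toSet r a i ((down (i, 0) ^ k) (vac M N)) =
      (lowOp r a 0 ^ k) (Finsupp.single ∅ 1) := by
    intro k
    induction k with
    | zero => exact toSet_vac r a i
    | succ k ih =>
      rw [pow_succ', pow_succ', Module.End.mul_apply, Module.End.mul_apply, toSet_down, if_pos rfl,
        ih]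
  have h2 : ∀ w, toSet r a i w = 0 →
      toSet r a i (upProd q D (x.map fun m => (i, m)) w) = 0 := by
    induction x with
    | nil => exact fun w h => h
    | cons m x ih =>
      intro w h
      change toSet r a i (upProd q D (x.map fun m => (i, m)) (up q D (i, m) w)) = 0
      exact ih _ (by rw [toSet_up r a hq D hi hr hκ hη ha, h, map_zero])
  rw [← toSet_apply_empty r a i, h2 _ (by rw [h1, lowOp_pow_eq_zero]), Finsupp.zero_apply]

end Intertwiner

/-! ### Continuity of the operators on words in the eigenvalue data. -/

section Deformation

variable (q : ℂˣ) {M N : ℕ} (D : ℝ → HData M N) (i : Node M N)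

/-- The families of words depending continuously on a parameter. -/
def contWords (M N : ℕ) : Submodule ℂ (ℝ → Words M N) :=
  Submodule.span ℂ {f | ∃ (c : ℝ → ℂ) (w : Words M N), Continuous c ∧ f = fun t => c t • w}

theorem smul_mem_contWords {c : ℝ → ℂ} (hc : Continuous c) {f : ℝ → Words M N}
    (hf : f ∈ contWords M N) : (fun t => c t • f t) ∈ contWords M N := by
  induction hf using Submodule.span_induction with
  | mem f hf =>
    obtain ⟨c', w, hc', rfl⟩ := hf
    exact Submodule.subset_span ⟨fun t => c t * c' t, w, hc.mul hc', by simp [smul_smul]⟩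
  | zero =>
    simp only [Pi.zero_apply, smul_zero]
    exact Submodule.zero_mem (contWords M N)
  | add f g _ _ hf hg =>
    simp only [Pi.add_apply, smul_add]
    exact add_mem hf hg
  | smul b f _ hf =>
    have := Submodule.smul_mem _ b hf
    simpa [Pi.smul_def, smul_comm b] using this

theorem const_mem_contWords (w : Words M N) : (fun _ => w) ∈ contWords M N :=
  Submodule.subset_span ⟨fun _ => 1, w, continuous_const, by simp⟩

/-- The families of operators preserving `contWords`. -/
def contOps (M N : ℕ) : Subalgebra ℂ (ℝ → Module.End ℂ (Words M N)) where
  carrier := {T | ∀ f ∈ contWords M N, (fun t => T t (f t)) ∈ contWords M N}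
  mul_mem' := fun ha hb f hf => ha _ (hb f hf)
  add_mem' := fun ha hb f hf => add_mem (ha f hf) (hb f hf)
  algebraMap_mem' := fun c f hf => by
    have := Submodule.smul_mem _ c hf
    simpa [Algebra.algebraMap_eq_smul_one, Pi.smul_def] using this

theorem mem_contOps {T : ℝ → Module.End ℂ (Words M N)}
    (h : ∀ w, (fun t => T t (Finsupp.single w 1)) ∈ contWords M N) : T ∈ contOps M N := by
  intro f hf
  induction hf using Submodule.span_induction with
  | mem f hf =>
    obtain ⟨c, w, hc, rfl⟩ := hf
    simp only [map_smul]
    refine smul_mem_contWords hc ?_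
    induction w using Finsupp.induction_linear with
    | zero =>
      simp only [map_zero]
      exact Submodule.zero_mem (contWords M N)
    | add f g hf hg =>
      simp only [map_add]
      exact add_mem hf hg
    | single w b =>
      have := Submodule.smul_mem _ b (h w)
      have e : ∀ t, T t (Finsupp.single w b) = b • T t (Finsupp.single w 1) := fun t => by
        rw [← map_smul, Finsupp.smul_single, smul_eq_mul, mul_one]
      simp only [e]
      exact this
  | zero =>
    simp only [Pi.zero_apply, map_zero]
    exact Submodule.zero_mem (contWords M N)
  | add f g _ _ hf hg =>
    simp only [Pi.add_apply, map_add]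
    exact add_mem hf hg
  | smul b f _ hf =>
    simp only [Pi.smul_apply, map_smul]
    exact Submodule.smul_mem _ b hf

theorem down_mem_contOps (l : Node M N × ℤ) : (fun _ => down l) ∈ contOps M N :=
  mem_contOps fun w => const_mem_contWords (down l (Finsupp.single w 1))

variable {D i} (hκ : ∀ t, (D t).κ i = (D 0).κ i)
  (hη : ∀ s, Continuous fun t => (D t).η i s)

include hη in
theorem hOp_mem_contOps (s : {s : ℤ // s ≠ 0}) : (fun t => hOp q (D t) i s) ∈ contOps M N := by
  refine mem_contOps fun w => ?_
  induction w with
  | nil =>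
    have := smul_mem_contWords (hη s) (const_mem_contWords (vac M N))
    simp only [← hOp_vac q] at this
    exact this
  | cons l w ih =>
    simp only [← down_single, hOp_down]
    exact sub_mem (down_mem_contOps l _ ih) (const_mem_contWords _)

include hκ in
theorem kOp_mem_contOps (e : ℤˣ) : (fun t => kOp q (D t) i e) ∈ contOps M N := by
  refine mem_contOps fun w => ?_
  induction w with
  | nil =>
    have := const_mem_contWords (M := M) (N := N) ((((D 0).κ i ^ (e : ℤ) : ℂˣ) : ℂ) • vac M N)
    have h : ∀ t, kOp q (D t) i e (Finsupp.single [] 1) =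
        (((D 0).κ i ^ (e : ℤ) : ℂˣ) : ℂ) • vac M N := fun t => by
      rw [← hκ t, ← kOp_vac]
      rfl
    simpa only [h] using this
  | cons l w ih =>
    simp only [← down_single, kOp_down]
    exact Submodule.smul_mem _ _ (down_mem_contOps l _ ih)

include hκ hη in
theorem phi_mem_contOps (ε : ℤˣ) (n : ℤ) :
    (fun t => phi q (borelOp q (D t)) ε i n) ∈ contOps M N := by
  have h := phi_mem q (x := fun g t => borelOp q (D t) g) (i := i) (contOps M N)
    (kOp_mem_contOps q hκ 1) (kOp_mem_contOps q hκ (-1)) (hOp_mem_contOps q hη) ε n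
  -- `phi` is first formed in the algebra of families of operators, so that `phi_mem` applies;
  -- evaluation at `t` is an algebra homomorphism and commutes with it.
  have e : phi q (fun g t => borelOp q (D t) g) ε i n =
      fun t => phi q (borelOp q (D t)) ε i n := by
    funext t
    let E : (ℝ → Module.End ℂ (Words M N)) →ₐ[ℂ] Module.End ℂ (Words M N) :=
      Pi.evalAlgHom ℂ (fun _ => Module.End ℂ (Words M N)) t
    exact map_phi (B := Module.End ℂ (Words M N)) q E (fun g t => borelOp q (D t) g) ε i n
  rwa [e] at h

include hκ hη in
theorem psiOp_mem_contOps (n : ℤ) : (fun t => psiOp q (D t) i n) ∈ contOps M N :=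
  fun f hf => Submodule.smul_mem _ _ (sub_mem (phi_mem_contOps q hκ hη 1 n f hf)
    (phi_mem_contOps q hκ hη (-1) n f hf))

include hκ hη in
theorem up_mem_contOps (m : ℤ) : (fun t => up q (D t) (i, m)) ∈ contOps M N := by
  refine mem_contOps fun w => ?_
  induction w with
  | nil =>
    have : ∀ t, up q (D t) (i, m) (Finsupp.single [] 1) = 0 := fun t => up_vac q (D t) (i, m)
    simp only [this]
    exact Submodule.zero_mem _
  | cons l w ih =>
    simp only [← down_single, up_down]
    refine add_mem (Submodule.smul_mem _ _ (down_mem_contOps l _ ih)) ?_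
    split_ifs
    · exact psiOp_mem_contOps q hκ hη _ _ (const_mem_contWords _)
    · exact Submodule.zero_mem _

include hκ hη in
theorem upProd_mem_contOps (x : List ℤ) :
    (fun t => upProd q (D t) (x.map fun m => (i, m))) ∈ contOps M N := by
  induction x with
  | nil => exact one_mem (contOps M N)
  | cons m x ih => exact mul_mem ih (up_mem_contOps q hκ hη m)

theorem continuous_apply_nil {f : ℝ → Words M N} (hf : f ∈ contWords M N) :
    Continuous fun t => f t [] := by
  induction hf using Submodule.span_induction with
  | mem f hf =>
    obtain ⟨c, w, hc, rfl⟩ := hf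
    exact hc.mul continuous_const
  | zero => exact continuous_const
  | add f g _ _ hf hg => exact hf.add hg
  | smul b f _ hf => exact continuous_const.mul hf

end Deformation

/-! ### Removing the assumption of distinct spectral parameters. -/

section LowerEven

variable {p : ℕ} {q : ℂˣ} (hq : ∀ n : ℕ, 0 < n → q ^ n ≠ 1) {M N : ℕ} {i : Node M N}
  (a : Fin p → ℂˣ) (D : HData M N)

/-- The nonzero complex number `e^x`. -/
def expUnit (x : ℝ) : ℂˣ := Units.mk0 ((Real.exp x : ℝ) : ℂ) (by exact_mod_cast (Real.exp_pos x).ne')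

/-- A deformation of a family of nonzero numbers into a family of distinct ones. -/
def deform (t : ℝ) (k : Fin p) : ℂˣ := a k * expUnit (k * t)

theorem deform_zpow (t : ℝ) (k : Fin p) (s : ℤ) : ((deform a t k ^ s : ℂˣ) : ℂ) =
    ((a k ^ s : ℂˣ) : ℂ) * ((Real.exp (k * t * s) : ℝ) : ℂ) := by
  rw [deform, mul_zpow, Units.val_mul, Units.val_zpow_eq_zpow_val (expUnit _), expUnit,
    Units.val_mk0, ← Complex.ofReal_zpow, ← Real.rpow_intCast, ← Real.exp_mul]

theorem deform_zero : deform a 0 = a := by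
  ext k
  simp [deform, expUnit]

/-- Parameters equal at `t = 0` are separated by the distinct exponents `k t` for every `t ≠ 0`;
those distinct at `t = 0` stay so nearby. -/
theorem eventually_injective_deform : ∀ᶠ t in nhdsWithin (0 : ℝ) {0}ᶜ,
    Function.Injective (deform a t) := by
  have key : ∀ k l : Fin p, ∀ᶠ t in nhdsWithin (0 : ℝ) {0}ᶜ, k ≠ l → deform a t k ≠ deform a t l := by
    intro k l
    by_cases h : a k = a l
    · filter_upwards [self_mem_nhdsWithin] with t ht hkl e
      rw [deform, deform, h, mul_right_inj] at e
      have e' := congrArg (Units.val) e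
      simp only [expUnit, Units.val_mk0] at e'
      have e2 := mul_right_cancel₀ ht (Real.exp_injective (Complex.ofReal_injective e'))
      exact hkl (Fin.ext (by exact_mod_cast e2))
    · have hc : ∀ k, Continuous fun t => (deform a t k : ℂ) := fun k => by
        simp only [deform, expUnit, Units.val_mul, Units.val_mk0]
        fun_prop
      have h0 : (deform a 0 k : ℂ) ≠ deform a 0 l := by
        rw [deform_zero]
        exact fun e => h (Units.ext e)
      have := ((hc k).sub (hc l)).continuousAt.eventually_ne (sub_ne_zero.mpr h0)
      filter_upwards [nhdsWithin_le_nhds this] with t ht _ e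
      exact ht (sub_eq_zero.mpr (congrArg Units.val e))
  have := Filter.eventually_all.mpr fun k => Filter.eventually_all.mpr (key k)
  filter_upwards [this] with t ht k l e
  by_contra hkl
  exact ht k l hkl e

variable (hi : i.1 ≠ M) (hκ : D.κ i = qn q M i.1 ^ p)
  (hη : ∀ s, D.η i s = rootEta (qn q M i.1) (fun k => (qn q M i.1 ^ 2)⁻¹ * a k) a s)
include hq hi hκ hη

/-- The coefficient is continuous in the deformation parameter and vanishes for all small `t ≠ 0`,
hence also at `t = 0`. Only the `h`-eigenvalues at node `i` are deformed, since `κ` depends on `p`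
alone. -/
theorem upProd_pow_down_apply_nil_eq_zero (x : List ℤ) :
    upProd q D (x.map fun m => (i, m)) ((down (i, 0) ^ (p + 1)) (vac M N)) [] = 0 := by
  classical
  let D' : ℝ → HData M N := fun t =>
    { κ := D.κ
      η := fun j s => if j = i then
        rootEta (qn q M i.1) (fun k => (qn q M i.1 ^ 2)⁻¹ * deform a t k) (deform a t) s
        else D.η j s }
  have hD : D' 0 = D := by
    have : (D' 0).η = D.η := by
      funext j s
      by_cases h : j = i
      · subst h
        simp only [D', if_true, deform_zero, hη]
      · simp only [D', h, if_false]
    cases D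
    simp only [D', HData.mk.injEq, true_and]
    exact this
  have hcont : Continuous fun t =>
      upProd q (D' t) (x.map fun m => (i, m)) ((down (i, 0) ^ (p + 1)) (vac M N)) [] := by
    refine continuous_apply_nil (upProd_mem_contOps q (D := D') (fun t => rfl) (fun s => ?_) x _
      (const_mem_contWords _))
    simp only [D', if_true, rootEta, mul_zpow, Units.val_mul, deform_zpow]
    fun_prop
  have hev : ∀ᶠ t in nhdsWithin (0 : ℝ) {0}ᶜ,
      upProd q (D' t) (x.map fun m => (i, m)) ((down (i, 0) ^ (p + 1)) (vac M N)) [] = 0 := by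
    filter_upwards [eventually_injective_deform a] with t ht
    refine upProd_pow_down_apply_nil (qn q M i.1) (deform a t) hq (D' t) hi rfl hκ (fun s => ?_)
      ht x
    simp [D']
  have := tendsto_nhds_unique ((hcont.tendsto 0).mono_left nhdsWithin_le_nhds)
    (tendsto_const_nhds.congr' (hev.mono fun t ht => ht.symm))
  rwa [hD] at this

end LowerEven

/-! ### Words supported on one even node. -/

section SingleNode

variable (q : ℂˣ) {M N : ℕ} (D : HData M N) (i : Node M N)

/-- The span of the words with letters belonging to the node `i`. -/
def nodeWords : Submodule ℂ (Words M N) :=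
  Submodule.span ℂ (Set.range fun x : List ℤ => Finsupp.single (x.map fun n => (i, n)) 1)

variable {i}

theorem mem_nodeWords_of_single {T : Module.End ℂ (Words M N)}
    (h : ∀ x : List ℤ, T (Finsupp.single (x.map fun n => (i, n)) 1) ∈ nodeWords i)
    {w : Words M N} (hw : w ∈ nodeWords i) : T w ∈ nodeWords i := by
  have : nodeWords i ≤ (nodeWords i).comap T := by
    refine Submodule.span_le.mpr ?_
    rintro _ ⟨x, rfl⟩
    exact h x
  exact this hw

theorem down_mem_nodeWords (n : ℤ) {w : Words M N} (hw : w ∈ nodeWords i) :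
    down (i, n) w ∈ nodeWords i :=
  mem_nodeWords_of_single (fun x => by
    rw [down_single]
    exact Submodule.subset_span ⟨n :: x, rfl⟩) hw

theorem hOp_mem_nodeWords (j : Node M N) (s : {s : ℤ // s ≠ 0}) {w : Words M N}
    (hw : w ∈ nodeWords i) : hOp q D j s w ∈ nodeWords i := by
  refine mem_nodeWords_of_single (fun x => ?_) hw
  induction x with
  | nil =>
    change hOp q D j s (vac M N) ∈ _
    rw [hOp_vac]
    exact Submodule.smul_mem _ _ (Submodule.subset_span ⟨[], rfl⟩)
  | cons n x ih =>
    rw [List.map_cons, ← down_single, hOp_down]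
    exact sub_mem (down_mem_nodeWords n ih) (Submodule.smul_mem _ _
      (down_mem_nodeWords _ (Submodule.subset_span ⟨x, rfl⟩)))

theorem kOp_mem_nodeWords (j : Node M N) (e : ℤˣ) {w : Words M N}
    (hw : w ∈ nodeWords i) : kOp q D j e w ∈ nodeWords i :=
  mem_nodeWords_of_single (fun x => by
    rw [kOp_single]
    exact Submodule.smul_mem _ _ (Submodule.subset_span ⟨x, rfl⟩)) hw

theorem psiOp_mem_nodeWords (j : Node M N) (n : ℤ) {w : Words M N}
    (hw : w ∈ nodeWords i) : psiOp q D j n w ∈ nodeWords i := by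
  let S : Subalgebra ℂ (Module.End ℂ (Words M N)) :=
    { carrier := {T | ∀ w ∈ nodeWords i, T w ∈ nodeWords i}
      mul_mem' := fun ha hb w hw => ha _ (hb w hw)
      add_mem' := fun ha hb w hw => add_mem (ha w hw) (hb w hw)
      algebraMap_mem' := fun c w hw => by
        simpa [Algebra.algebraMap_eq_smul_one] using Submodule.smul_mem _ c hw }
  have hK : borelOp q D (.K j) ∈ S := fun w hw => kOp_mem_nodeWords q D j 1 hw
  have hKinv : borelOp q D (.Kinv j) ∈ S := fun w hw => kOp_mem_nodeWords q D j (-1) hw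
  have hh : ∀ s, borelOp q D (.h j s) ∈ S := fun s w hw => hOp_mem_nodeWords q D j s hw
  have h := phi_mem (x := borelOp q D) q S hK hKinv hh
  exact Submodule.smul_mem _ _ (sub_mem (h 1 n w hw) (h (-1) n w hw))

theorem up_mem_nodeWords (m : ℤ) {w : Words M N} (hw : w ∈ nodeWords i) :
    up q D (i, m) w ∈ nodeWords i := by
  refine mem_nodeWords_of_single (fun x => ?_) hw
  induction x with
  | nil =>
    change up q D (i, m) (vac M N) ∈ _
    rw [up_vac]
    exact Submodule.zero_mem _
  | cons n x ih =>
    rw [List.map_cons, ← down_single, up_down, if_pos rfl]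
    exact add_mem (Submodule.smul_mem _ _ (down_mem_nodeWords n ih))
      (psiOp_mem_nodeWords q D i _ (Submodule.subset_span ⟨x, rfl⟩))

theorem up_nodeWords_eq_zero {k : Node M N × ℤ} (hk : k.1 ≠ i) {w : Words M N}
    (hw : w ∈ nodeWords i) : up q D k w = 0 := by
  have : nodeWords i ≤ LinearMap.ker (up q D k) := by
    refine Submodule.span_le.mpr ?_
    rintro _ ⟨x, rfl⟩
    change up q D k (Finsupp.single (x.map fun n => (i, n)) 1) = 0
    induction x with
    | nil => exact up_vac q D k
    | cons n x ih => rw [List.map_cons, ← down_single, up_down, if_neg hk, ih]; simp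
  exact this hw

variable {R : Type} [CommRing R] [Algebra ℂ R] {o : Node M N} (ζ : Rˣ)

theorem top_nodeWords (ho : i ≠ o) {w : Words M N} (hw : w ∈ nodeWords i) :
    top o ζ w = (w [], 0) := by
  have : nodeWords i ≤ LinearMap.ker (top o ζ -
      LinearMap.inl ℂ ℂ R ∘ₗ (Finsupp.lapply [] : Words M N →ₗ[ℂ] ℂ)) := by
    refine Submodule.span_le.mpr ?_
    rintro _ ⟨x, rfl⟩
    rw [SetLike.mem_coe, LinearMap.mem_ker, LinearMap.sub_apply, sub_eq_zero]
    rcases x with _ | ⟨n, _ | ⟨n', x⟩⟩ <;> simp [top, topList, ho, Prod.zero_eq_mk]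
  have h := this hw
  rw [LinearMap.mem_ker, LinearMap.sub_apply, sub_eq_zero] at h
  simpa using h

/-- Words in the letters of node `i` are preserved by the raising operators of `i` and killed by
those of other nodes. As `i ≠ o`, `top` sees only their empty-word coefficient, so membership
reduces to the one-node computation. -/
theorem pow_down_mem_maxSub {p : ℕ} {q : ℂˣ} (hq : ∀ n : ℕ, 0 < n → q ^ n ≠ 1)
    (a : Fin p → ℂˣ) (hi : i.1 ≠ M) (ho : i ≠ o) (hκ : D.κ i = qn q M i.1 ^ p)
    (hη : ∀ s, D.η i s = rootEta (qn q M i.1) (fun k => (qn q M i.1 ^ 2)⁻¹ * a k) a s) :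
    (down (i, 0) ^ (p + 1)) (vac M N) ∈ maxSub q D o ζ := by
  rw [mem_maxSub]
  have hmem : ∀ k, (down (i, 0) ^ k) (vac M N) ∈ nodeWords i := by
    intro k
    induction k with
    | zero => exact Submodule.subset_span ⟨[], rfl⟩
    | succ k ih => rw [pow_succ', Module.End.mul_apply]; exact down_mem_nodeWords 0 ih
  have key := upProd_pow_down_apply_nil_eq_zero hq a D hi hκ hη
  have hm := hmem (p + 1)
  generalize (down (i, 0) ^ (p + 1)) (vac M N) = w at key hm
  intro x
  induction x generalizing w with
  | nil =>
    change top o ζ w = 0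
    have h : w [] = 0 := key []
    rw [top_nodeWords ζ ho hm, h]
    rfl
  | cons k x ih =>
    change top o ζ (upProd q D x (up q D k w)) = 0
    obtain ⟨j, m⟩ := k
    by_cases hj : j = i
    · subst hj
      exact ih _ (fun y => key (m :: y)) (up_mem_nodeWords q D m hm)
    · rw [up_nodeWords_eq_zero q D hj hm, map_zero, map_zero]

end SingleNode
end QAffSuper
end

noncomputable section

namespace QAffSuper

/-! ### Eigenvalues of the `h_{i,s}` realising a given highest weight. -/

section HighestWeightData

/-- The `b_k` are the inverses of the roots, which are nonzero because `P(0) = 1`; the same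
normalisation fixes the constant factor. -/
theorem exists_eq_linProd (P : Polynomial ℂ) (hP : P.coeff 0 = 1) :
    ∃ b : Fin P.natDegree → ℂˣ, P = linProd fun k => (b k : ℂ) := by
  have hs : P.Splits := IsAlgClosed.splits P
  have hP0 : P ≠ 0 := fun h => by simp [h] at hP
  have hcard : P.roots.toList.length = P.natDegree := by
    rw [Multiset.length_toList, ← hs.natDegree_eq_card_roots]
  have hroot : ∀ x ∈ P.roots, x ≠ 0 := by
    rintro x hx rfl
    have := (Polynomial.mem_roots hP0).mp hx
    rw [Polynomial.IsRoot, ← Polynomial.coeff_zero_eq_eval_zero, hP] at this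
    exact one_ne_zero this
  let x : Fin P.natDegree → ℂ := fun k => P.roots.toList.get (k.cast hcard.symm)
  have hx : ∀ k, x k ≠ 0 := fun k => hroot _ (Multiset.mem_toList.mp (List.get_mem _ _))
  have hprod : (P.roots.map fun c => Polynomial.X - Polynomial.C c).prod =
      ∏ k, (Polynomial.X - Polynomial.C (x k)) := by
    conv_lhs => rw [← Multiset.coe_toList P.roots]
    rw [Multiset.map_coe, Multiset.prod_coe, ← List.prod_ofFn]
    congr 1
    refine List.ext_get (by simp [hcard]) fun n h1 h2 => ?_
    simp [x]
  refine ⟨fun k => (Units.mk0 (x k) (hx k))⁻¹, ?_⟩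
  have e1 : ∏ k, (Polynomial.X - Polynomial.C (x k)) =
      Polynomial.C (∏ k, -x k) * linProd fun k => ((Units.mk0 (x k) (hx k))⁻¹ : ℂˣ) := by
    rw [linProd, map_prod, ← Finset.prod_mul_distrib]
    refine Finset.prod_congr rfl fun k _ => ?_
    have : Polynomial.C (x k) * Polynomial.C (x k)⁻¹ = 1 := by
      rw [← Polynomial.C_mul, mul_inv_cancel₀ (hx k), Polynomial.C_1]
    rw [Units.val_inv_eq_inv_val, Units.val_mk0, Polynomial.C_neg]
    linear_combination Polynomial.X * (-this)
  have e2 := hs.eq_prod_roots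
  rw [hprod, e1, ← mul_assoc, ← Polynomial.C_mul] at e2
  have e3 := congrArg (fun p => Polynomial.coeff p 0) e2
  simp only [Polynomial.coeff_C_mul, coeff_zero_linProd, mul_one, hP] at e3
  rwa [← e3, Polynomial.C_1, one_mul] at e2

theorem reverse_one_sub {a : ℂ} (ha : a ≠ 0) :
    (1 - Polynomial.C a * Polynomial.X).reverse =
      Polynomial.C (-a) * (1 - Polynomial.C a⁻¹ * Polynomial.X) := by
  have hd : (1 - Polynomial.C a * Polynomial.X).natDegree = 1 := by
    compute_degree!
  ext n
  rw [Polynomial.coeff_reverse, hd, Polynomial.coeff_C_mul]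
  rcases n with _ | _ | n
  · simp [Polynomial.revAt_le, Polynomial.coeff_one]
  · simp [Polynomial.revAt_le, Polynomial.coeff_one, ha]
  · rw [Polynomial.revAt_eq_self_of_lt (by omega)]
    simp [Polynomial.coeff_one]

theorem reverse_linProd {ι : Type} [Fintype ι] (a : ι → ℂ) (ha : ∀ k, a k ≠ 0) :
    (linProd a).reverse = Polynomial.C (∏ k, -a k) * linProd fun k => (a k)⁻¹ := by
  classical
  unfold linProd
  induction (Finset.univ : Finset ι) using Finset.induction_on with
  | empty => simpa using Polynomial.reverse_C (1 : ℂ)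
  | insert k s hk ih =>
    rw [Finset.prod_insert hk, Finset.prod_insert hk, Finset.prod_insert hk,
      Polynomial.reverse_mul_of_domain, ih, reverse_one_sub (ha k), Polynomial.C_mul]
    ring

theorem linProd_comp {ι : Type} [Fintype ι] (a : ι → ℂ) (c : ℂ) :
    (linProd a).comp (Polynomial.C c * Polynomial.X) = linProd fun k => c * a k := by
  rw [linProd, Polynomial.prod_comp, linProd]
  refine Finset.prod_congr rfl fun k _ => ?_
  simp only [Polynomial.sub_comp, Polynomial.one_comp, Polynomial.mul_comp, Polynomial.C_comp,
    Polynomial.X_comp, Polynomial.C_mul]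
  ring

/-- This is the equation satisfied by `φ_i^±` in `linProd_mul_phi` with `α_k = p⁻¹ b_k` and `β_k = p
b_k`, so cancelling the denominator identifies the two series. -/
theorem linProd_mul_evenSeries {m : ℕ} (p : ℂˣ) (P : Polynomial ℂ) (hm : P.natDegree = m)
    (b : Fin m → ℂˣ) (hb : P = linProd fun k => (b k : ℂ)) (ε : ℤˣ) :
    (linProd fun k => (((p * b k) ^ (ε : ℤ) : ℂˣ) : ℂ) : PowerSeries ℂ) * evenSeries p P ε =
      PowerSeries.C (((p ^ m) ^ (ε : ℤ) : ℂˣ) : ℂ) *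
        (linProd fun k => (((p⁻¹ * b k) ^ (ε : ℤ) : ℂˣ) : ℂ)) := by
  have hp : (p : ℂ) ≠ 0 := p.ne_zero
  have hnum : P.comp (Polynomial.C ((p⁻¹ : ℂˣ) : ℂ) * Polynomial.X) =
      linProd fun k => ((p⁻¹ * b k : ℂˣ) : ℂ) := by
    conv_lhs => rw [hb]
    rw [linProd_comp]
    simp
  have hden : P.comp (Polynomial.C (p : ℂ) * Polynomial.X) =
      linProd fun k => ((p * b k : ℂˣ) : ℂ) := by
    conv_lhs => rw [hb]
    rw [linProd_comp]
    simp
  have hinv : ∀ a : Fin m → ℂ, (linProd a : PowerSeries ℂ) * (linProd a : PowerSeries ℂ)⁻¹ = 1 := by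
    intro a
    refine PowerSeries.mul_inv_cancel _ ?_
    rw [← PowerSeries.coeff_zero_eq_constantCoeff_apply, Polynomial.coeff_coe, coeff_zero_linProd]
    exact one_ne_zero
  rcases Int.units_eq_one_or ε with rfl | rfl
  · simp only [evenSeries, if_true, hnum, hden, hm, Units.val_one, zpow_one, Units.val_pow_eq_pow_val]
    linear_combination (PowerSeries.C ((p : ℂ) ^ m) *
      ((linProd fun k => ((p⁻¹ * b k : ℂˣ) : ℂ) : Polynomial ℂ) : PowerSeries ℂ)) *
        hinv fun k => ((p * b k : ℂˣ) : ℂ)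
  · simp only [evenSeries, show (-1 : ℤˣ) ≠ 1 by decide, if_false, hnum, hden, hm]
    rw [reverse_linProd _ (fun k => Units.ne_zero _), reverse_linProd _ (fun k => Units.ne_zero _),
      Polynomial.coe_mul, Polynomial.coe_mul, Polynomial.coe_C, Polynomial.coe_C,
      PowerSeries.mul_inv_rev]
    simp only [Units.val_neg, Units.val_one, zpow_neg, zpow_one, Units.val_inv_eq_inv_val]
    have h1 := hinv fun k => ((p * b k : ℂˣ) : ℂ)⁻¹
    set A := ((linProd fun k => ((p * b k : ℂˣ) : ℂ)⁻¹ : Polynomial ℂ) : PowerSeries ℂ)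
    set B := ((linProd fun k => ((p⁻¹ * b k : ℂˣ) : ℂ)⁻¹ : Polynomial ℂ) : PowerSeries ℂ)
    have h2 : PowerSeries.C ((p : ℂ) ^ m) * (PowerSeries.C (∏ k, -((p⁻¹ * b k : ℂˣ) : ℂ)) *
        (PowerSeries.C (∏ k, -((p * b k : ℂˣ) : ℂ)))⁻¹) = PowerSeries.C ((p ^ m : ℂˣ) : ℂ)⁻¹ := by
      rw [PowerSeries.C_inv, ← map_mul, ← map_mul]
      congr 1
      have h3 : ∏ k, -((p⁻¹ * b k : ℂˣ) : ℂ) =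
          ((p : ℂ) ^ m)⁻¹ * ((p : ℂ) ^ m)⁻¹ * ∏ k, -((p * b k : ℂˣ) : ℂ) := by
        have : (p : ℂ) ^ m = ∏ _k : Fin m, (p : ℂ) := by simp
        rw [this, ← Finset.prod_inv_distrib, ← Finset.prod_mul_distrib, ← Finset.prod_mul_distrib]
        refine Finset.prod_congr rfl fun k _ => ?_
        push_cast
        field_simp
      have h4 : ∏ k, -((p * b k : ℂˣ) : ℂ) ≠ 0 :=
        Finset.prod_ne_zero_iff.mpr fun k _ => neg_ne_zero.mpr (Units.ne_zero _)
      rw [h3]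
      generalize ∏ k, -((p * b k : ℂˣ) : ℂ) = z at h4
      push_cast
      field_simp
    linear_combination (PowerSeries.C ((p : ℂ) ^ m) *
      (PowerSeries.C (∏ k, -((p⁻¹ * b k : ℂˣ) : ℂ)) *
        (PowerSeries.C (∏ k, -((p * b k : ℂˣ) : ℂ)))⁻¹) * B) * h1 + B * h2

/-- The logarithm is obtained by integrating `θ(E)/E`, that is, by dividing its coefficients by `s`.
-/
theorem exists_expSeries_eq (E : PowerSeries ℂ) (hE : PowerSeries.coeff 0 E = 1) :
    ∃ g : PowerSeries ℂ, PowerSeries.coeff 0 g = 0 ∧ expSeries g = E := by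
  let H := theta E * E⁻¹
  have hEE : E⁻¹ * E = 1 := PowerSeries.inv_mul_cancel _ (by
    rw [← PowerSeries.coeff_zero_eq_constantCoeff_apply, hE]; exact one_ne_zero)
  have hH : PowerSeries.coeff 0 H = 0 := by
    simp [H, PowerSeries.coeff_mul]
  let g : PowerSeries ℂ := PowerSeries.mk fun s => PowerSeries.coeff s H / s
  have hg : theta g = H := by
    ext s
    by_cases hs : s = 0
    · subst hs
      simpa using hH.symm
    · have : (s : ℂ) ≠ 0 := by exact_mod_cast hs
      rw [coeff_theta, PowerSeries.coeff_mk, smul_eq_mul, mul_div_cancel₀ _ this]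
  have hg0 : PowerSeries.coeff 0 g = 0 := by simp [g]
  refine ⟨g, hg0, eq_of_theta_eq hH ?_ ?_ ?_⟩
  · rw [theta_expSeries hg0 (Commute.all _ _), hg]
  · rw [mul_assoc, hEE, mul_one]
  · rw [hE, expSeries, PowerSeries.coeff_mk, expCoeff_zero]

variable {q : ℂˣ} (hq : ∀ n : ℕ, 0 < n → q ^ n ≠ 1) {M N : ℕ} (Λ : HighestWeight q M N)
include hq

/-- Off degree zero, `φ^+` and `φ^-` never overlap, so the nonconstant parts of both can be read off
from `f`, and the `h`-eigenvalues are the coefficients of the logarithms. In degree zero the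
requirement is the compatibility of `c` with `f_0`. -/
theorem exists_odd_eta (i : Node M N) (hi : i.1 = M) :
    ∃ η : {s : ℤ // s ≠ 0} → ℂ, ∀ y : Gen M N → ℂ, y (.K i) = Λ.c → y (.Kinv i) = (Λ.c⁻¹ : ℂˣ) →
      (∀ s, y (.h i s) = η s) → ∀ n, ((q : ℂ) - ((q⁻¹ : ℂˣ) : ℂ))⁻¹ *
        (phi q y 1 i n - phi q y (-1) i n) = Λ.f n := by
  have hqi : qn q M i.1 = q := by simp [qn, ell, hi]
  have hδ := qn_sub_inv_ne_zero hq M i.1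
  rw [hqi] at hδ
  set δ : ℂ := (q : ℂ) - ((q⁻¹ : ℂˣ) : ℂ) with hδ_def
  have hc : (Λ.c : ℂ) ≠ 0 := Λ.c.ne_zero
  have key : ∀ ε : ℤˣ, ∃ g : PowerSeries ℂ, PowerSeries.coeff 0 g = 0 ∧ ∀ n : ℕ, n ≠ 0 →
      expCoeff g n = ((Λ.c ^ (ε : ℤ) : ℂˣ) : ℂ)⁻¹ * ((ε : ℤ) * δ * Λ.f ((ε : ℤ) * n)) := by
    intro ε
    obtain ⟨g, hg0, hg⟩ := exists_expSeries_eq (PowerSeries.mk fun n : ℕ => if n = 0 then 1 else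
      ((Λ.c ^ (ε : ℤ) : ℂˣ) : ℂ)⁻¹ * ((ε : ℤ) * δ * Λ.f ((ε : ℤ) * n))) (by simp)
    refine ⟨g, hg0, fun n hn => ?_⟩
    have := congrArg (PowerSeries.coeff n) hg
    simpa [expSeries, hn] using this
  choose g hg0 hg using key
  refine ⟨fun s => if 0 < s.1 then δ⁻¹ * PowerSeries.coeff s.1.natAbs (g 1)
    else -δ⁻¹ * PowerSeries.coeff s.1.natAbs (g (-1)), fun y hK hKinv hh n => ?_⟩
  have hser : ∀ ε, hSeries q y ε i = g ε := by
    intro ε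
    ext s
    by_cases hs : s = 0
    · rw [hs, coeff_zero_hSeries, hg0]
    · rw [coeff_hSeries q y ε i hs, hh, hqi, ← hδ_def]
      have hs' : 0 < s := Nat.pos_of_ne_zero hs
      rcases Int.units_eq_one_or ε with rfl | rfl
      · simp [hs', hδ]
      · simp [hδ]
  have hphi : ∀ (ε : ℤˣ) (n : ℕ), n ≠ 0 → phi q y ε i ((ε : ℤ) * n) =
      (ε : ℤ) * δ * Λ.f ((ε : ℤ) * n) := by
    intro ε n hn
    rw [phi_natCast, hser, hg ε n hn]
    rcases Int.units_eq_one_or ε with rfl | rfl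
    · simp [hK, hc]
    · simp [hKinv, hc, show (-1 : ℤˣ) ≠ 1 by decide]
  rcases lt_trichotomy n 0 with hn | rfl | hn
  · obtain ⟨m, rfl⟩ : ∃ m : ℕ, n = -m := ⟨n.natAbs, by omega⟩
    have := hphi (-1) m (by omega)
    simp only [Units.val_neg, Units.val_one, neg_mul, one_mul] at this
    rw [phi_of_neg q y 1 i (by simpa using hn), this]
    push_cast
    field_simp
    ring
  · have h1 := phi_natCast q y 1 i 0
    have h2 := phi_natCast q y (-1) i 0
    simp only [Nat.cast_zero, mul_zero, expCoeff_zero, mul_one, if_true,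
      show (-1 : ℤˣ) ≠ 1 by decide, if_false] at h1 h2
    rw [h1, h2, hK, hKinv, ← Λ.f_zero, div_eq_inv_mul]
  · obtain ⟨m, rfl⟩ : ∃ m : ℕ, n = m := ⟨n.natAbs, by omega⟩
    have := hphi 1 m (by omega)
    simp only [Units.val_one, one_mul] at this
    rw [phi_of_neg q y (-1) i (by simpa using hn), this]
    push_cast
    field_simp
    ring

theorem phi_eq_evenSeries {m : ℕ} {i : Node M N} (P : Polynomial ℂ) (hm : P.natDegree = m)
    (b : Fin m → ℂˣ) (hb : P = linProd fun k => (b k : ℂ)) {y : Gen M N → ℂ}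
    (hK : y (.K i) = (qn q M i.1 ^ m : ℂˣ)) (hKinv : y (.Kinv i) = ((qn q M i.1 ^ m)⁻¹ : ℂˣ))
    (hh : ∀ s, y (.h i s) = rootEta (qn q M i.1)
      (fun k => (qn q M i.1 ^ 2)⁻¹ * (qn q M i.1 * b k)) (fun k => qn q M i.1 * b k) s)
    (ε : ℤˣ) (n : ℕ) : phi q y ε i ((ε : ℤ) * n) =
      PowerSeries.coeff n (evenSeries (qn q M i.1) P ε) := by
  have h1 := linProd_mul_phi hq hK hKinv hh ε
  have h2 := linProd_mul_evenSeries (qn q M i.1) P hm b hb ε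
  have h3 : (fun k => (qn q M i.1 ^ 2)⁻¹ * (qn q M i.1 * b k)) = fun k => (qn q M i.1)⁻¹ * b k := by
    funext k
    group
  simp only [congrFun h3] at h1
  rw [← h2] at h1
  rw [← mul_left_cancel₀ (linProd_coe_ne_zero _) h1, PowerSeries.coeff_mk]

theorem exists_hData : ∃ D : HData M N,
    (∀ i (hi : i.1 ≠ M), D.κ i = qn q M i.1 ^ (Λ.P ⟨i, hi⟩).natDegree ∧
      ∃ b : Fin (Λ.P ⟨i, hi⟩).natDegree → ℂˣ, Λ.P ⟨i, hi⟩ = linProd (fun k => (b k : ℂ)) ∧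
        ∀ s, D.η i s = rootEta (qn q M i.1)
          (fun k => (qn q M i.1 ^ 2)⁻¹ * (qn q M i.1 * b k)) (fun k => qn q M i.1 * b k) s) ∧
    (∀ i (hi : i.1 ≠ M) (ε : ℤˣ) (n : ℕ), phi q D.val ε i ((ε : ℤ) * n) =
      PowerSeries.coeff n (evenSeries (qn q M i.1) (Λ.P ⟨i, hi⟩) ε)) ∧
    ∀ i : Node M N, i.1 = M → D.κ i = Λ.c ∧ ∀ n, ((q : ℂ) - ((q⁻¹ : ℂˣ) : ℂ))⁻¹ *
      (phi q D.val 1 i n - phi q D.val (-1) i n) = Λ.f n := by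
  classical
  choose b hb using fun i => exists_eq_linProd (Λ.P i) (Λ.P_zero i)
  choose η hη using exists_odd_eta hq Λ
  let D : HData M N :=
    { κ := fun i => if hi : i.1 = M then Λ.c else qn q M i.1 ^ (Λ.P ⟨i, hi⟩).natDegree
      η := fun i => if hi : i.1 = M then η i hi else rootEta (qn q M i.1)
        (fun k => (qn q M i.1 ^ 2)⁻¹ * (qn q M i.1 * b ⟨i, hi⟩ k))
        (fun k => qn q M i.1 * b ⟨i, hi⟩ k) }
  refine ⟨D, fun i hi => ⟨by simp [D, hi], b ⟨i, hi⟩, hb ⟨i, hi⟩,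
    fun s => by simp [D, hi]⟩, fun i hi ε n => ?_, fun i hi => ⟨by simp [D, hi], fun n => ?_⟩⟩
  · exact phi_eq_evenSeries hq (Λ.P ⟨i, hi⟩) rfl (b ⟨i, hi⟩) (hb ⟨i, hi⟩)
      (by simp [HData.val, D, hi]) (by simp [HData.val, D, hi]) (by simp [HData.val, D, hi]) ε n
  · exact hη i hi D.val (by simp [HData.val, D, hi]) (by simp [HData.val, D, hi])
      (by simp [HData.val, D, hi]) n

end HighestWeightData
end QAffSuper
end

noncomputable section

namespace QAffSuper

/-! ### The linear map on the Weyl module that detects `v` and the `X_{M,n}^- v`. -/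

section Detect

variable {q : ℂˣ} (hq : ∀ n : ℕ, 0 < n → q ^ n ≠ 1) {M N : ℕ} (D : HData M N)

theorem reverse_monic {Q : Polynomial ℂ} (hQ0 : Q.coeff 0 = 1) : Q.reverse.Monic := by
  have h : Q.natTrailingDegree = 0 := by
    rw [Polynomial.natTrailingDegree_eq_zero]
    exact Or.inr (by rw [hQ0]; exact one_ne_zero)
  rw [Polynomial.Monic, Polynomial.reverse_leadingCoeff, Polynomial.trailingCoeff, h, hQ0]

theorem natDegree_reverse_eq {Q : Polynomial ℂ} (hQ0 : Q.coeff 0 = 1) :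
    Q.reverse.natDegree = Q.natDegree := by
  have h : Q.natTrailingDegree = 0 := by
    rw [Polynomial.natTrailingDegree_eq_zero]
    exact Or.inr (by rw [hQ0]; exact one_ne_zero)
  rw [Polynomial.reverse_natDegree, h, Nat.sub_zero]

theorem reverse_eq_sum {Q : Polynomial ℂ} (hQ0 : Q.coeff 0 = 1) : Q.reverse =
    ∑ s ∈ Finset.range (Q.natDegree + 1),
      Polynomial.C (Q.coeff (Q.natDegree - s)) * Polynomial.X ^ s := by
  conv_lhs => rw [Q.reverse.as_sum_range_C_mul_X_pow, natDegree_reverse_eq hQ0]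
  refine Finset.sum_congr rfl fun s hs => ?_
  rw [Polynomial.coeff_reverse, Polynomial.revAt_le (by simpa [Nat.lt_succ_iff] using hs)]

/-- The constant coefficient of the reverse is the leading coefficient of `Q`, so the equation of
the root exhibits a unit as a multiple of it. -/
theorem isUnit_root_reverse {Q : Polynomial ℂ} (hQ0 : Q.coeff 0 = 1) :
    IsUnit (AdjoinRoot.root Q.reverse) := by
  have hQ : Q ≠ 0 := fun h => by simp [h] at hQ0
  have h1 : Polynomial.aeval (AdjoinRoot.root Q.reverse)
      (Q.reverse.divX * Polynomial.X + Polynomial.C (Q.reverse.coeff 0)) = 0 := by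
    rw [Polynomial.divX_mul_X_add, AdjoinRoot.aeval_eq, AdjoinRoot.mk_self]
  have hc : Q.reverse.coeff 0 = Q.leadingCoeff := Polynomial.coeff_zero_reverse Q
  rw [map_add, map_mul, Polynomial.aeval_X,
    Polynomial.aeval_C, hc] at h1
  have hl : IsUnit (algebraMap ℂ (AdjoinRoot Q.reverse) Q.leadingCoeff) :=
    (IsUnit.mk0 _ (Polynomial.leadingCoeff_ne_zero.mpr hQ)).map _
  rw [eq_neg_of_add_eq_zero_right h1] at hl
  exact isUnit_of_mul_isUnit_right (IsUnit.neg_iff _ |>.mp hl)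

/-- The root of the reverse of a polynomial `Q` with `Q(0) = 1`, as a unit. -/
def rootUnit {Q : Polynomial ℂ} (hQ0 : Q.coeff 0 = 1) : (AdjoinRoot Q.reverse)ˣ :=
  (isUnit_root_reverse hQ0).unit

theorem sum_zpow_rootUnit {Q : Polynomial ℂ} (hQ0 : Q.coeff 0 = 1) :
    ∑ s ∈ Finset.range (Q.natDegree + 1), Q.coeff (Q.natDegree - s) •
      ((rootUnit hQ0 ^ (s : ℤ) : (AdjoinRoot Q.reverse)ˣ) : AdjoinRoot Q.reverse) = 0 := by
  have h1 : Polynomial.aeval (AdjoinRoot.root Q.reverse) Q.reverse = 0 := by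
    rw [AdjoinRoot.aeval_eq, AdjoinRoot.mk_self]
  conv at h1 => lhs; arg 2; rw [reverse_eq_sum hQ0]
  rw [map_sum] at h1
  rw [← h1]
  refine Finset.sum_congr rfl fun s _ => ?_
  rw [map_mul, Polynomial.aeval_C, map_pow, Polynomial.aeval_X, Algebra.smul_def, zpow_natCast,
    Units.val_pow_eq_pow_val]
  rfl

theorem phi_borelOp_vac (ε : ℤˣ) (i : Node M N) (n : ℤ) :
    phi q (borelOp q D) ε i n (vac M N) = phi q D.val ε i n • vac M N :=
  phi_eigen q (x := borelOp q D) (y := D.val) (i := i) ((kOp_vac q D i 1).trans (by simp [HData.val]))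
    ((kOp_vac q D i (-1)).trans (by simp [HData.val])) (fun s => hOp_vac q D i s) ε n

/-- `top` kills the vector because `ζ` is a root of the reverse of `Q`, and a raising operator of
node `o` yields a coefficient of `Q f`, which is zero; those of other nodes yield nothing. -/
theorem sum_down_mem_maxSub {Q : Polynomial ℂ} (hQ0 : Q.coeff 0 = 1) {f : ℤ → ℂ}
    (hQf : Annihilates Q f) (o : Node M N)
    (hf : ∀ n, ((qn q M o.1 : ℂ) - ((qn q M o.1)⁻¹ : ℂˣ))⁻¹ *
      (phi q D.val 1 o n - phi q D.val (-1) o n) = f n) :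
    ∑ s ∈ Finset.range (Q.natDegree + 1), Q.coeff (Q.natDegree - s) •
      down (o, (s : ℤ)) (vac M N) ∈ maxSub q D o (rootUnit hQ0) := by
  rw [mem_maxSub]
  rintro (_ | ⟨⟨k, m⟩, x⟩)
  · rw [show upProd q D [] = 1 from rfl, Module.End.one_apply]
    simp only [map_sum, map_smul, top_down, if_true, top_vac, one_smul]
    have h := sum_zpow_rootUnit hQ0
    have e : ∀ r : AdjoinRoot Q.reverse, ((0, r) : ℂ × AdjoinRoot Q.reverse) =
      LinearMap.inr ℂ ℂ _ r := fun _ => rfl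
    simp only [e, ← map_smul, ← map_sum, h, map_zero]
  · change top o _ (upProd q D x (up q D (k, m) _)) = 0
    suffices h : up q D (k, m) (∑ s ∈ Finset.range (Q.natDegree + 1), Q.coeff (Q.natDegree - s) •
        down (o, (s : ℤ)) (vac M N)) = 0 by rw [h, map_zero, map_zero]
    simp only [map_sum, map_smul, up_down, up_vac, map_zero, smul_zero, zero_add]
    by_cases hk : k = o
    · subst hk
      simp only [if_true, psiOp, LinearMap.smul_apply, LinearMap.sub_apply, phi_borelOp_vac,
        ← sub_smul, smul_smul, hf, ← Finset.sum_smul]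
      -- Reversing the summation turns the coefficients `a_{d-s}` into `a_s`, and the sum into the
      -- coefficient of `Q f` in degree `m + d`.
      rw [← Finset.sum_range_reflect]
      have h := hQf (m + Q.natDegree)
      have e : ∑ j ∈ Finset.range (Q.natDegree + 1),
          Q.coeff (Q.natDegree - (Q.natDegree + 1 - 1 - j)) *
            f (m + ((Q.natDegree + 1 - 1 - j : ℕ) : ℤ)) =
          ∑ s ∈ Finset.range (Q.natDegree + 1), Q.coeff s * f (m + Q.natDegree - s) := by
        refine Finset.sum_congr rfl fun s hs => ?_
        have hs' : s ≤ Q.natDegree := by simpa [Nat.lt_succ_iff] using hs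
        rw [show Q.natDegree - (Q.natDegree + 1 - 1 - s) = s by omega,
          show m + ((Q.natDegree + 1 - 1 - s : ℕ) : ℤ) = m + Q.natDegree - s by omega]
      rw [e, h, zero_smul]
    · simp [hk]

include hq in
/-- A linear form on `U_q(L sl(M,N))` which vanishes on the left ideal defining the Weyl module and
separates the vectors `v` and `X_{M,n}^- v`. -/
theorem exists_detect (Λ : HighestWeight q M N) {Q : Polynomial ℂ} (hQ0 : Q.coeff 0 = 1)
    (hQf : Annihilates Q Λ.f) (hM : 1 < M) (o : Node M N) (ho : o.1 = M) :
    ∃ τ : U q M N →ₗ[ℂ] ℂ × AdjoinRoot Q.reverse, (∀ x ∈ weylIdeal Λ Q, τ x = 0) ∧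
      τ 1 = (1, 0) ∧ ∀ n : ℤ, τ (gen q (.X (-1) o n)) =
        (0, ((rootUnit hQ0 ^ n : (AdjoinRoot Q.reverse)ˣ) : AdjoinRoot Q.reverse)) := by
  obtain ⟨D, hD1, hD2, hD3⟩ := exists_hData hq Λ
  have hqo : qn q M o.1 = q := by simp [qn, ell, ho]
  set ζ := rootUnit hQ0
  let π := quotRep q D o ζ hq
  let v : WordQuot q D o ζ := Submodule.Quotient.mk (vac M N)
  have hneg : (-1 : ℤˣ) ≠ 1 := by decide
  have hX : ∀ (i : Node M N) n w, π (gen q (.X (-1) i n)) (Submodule.Quotient.mk w) =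
      Submodule.Quotient.mk (down (i, n) w) := by
    intro i n w
    simp only [π, quotRep_gen, quotOp_mk, wordOp, hneg, if_false]
  have hφ : ∀ ε i n, π (phi q (gen q) ε i n) v = phi q D.val ε i n • v := by
    intro ε i n
    simp only [π, v, quotRep_phi, phi_quotOp_mk, phi_wordOp, phi_borelOp_vac]
    rfl
  have hker : ∀ x ∈ weylIdeal Λ Q, π x v = 0 := by
    intro x hx
    induction hx using Submodule.span_induction with
    | zero => simp
    | add x y _ _ hx hy => rw [map_add, LinearMap.add_apply, hx, hy, add_zero]
    | smul a x _ hx => rw [smul_eq_mul, map_mul, Module.End.mul_apply, hx, map_zero]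
    | mem x hx =>
      have hx' : WeylRel Λ Q x := hx
      cases hx' with
      | raise i n =>
        simp only [π, v, quotRep_gen, quotOp_mk, wordOp, if_true, up_vac]
        rfl
      | even i ε n =>
        rw [map_sub, LinearMap.sub_apply, hφ, hD2 i.1 i.2, AlgHom.commutes,
          Module.algebraMap_end_apply, sub_self]
      | odd_K i hi =>
        have h : π (gen q (.K i)) v = (D.κ i : ℂ) • v := by
          simp only [π, v, quotRep_gen, quotOp_mk, wordOp, kOp_vac]
          simp
        rw [map_sub, LinearMap.sub_apply, h, (hD3 i hi).1, AlgHom.commutes,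
          Module.algebraMap_end_apply, sub_self]
      | odd_phi i hi n =>
        rw [map_sub, LinearMap.sub_apply, map_smul, map_sub, LinearMap.smul_apply,
          LinearMap.sub_apply, hφ, hφ, ← sub_smul, smul_smul, (hD3 i hi).2, AlgHom.commutes,
          Module.algebraMap_end_apply, sub_self]
      | lower_even i =>
        obtain ⟨hκ, b, -, hη⟩ := hD1 i.1 i.2
        have h := pow_down_mem_maxSub D (o := o) ζ hq (fun k => qn q M i.1.1 * b k) i.2
          (fun e => i.2 (by rw [e, ho])) hκ hη
        have e : ∀ k, π (gen q (.X (-1) i.1 0) ^ k) v =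
            Submodule.Quotient.mk ((down (i.1, 0) ^ k) (vac M N)) := by
          intro k
          induction k with
          | zero => simp [v]
          | succ k ih =>
            rw [pow_succ', pow_succ', map_mul, Module.End.mul_apply, ih, hX, Module.End.mul_apply]
        rw [e, add_comm 1 (Λ.P i).natDegree, Submodule.Quotient.mk_eq_zero]
        exact h
      | lower_odd i hi n hn =>
        -- The relation is imposed for all `n` only when `M = N = 1`, which `M > 1` excludes.
        obtain rfl : n = 0 := hn.resolve_right fun h => by omega
        obtain rfl : i = o := Subtype.ext (hi.trans ho.symm)
        have h := sum_down_mem_maxSub D hQ0 hQf i (by rw [hqo]; exact (hD3 i hi).2)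
        have e : π (∑ s ∈ Finset.range (Q.natDegree + 1),
            Q.coeff (Q.natDegree - s) • gen q (.X (-1) i (s + 0))) v =
            Submodule.Quotient.mk (∑ s ∈ Finset.range (Q.natDegree + 1),
              Q.coeff (Q.natDegree - s) • down (i, (s : ℤ)) (vac M N)) := by
          rw [map_sum, LinearMap.sum_apply, ← Submodule.mkQ_apply, map_sum]
          refine Finset.sum_congr rfl fun s _ => ?_
          rw [map_smul, LinearMap.smul_apply, hX, add_zero]
          rfl
        rw [e, Submodule.Quotient.mk_eq_zero]
        exact h
  refine ⟨quotTop q D o ζ ∘ₗ LinearMap.applyₗ v ∘ₗ π.toLinearMap, fun x hx => ?_, ?_, fun n => ?_⟩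
  · change quotTop q D o ζ (π x v) = 0
    rw [hker x hx, map_zero]
  · change quotTop q D o ζ (π 1 v) = _
    rw [map_one]
    exact top_vac o ζ
  · change quotTop q D o ζ (π _ v) = _
    rw [hX]
    change top o ζ _ = _
    rw [top_down, if_pos rfl, top_vac, one_smul]

end Detect
end QAffSuper
end

noncomputable section

namespace QAffSuper

theorem cartanRels_gen (q : ℂˣ) (M N : ℕ) : CartanRels q (gen q : Gen M N → U q M N) where
  K_Kinv i := by simpa using mk_rel q (Rel.K_Kinv i)
  Kinv_K i := by simpa using mk_rel q (Rel.Kinv_K i)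
  K_K i j := by simpa using mk_rel q (Rel.K_K i j)
  K_h i j s := by simpa using mk_rel q (Rel.K_h i j s)
  h_h i j s t := by simpa using mk_rel q (Rel.h_h i j s t)
  K_X ε i j n := by
    have h := mk_rel q (Rel.K_X ε i j n)
    have h' : gen q (.Kinv i : Gen M N) * gen q (.K i) = 1 := by
      simpa using mk_rel q (Rel.Kinv_K i)
    simp only [map_mul, map_smul, FreeAlgebra.lift_ι_apply] at h
    rw [← smul_mul_assoc, ← h, mul_assoc, h', mul_one]
  h_X ε i j s n := by simpa using mk_rel q (Rel.h_X ε i j s n)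

theorem basicRels_gen (q : ℂˣ) (M N : ℕ) : BasicRels q (gen q : Gen M N → U q M N) where
  toCartanRels := cartanRels_gen q M N
  X_X i j m n := by
    have h := mk_rel q (Rel.X_X (q := q) i j m n)
    rw [map_sbr, sbr_eq] at h
    by_cases hij : i = j
    · subst hij
      simpa [map_phi] using h
    · simpa [hij] using h

/-! ### Monomials in the lowering operators span the Weyl module. -/

section HighestWeightVector

variable {q : ℂˣ} {M N : ℕ} (Λ : HighestWeight q M N) (Q : Polynomial ℂ)

theorem smul_hwVector (x : U q M N) : x • hwVector Λ Q = Submodule.Quotient.mk x := by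
  rw [hwVector, ← Submodule.Quotient.mk_smul, smul_eq_mul, mul_one]

variable {Λ Q}

theorem WeylRel.smul_hwVector {x : U q M N} (h : WeylRel Λ Q x) : x • hwVector Λ Q = 0 := by
  rw [QAffSuper.smul_hwVector, Submodule.Quotient.mk_eq_zero]
  exact Submodule.subset_span h

theorem smul_eq_of_rel {x : U q M N} {c : ℂ}
    (h : WeylRel Λ Q (x - algebraMap ℂ (U q M N) c)) : x • hwVector Λ Q = c • hwVector Λ Q := by
  have := h.smul_hwVector
  rwa [sub_smul, algebraMap_smul, sub_eq_zero] at this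

theorem smul_smul_comm (x : U q M N) (c : ℂ) (w : Weyl Λ Q) : x • c • w = c • x • w := by
  rw [← algebraMap_smul (U q M N) c w, ← algebraMap_smul (U q M N) c (x • w), smul_smul, smul_smul,
    Algebra.commutes]

variable (hq : ∀ n : ℕ, 0 < n → q ^ n ≠ 1) {D : HData M N}
  (hD2 : ∀ i (hi : i.1 ≠ M) (ε : ℤˣ) (n : ℕ), phi q D.val ε i ((ε : ℤ) * n) =
      PowerSeries.coeff n (evenSeries (qn q M i.1) (Λ.P ⟨i, hi⟩) ε))
  (hD3 : ∀ i : Node M N, i.1 = M → D.κ i = Λ.c ∧ ∀ n, ((q : ℂ) - ((q⁻¹ : ℂˣ) : ℂ))⁻¹ *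
      (phi q D.val 1 i n - phi q D.val (-1) i n) = Λ.f n)
include hq hD2 hD3

omit hq in
theorem K_smul_hwVector (i : Node M N) :
    gen q (.K i) • hwVector Λ Q = (D.κ i : ℂ) • hwVector Λ Q := by
  by_cases hi : i.1 = M
  · rw [(hD3 i hi).1]
    exact smul_eq_of_rel (.odd_K i hi)
  · have h := smul_eq_of_rel (.even (Λ := Λ) (Q := Q) ⟨i, hi⟩ 1 0)
    rw [← hD2 i hi 1 0, phi_natCast, phi_natCast, expCoeff_zero, expCoeff_zero] at h
    simpa [HData.val] using h

omit hq in
theorem Kinv_smul_hwVector (i : Node M N) :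
    gen q (.Kinv i) • hwVector Λ Q = (((D.κ i)⁻¹ : ℂˣ) : ℂ) • hwVector Λ Q := by
  have h := congrArg (fun w => (((D.κ i)⁻¹ : ℂˣ) : ℂ) • gen q (.Kinv i) • w)
    (K_smul_hwVector (Q := Q) hD2 hD3 i)
  simp only [smul_smul, smul_smul_comm, (cartanRels_gen q M N).Kinv_K, one_smul] at h
  rw [h]
  simp

/-- At the odd node only `φ^+ - φ^-` is prescribed, but in nonzero degree one of the two vanishes;
degree zero is the action of `K_M^{±1}`. -/
theorem phi_smul_hwVector (i : Node M N) (ε : ℤˣ) (n : ℕ) :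
    phi q (gen q) ε i ((ε : ℤ) * n) • hwVector Λ Q =
      phi q D.val ε i ((ε : ℤ) * n) • hwVector Λ Q := by
  by_cases hi : i.1 = M
  · rcases Nat.eq_zero_or_pos n with rfl | hn
    · rw [phi_natCast, phi_natCast, expCoeff_zero, expCoeff_zero, mul_one, mul_one]
      split_ifs
      · exact K_smul_hwVector hD2 hD3 i
      · exact Kinv_smul_hwVector hD2 hD3 i
    · have hδ := qn_sub_inv_ne_zero hq M i.1
      rw [show qn q M i.1 = q by simp [qn, ell, hi]] at hδ
      have h := smul_eq_of_rel (.odd_phi (Λ := Λ) (Q := Q) i hi ((ε : ℤ) * n))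
      rw [← (hD3 i hi).2, mul_smul, smul_assoc] at h
      have h' := smul_right_injective _ (inv_ne_zero hδ) h
      rcases Int.units_eq_one_or ε with rfl | rfl
      · have hz : ∀ {A : Type} [Ring A] [Algebra ℂ A] (x : Gen M N → A),
            phi q x (-1) i (((1 : ℤˣ) : ℤ) * n) = 0 := fun x =>
          phi_of_neg q x (-1) i (by simpa using hn)
        simpa only [hz, sub_zero] using h'
      · have hz : ∀ {A : Type} [Ring A] [Algebra ℂ A] (x : Gen M N → A),
            phi q x 1 i (((-1 : ℤˣ) : ℤ) * n) = 0 := fun x =>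
          phi_of_neg q x 1 i (by simpa using hn)
        simpa only [hz, zero_sub, neg_smul, neg_inj] using h'
  · rw [hD2 i hi]
    exact smul_eq_of_rel (.even ⟨i, hi⟩ ε n)

theorem expCoeff_smul_hwVector (i : Node M N) (ε : ℤˣ) (n : ℕ) :
    expCoeff (hSeries q (gen q) ε i) n • hwVector Λ Q =
      expCoeff (hSeries q D.val ε i) n • hwVector Λ Q := by
  have h := phi_smul_hwVector (Q := Q) hq hD2 hD3 i ε n
  rw [phi_natCast, phi_natCast] at h
  split_ifs at h with hε
  · have h' := congrArg (fun w => gen q (.Kinv i) • w) h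
    simp only [smul_smul_comm, Kinv_smul_hwVector (Q := Q) hD2 hD3] at h'
    rw [smul_smul, ← mul_assoc, (cartanRels_gen q M N).Kinv_K, one_mul, smul_smul] at h'
    rw [h', HData.val]
    congr 1
    rw [mul_right_comm, Units.mul_inv, one_mul]
  · have h' := congrArg (fun w => gen q (.K i) • w) h
    simp only [smul_smul_comm, K_smul_hwVector (Q := Q) hD2 hD3] at h'
    rw [smul_smul, ← mul_assoc, (cartanRels_gen q M N).K_Kinv, one_mul, smul_smul] at h'
    rw [h', HData.val]
    congr 1
    rw [mul_right_comm, Units.inv_mul, one_mul]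

/-- The relations prescribe `φ`, not `h`. The Euler equation of the exponential recovers the
`h`-eigenvalues recursively. -/
theorem h_smul_hwVector (i : Node M N) (s : {s : ℤ // s ≠ 0}) :
    gen q (.h i s) • hwVector Λ Q = D.η i s • hwVector Λ Q := by
  have key : ∀ (ε : ℤˣ) (n : ℕ), PowerSeries.coeff n (theta (hSeries q (gen q) ε i)) •
      hwVector Λ Q = PowerSeries.coeff n (theta (hSeries q D.val ε i)) • hwVector Λ Q := by
    intro ε n
    induction n using Nat.strong_induction_on with
    | _ n ih =>
      have e1 := congrArg (PowerSeries.coeff n) (theta_expSeries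
        (coeff_zero_hSeries q (gen q) ε i) ((cartanRels_gen q M N).commute_theta_hSeries ε i))
      have e2 := congrArg (PowerSeries.coeff n) (theta_expSeries
        (coeff_zero_hSeries q D.val ε i) (Commute.all _ _))
      -- For this pair the exponential coefficient is one, so the `n`-th coefficient of `θ(g)` is
      -- expressed by exponential coefficients and earlier coefficients of `θ(g)`.
      have hmem : (n, 0) ∈ Finset.HasAntidiagonal.antidiagonal n := by simp
      rw [PowerSeries.coeff_mul, ← Finset.add_sum_erase _ _ hmem, coeff_theta] at e1 e2
      simp only [expSeries, PowerSeries.coeff_mk, expCoeff_zero, mul_one] at e1 e2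
      have e1' := congrArg (fun x => x • hwVector Λ Q) e1
      have e2' := congrArg (fun x => x • hwVector Λ Q) e2
      simp only [smul_assoc, expCoeff_smul_hwVector (Q := Q) hq hD2 hD3, add_smul,
        Finset.sum_smul] at e1' e2'
      rw [e2'] at e1'
      have hs : ∑ p ∈ (Finset.HasAntidiagonal.antidiagonal n).erase (n, 0),
          (PowerSeries.coeff p.1 (theta (hSeries q (gen q) ε i)) *
            expCoeff (hSeries q (gen q) ε i) p.2) • hwVector Λ Q =
          ∑ p ∈ (Finset.HasAntidiagonal.antidiagonal n).erase (n, 0),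
          (PowerSeries.coeff p.1 (theta (hSeries q D.val ε i)) *
            expCoeff (hSeries q D.val ε i) p.2) • hwVector Λ Q := by
        refine Finset.sum_congr rfl fun p hp => ?_
        have hp' := Finset.HasAntidiagonal.mem_antidiagonal.mp (Finset.mem_of_mem_erase hp)
        have hlt : p.1 < n := by
          rcases Nat.lt_or_ge p.1 n with h | h
          · exact h
          · exact absurd (Prod.ext (by simp; omega) (by simp; omega)) (Finset.ne_of_mem_erase hp)
        rw [mul_smul, expCoeff_smul_hwVector (Q := Q) hq hD2 hD3, smul_smul_comm, ih p.1 hlt,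
          smul_smul, mul_comm]
      rw [hs] at e1'
      exact (add_right_cancel e1').symm
  obtain ⟨s, hs⟩ := s
  obtain ⟨ε, n, hn, rfl⟩ : ∃ (ε : ℤˣ) (n : ℕ), n ≠ 0 ∧ s = (ε : ℤ) * n := by
    rcases lt_or_gt_of_ne hs with h | h
    · exact ⟨-1, s.natAbs, by omega, by rw [Units.val_neg, Units.val_one]; omega⟩
    · exact ⟨1, s.natAbs, by omega, by rw [Units.val_one]; omega⟩
  have h := key ε n
  rw [coeff_theta, coeff_theta, coeff_hSeries q _ ε i hn, coeff_hSeries q _ ε i hn] at h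
  simp only [smul_assoc] at h
  have hδ := qn_sub_inv_ne_zero hq M i.1
  have hε : ((ε : ℤ) : ℂ) ≠ 0 := by exact_mod_cast ε.ne_zero
  have hn' : (n : ℂ) ≠ 0 := by exact_mod_cast hn
  exact smul_right_injective _ (mul_ne_zero hε hδ) (smul_right_injective _ hn' h)

/-- The monomials in the `X_{i,n}^-` applied to the highest weight vector. -/
def wordVec (Λ : HighestWeight q M N) (Q : Polynomial ℂ) : List (Node M N × ℤ) → Weyl Λ Q
  | [] => hwVector Λ Q
  | l :: x => gen q (.X (-1) l.1 l.2) • wordVec Λ Q x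

/-- The weight of a monomial. -/
def wordWt (Λ : HighestWeight q M N) (x : List (Node M N × ℤ)) : Weight M N :=
  Λ.wt / (x.map fun l => simpleRoot q l.1).prod

omit hq in
theorem wt_some (i : Node M N) : Λ.wt (some i) = D.κ i := by
  by_cases hi : i.1 = M
  · simp [HighestWeight.wt, hi, (hD3 i hi).1]
  · obtain ⟨b, hb⟩ := exists_eq_linProd (Λ.P ⟨i, hi⟩) (Λ.P_zero _)
    have h := hD2 i hi 1 0
    rw [phi_natCast, expCoeff_zero] at h
    have h2 := congrArg (PowerSeries.coeff 0)
      (linProd_mul_evenSeries (qn q M i.1) (Λ.P ⟨i, hi⟩) rfl b hb 1)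
    rw [PowerSeries.coeff_mul, PowerSeries.coeff_mul] at h2
    simp only [Finset.Nat.antidiagonal_zero, Finset.sum_singleton, Polynomial.coeff_coe,
      coeff_zero_linProd, ← h] at h2
    refine Units.ext ?_
    rw [HighestWeight.wt, dif_neg hi]
    simpa [HData.val] using h2.symm

omit hq in
theorem Kop_wordVec (k : Option (Node M N)) (x : List (Node M N × ℤ)) :
    Kop Λ Q k (wordVec Λ Q x) = (wordWt Λ x k : ℂ) • wordVec Λ Q x := by
  induction x with
  | nil =>
    cases k with
    | none => simpa [Kop, wordVec, wordWt, HighestWeight.wt] using Kzero_hwVector Λ Q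
    | some i =>
      have h := K_smul_hwVector (Q := Q) hD2 hD3 i
      rw [← wt_some hD2 hD3] at h
      change gen q (.K i) • hwVector Λ Q = (wordWt Λ [] (some i) : ℂ) • hwVector Λ Q
      simpa [wordWt] using h
  | cons l x ih =>
    have hw : wordWt Λ (l :: x) k = (simpleRoot q l.1 k)⁻¹ * wordWt Λ x k := by
      simp only [wordWt, List.map_cons, List.prod_cons, Pi.div_apply, Pi.mul_apply]
      rw [div_mul_eq_div_div_swap, div_eq_inv_mul]
    cases k with
    | none =>
      change Kzero Λ Q (gen q (.X (-1) l.1 l.2) • wordVec Λ Q x) = _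
      change Kzero Λ Q (wordVec Λ Q x) = _ at ih
      rw [Kzero_smul, ih, sigma, twist_gen, hw, twistGen, smul_assoc, smul_smul_comm, smul_smul,
        Units.val_mul]
      by_cases hl : l.1.1 = 1 <;> simp [simpleRoot, wordVec, hl]
    | some i =>
      change gen q (.K i) • gen q (.X (-1) l.1 l.2) • wordVec Λ Q x = _
      change gen q (.K i) • wordVec Λ Q x = _ at ih
      rw [smul_smul, (cartanRels_gen q M N).K_X, smul_assoc, mul_smul, ih, smul_smul_comm,
        smul_smul, hw, simpleRoot, cartan_comm, Units.val_mul]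
      simp [wordVec]

/-- The span of the monomial vectors. -/
def wordSpan (Λ : HighestWeight q M N) (Q : Polynomial ℂ) : Submodule ℂ (Weyl Λ Q) :=
  Submodule.span ℂ (Set.range (wordVec Λ Q))

/-- The elements of `U_q(L sl(M,N))` preserving the span of the monomial vectors. -/
def wordStab (Λ : HighestWeight q M N) (Q : Polynomial ℂ) : Subalgebra ℂ (U q M N) where
  carrier := {u | ∀ w ∈ wordSpan Λ Q, u • w ∈ wordSpan Λ Q}
  mul_mem' := fun ha hb w hw => by rw [mul_smul]; exact ha _ (hb w hw)
  add_mem' := fun ha hb w hw => by rw [add_smul]; exact add_mem (ha w hw) (hb w hw)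
  algebraMap_mem' := fun c w hw => by
    rw [algebraMap_smul]
    exact Submodule.smul_mem _ c hw

omit hq hD2 hD3 in
theorem mem_wordStab {u : U q M N} (h : ∀ x, u • wordVec Λ Q x ∈ wordSpan Λ Q) :
    u ∈ wordStab Λ Q := by
  intro w hw
  induction hw using Submodule.span_induction with
  | mem w hw => obtain ⟨x, rfl⟩ := hw; exact h x
  | zero => rw [smul_zero]; exact Submodule.zero_mem _
  | add w w' _ _ hw hw' => rw [smul_add]; exact add_mem hw hw'
  | smul c w _ hw => rw [smul_smul_comm]; exact Submodule.smul_mem _ c hw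

omit hq hD2 hD3 in
theorem X_neg_mem_wordStab (i : Node M N) (n : ℤ) : gen q (.X (-1) i n) ∈ wordStab Λ Q :=
  mem_wordStab fun x => Submodule.subset_span ⟨(i, n) :: x, rfl⟩

omit hq in
theorem K_mem_wordStab (i : Node M N) : gen q (.K i) ∈ wordStab Λ Q :=
  mem_wordStab fun x => by
    have h : gen q (.K i) • wordVec Λ Q x = _ := Kop_wordVec hD2 hD3 (some i) x
    rw [h]
    exact Submodule.smul_mem _ _ (Submodule.subset_span ⟨x, rfl⟩)

omit hq in
theorem Kinv_mem_wordStab (i : Node M N) : gen q (.Kinv i) ∈ wordStab Λ Q :=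
  mem_wordStab fun x => by
    have h : gen q (.K i) • wordVec Λ Q x = _ := Kop_wordVec hD2 hD3 (some i) x
    have h' := congrArg (fun w => (((wordWt Λ x (some i))⁻¹ : ℂˣ) : ℂ) • gen q (.Kinv i) • w) h
    simp only [smul_smul_comm, smul_smul, (cartanRels_gen q M N).Kinv_K, one_smul,
      Units.inv_mul] at h'
    rw [← h']
    exact Submodule.smul_mem _ _ (Submodule.subset_span ⟨x, rfl⟩)

theorem h_mem_wordStab (i : Node M N) (s : {s : ℤ // s ≠ 0}) : gen q (.h i s) ∈ wordStab Λ Q := by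
  refine mem_wordStab fun x => ?_
  induction x with
  | nil =>
    change gen q (.h i s) • hwVector Λ Q ∈ _
    rw [h_smul_hwVector hq hD2 hD3]
    exact Submodule.smul_mem _ _ (Submodule.subset_span ⟨[], rfl⟩)
  | cons l x ih =>
    change gen q (.h i s) • gen q (.X (-1) l.1 l.2) • wordVec Λ Q x ∈ _
    rw [smul_smul, eq_add_of_sub_eq ((cartanRels_gen q M N).h_X (-1) i l.1 s l.2), add_smul,
      smul_assoc, mul_smul (gen q (.X (-1) l.1 l.2))]
    exact add_mem (Submodule.smul_mem _ _ (Submodule.subset_span ⟨(l.1, l.2 + s.1) :: x, rfl⟩))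
      (X_neg_mem_wordStab _ _ _ ih)

/-- Moving `X^+` through the first letter leaves a shorter word acted on by `X^+`, plus Cartan
terms, which already preserve the span. -/
theorem X_one_mem_wordStab (i : Node M N) (n : ℤ) : gen q (.X 1 i n) ∈ wordStab Λ Q := by
  refine mem_wordStab fun x => ?_
  induction x with
  | nil =>
    change gen q (.X 1 i n) • hwVector Λ Q ∈ _
    rw [(WeylRel.raise i n).smul_hwVector]
    exact Submodule.zero_mem _
  | cons l x ih =>
    change gen q (.X 1 i n) • gen q (.X (-1) l.1 l.2) • wordVec Λ Q x ∈ _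
    rw [smul_smul, eq_add_of_sub_eq ((basicRels_gen q M N).X_X i l.1 n l.2), add_smul,
      smul_assoc, mul_smul]
    refine add_mem ?_ (Submodule.smul_mem _ _ (X_neg_mem_wordStab _ _ _ ih))
    have hφ : ∀ ε, phi q (gen q) ε i (n + l.2) ∈ wordStab Λ Q := fun ε =>
      phi_mem q (x := gen q) (i := i) (wordStab Λ Q) (K_mem_wordStab hD2 hD3 i)
        (Kinv_mem_wordStab hD2 hD3 i) (h_mem_wordStab hq hD2 hD3 i) ε _
    have hx : wordVec Λ Q x ∈ wordSpan Λ Q := Submodule.subset_span ⟨x, rfl⟩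
    split_ifs
    · rw [smul_assoc, sub_smul]
      exact Submodule.smul_mem _ _ (sub_mem (hφ 1 _ hx) (hφ (-1) _ hx))
    · rw [zero_smul]
      exact Submodule.zero_mem _

/-- The stabiliser of the span is a subalgebra containing all generators, hence everything, and `v`
lies in the span. -/
theorem wordSpan_eq_top : wordSpan Λ Q = ⊤ := by
  have hgen : ∀ g, gen q g ∈ wordStab Λ Q := by
    intro g
    cases g with
    | X ε i n =>
      rcases Int.units_eq_one_or ε with rfl | rfl
      · exact X_one_mem_wordStab hq hD2 hD3 i n
      · exact X_neg_mem_wordStab i n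
    | K i => exact K_mem_wordStab hD2 hD3 i
    | Kinv i => exact Kinv_mem_wordStab hD2 hD3 i
    | h i s => exact h_mem_wordStab hq hD2 hD3 i s
  have hall : ∀ a, toU q M N a ∈ wordStab Λ Q := by
    intro a
    induction a using FreeAlgebra.induction with
    | grade0 r => rw [AlgHom.commutes]; exact (wordStab Λ Q).algebraMap_mem r
    | grade1 g => exact hgen g
    | mul a b ha hb => rw [map_mul]; exact mul_mem ha hb
    | add a b ha hb => rw [map_add]; exact add_mem ha hb
  refine eq_top_iff.mpr fun w _ => ?_
  obtain ⟨u, rfl⟩ := Submodule.Quotient.mk_surjective _ w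
  obtain ⟨a, ha⟩ : ∃ a, toU q M N a = u := RingQuot.mkAlgHom_surjective ℂ (Rel q M N) u
  rw [← ha, ← smul_hwVector]
  exact hall a _ (Submodule.subset_span ⟨[], rfl⟩)

omit hq hD2 hD3 in
theorem Kop_commute (k l : Option (Node M N)) : Commute (Kop Λ Q k) (Kop Λ Q l) := by
  have h0 : ∀ (i : Node M N) (w : Weyl Λ Q), Kzero Λ Q (gen q (.K i) • w) = gen q (.K i) • Kzero Λ Q w := by
    intro i w
    rw [Kzero_smul, sigma, twist_gen]
    rfl
  refine LinearMap.ext fun w => ?_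
  cases k with
  | none =>
    cases l with
    | none => rfl
    | some j => exact h0 j w
  | some i =>
    cases l with
    | none => exact (h0 i w).symm
    | some j =>
      change gen q (.K i) • gen q (.K j) • w = gen q (.K j) • gen q (.K i) • w
      rw [smul_smul, smul_smul, (cartanRels_gen q M N).K_K]

omit hq hD2 hD3 in
theorem iSupIndep_weightSpace : iSupIndep fun μ : Weight M N => weightSpace Λ Q μ := by
  have h := Module.End.independent_iInf_maxGenEigenspace_of_forall_mapsTo (Kop Λ Q)
    (fun k l φ => Module.End.mapsTo_maxGenEigenspace_of_comm (Kop_commute l k) φ)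
  have h' := h.comp (f := fun (μ : Weight M N) k => (μ k : ℂ)) fun μ ν e =>
    funext fun k => Units.ext (congrFun e k)
  exact h'.mono fun μ => iInf_mono fun k =>
    (Module.End.genEigenspace (Kop Λ Q k) (μ k : ℂ)).monotone le_top

/-- Monomials of weight `μ` and those of other weights together span. A vector of weight `μ` differs
from a combination of the former by an element of the sum of the other weight spaces, which is zero
by independence. -/
theorem weightSpace_eq_span (μ : Weight M N) :
    weightSpace Λ Q μ = Submodule.span ℂ {w | ∃ x, wordWt Λ x = μ ∧ wordVec Λ Q x = w} := by
  have hmem : ∀ x, wordVec Λ Q x ∈ weightSpace Λ Q (wordWt Λ x) := by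
    intro x
    simp only [weightSpace, Submodule.mem_iInf, Module.End.mem_eigenspace_iff]
    exact fun k => Kop_wordVec hD2 hD3 k x
  set A := Submodule.span ℂ {w | ∃ x, wordWt Λ x = μ ∧ wordVec Λ Q x = w} with hA
  set B := ⨆ ν ≠ μ, weightSpace Λ Q ν
  have hAle : A ≤ weightSpace Λ Q μ := by
    refine Submodule.span_le.mpr ?_
    rintro _ ⟨x, rfl, rfl⟩
    exact hmem x
  have htop : A ⊔ B = ⊤ := by
    rw [eq_top_iff, ← wordSpan_eq_top (Q := Q) hq hD2 hD3]
    refine Submodule.span_le.mpr ?_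
    rintro _ ⟨x, rfl⟩
    by_cases hx : wordWt Λ x = μ
    · exact (le_sup_left : A ≤ A ⊔ B) (Submodule.subset_span ⟨x, hx, rfl⟩)
    · exact (le_sup_right : B ≤ A ⊔ B) ((le_iSup₂ (f := fun ν (_ : ν ≠ μ) => weightSpace Λ Q ν)
        (wordWt Λ x) hx) (hmem x))
  have hdisj : weightSpace Λ Q μ ⊓ B = ⊥ :=
    (iSupIndep_weightSpace (Λ := Λ) (Q := Q) μ).eq_bot
  refine le_antisymm (fun w hw => ?_) hAle
  have hw' : w ∈ A ⊔ B := htop ▸ Submodule.mem_top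
  obtain ⟨a, ha, b, hb, rfl⟩ := Submodule.mem_sup.mp hw'
  have hb' : b ∈ weightSpace Λ Q μ ⊓ B :=
    ⟨by simpa using sub_mem hw (hAle ha), hb⟩
  rw [hdisj, Submodule.mem_bot] at hb'
  rwa [hb', add_zero]

end HighestWeightVector
end QAffSuper
end

noncomputable section

namespace QAffSuper

/-! ### The weight of a word determines its letter counts. -/

section Multidegree

variable {q : ℂˣ} {M N : ℕ}

/-- The number of letters of a word belonging to the node `i`. -/
def letterCount (x : List (Node M N × ℤ)) (i : ℕ) : ℤ :=
  (x.map fun l => if l.1.1 = i then (1 : ℤ) else 0).sum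

theorem letterCount_cons (l : Node M N × ℤ) (x : List (Node M N × ℤ)) (i : ℕ) :
    letterCount (l :: x) i = (if l.1.1 = i then 1 else 0) + letterCount x i := by
  simp [letterCount]

theorem letterCount_zero (x : List (Node M N × ℤ)) : letterCount x 0 = 0 := by
  induction x with
  | nil => rfl
  | cons l x ih => rw [letterCount_cons, ih, if_neg (by have := l.1.2.1; omega), add_zero]

theorem sum_letterCount_mul (x : List (Node M N × ℤ)) (f : ℕ → ℤ) :
    ∑ i ∈ Finset.range (M + N), letterCount x i * f i = (x.map fun l => f l.1.1).sum := by
  induction x with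
  | nil => simp [letterCount]
  | cons l x ih =>
    have hl : l.1.1 ∈ Finset.range (M + N) := by
      have := l.1.2
      rw [Finset.mem_range]
      omega
    simp only [letterCount_cons, add_mul, Finset.sum_add_distrib, ih, List.map_cons, List.sum_cons]
    congr 1
    rw [Finset.sum_eq_single_of_mem _ hl fun i _ hi => by rw [if_neg hi.symm, zero_mul]]
    simp

theorem prod_simpleRoot_some (x : List (Node M N × ℤ)) (j : Node M N) :
    (x.map fun l => simpleRoot q l.1).prod (some j) =
      q ^ ∑ i ∈ Finset.range (M + N), letterCount x i * cartan M i j.1 := by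
  rw [sum_letterCount_mul x fun i => cartan M i j.1]
  induction x with
  | nil => simp
  | cons l x ih =>
    rw [List.map_cons, List.prod_cons, Pi.mul_apply, ih, List.map_cons, List.sum_cons, zpow_add]
    rfl

theorem prod_simpleRoot_none (x : List (Node M N × ℤ)) :
    (x.map fun l => simpleRoot q l.1).prod none = q ^ letterCount x 1 := by
  induction x with
  | nil => simp [letterCount]
  | cons l x ih =>
    rw [List.map_cons, List.prod_cons, Pi.mul_apply, ih, letterCount_cons, zpow_add]
    by_cases h : l.1.1 = 1 <;> simp [simpleRoot, h]

/-- The Cartan matrix alone may be singular; the condition `d 1 = 0`, supplied by `K_0`, repairs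
this. The matrix is tridiagonal with nonzero off-diagonal entries, so column `j + 1` determines `d
(j + 2)` from the earlier values. -/
theorem eq_zero_of_sum_mul_cartan {d : ℕ → ℤ} (h0 : d 0 = 0) (h1 : d 1 = 0)
    (h : ∀ j : Node M N, ∑ i ∈ Finset.range (M + N), d i * cartan M i j.1 = 0) {i : ℕ}
    (hi : i < M + N) : d i = 0 := by
  induction i using Nat.strong_induction_on with
  | _ i ih =>
    rcases i with _ | _ | j
    · exact h0
    · exact h1
    · have hj := h ⟨j + 1, by omega, by omega⟩
      rw [Finset.sum_eq_single_of_mem (j + 2) (Finset.mem_range.mpr hi)] at hj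
      · have hc : cartan M (j + 1 + 1) (j + 1) ≠ 0 := by
          rw [cartan_comm, cartan_succ]
          rcases ell_sq M (j + 1 + 1) with e | e <;> rw [e] <;> decide
        exact (mul_eq_zero.mp hj).resolve_right hc
      · intro k hk hk2
        rcases Nat.lt_or_ge k (j + 2) with hlt | hge
        · rw [ih k hlt (by omega), zero_mul]
        · rw [cartan_comm, cartan_of_lt (show j + 1 + 1 < k by omega), mul_zero]

variable (hq : ∀ n : ℕ, 0 < n → q ^ n ≠ 1)
include hq

theorem letterCount_eq_of_prod_eq {x y : List (Node M N × ℤ)}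
    (h : (x.map fun l => simpleRoot q l.1).prod = (y.map fun l => simpleRoot q l.1).prod) {i : ℕ}
    (hi : i < M + N) : letterCount x i = letterCount y i := by
  refine sub_eq_zero.mp (eq_zero_of_sum_mul_cartan (M := M) (N := N)
    (d := fun i => letterCount x i - letterCount y i) ?_ ?_ (fun j => ?_) hi)
  · simp [letterCount_zero]
  · have := congrFun h none
    rw [prod_simpleRoot_none, prod_simpleRoot_none] at this
    exact sub_eq_zero.mpr (zpow_injective hq this)
  · have := congrFun h (some j)
    rw [prod_simpleRoot_some, prod_simpleRoot_some] at this
    simp only [sub_mul, Finset.sum_sub_distrib]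
    exact sub_eq_zero.mpr (zpow_injective hq this)

theorem length_eq_of_prod_eq {x y : List (Node M N × ℤ)}
    (h : (x.map fun l => simpleRoot q l.1).prod = (y.map fun l => simpleRoot q l.1).prod) :
    x.length = y.length := by
  have hx := sum_letterCount_mul x fun _ => 1
  have hy := sum_letterCount_mul y fun _ => 1
  rw [Finset.sum_congr rfl fun i hi => by
    rw [letterCount_eq_of_prod_eq hq h (Finset.mem_range.mp hi)], hy] at hx
  simpa using hx.symm

theorem wordWt_eq_wt {Λ : HighestWeight q M N} {x : List (Node M N × ℤ)} :
    wordWt Λ x = Λ.wt ↔ x = [] := by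
  refine ⟨fun h => ?_, fun h => by simp [h, wordWt]⟩
  have h' : (x.map fun l => simpleRoot q l.1).prod =
      (([] : List (Node M N × ℤ)).map fun l => simpleRoot q l.1).prod := by
    simpa [wordWt] using h
  simpa using length_eq_of_prod_eq hq h'

theorem wordWt_eq_wt_div {Λ : HighestWeight q M N} {o : Node M N} {x : List (Node M N × ℤ)} :
    wordWt Λ x = Λ.wt / simpleRoot q o ↔ ∃ n : ℤ, x = [(o, n)] := by
  refine ⟨fun h => ?_, fun ⟨n, h⟩ => by simp [h, wordWt]⟩
  have h' : (x.map fun l => simpleRoot q l.1).prod =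
      ([(o, (0 : ℤ))].map fun l => simpleRoot q l.1).prod := by
    simpa [wordWt] using h
  obtain ⟨l, rfl⟩ := List.length_eq_one_iff.mp (length_eq_of_prod_eq hq h')
  have hc := letterCount_eq_of_prod_eq hq h' (i := o.1) (by have := o.2; omega)
  refine ⟨l.2, ?_⟩
  have hl : l.1.1 = o.1 := by
    by_contra hne
    simp [letterCount, hne] at hc
  rw [← Subtype.ext hl]

end Multidegree

/-! ### The weight space `λ - α_M` and the action of `h_{M-1,±1}` on it. -/

section MainTheorem

theorem coeff_one_linProd {ι : Type} [Fintype ι] (b : ι → ℂ) :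
    (linProd b).coeff 1 = -∑ k, b k := by
  have h := congrArg (PowerSeries.coeff 1) (theta_linProd b)
  rw [coeff_theta, PowerSeries.coeff_mul, Finset.Nat.antidiagonal_succ] at h
  simpa [geomTail, map_sum, coeff_zero_linProd] using h

theorem rootEta_one {ι : Type} [Fintype ι] {r : ℂˣ} (hr : (r : ℂ) - (r⁻¹ : ℂˣ) ≠ 0)
    (b : ι → ℂˣ) : rootEta r (fun k => (r ^ 2)⁻¹ * (r * b k)) (fun k => r * b k)
      ⟨1, one_ne_zero⟩ = -(linProd fun k => (b k : ℂ)).coeff 1 := by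
  rw [coeff_one_linProd, neg_neg, rootEta, div_eq_iff (by simpa using hr)]
  simp only [zpow_one, Int.cast_one, one_mul, Finset.sum_mul]
  refine Finset.sum_congr rfl fun k _ => ?_
  push_cast
  field_simp

variable {q : ℂˣ} {M N : ℕ} {Λ : HighestWeight q M N} {Q : Polynomial ℂ}

/-- Since `c_{M-1,M} = -1` and `l_{M-1} = 1`, the coefficient is `-1` for both `s = ±1`. On `X_M^-`
the two operators `h_{M-1,±1}` thus act by the plain shifts. -/
theorem gam_prevNode (hq : ∀ n : ℕ, 0 < n → q ^ n ≠ 1) (hM : 1 < M) (hN : 1 ≤ N)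
    (ε : ℤˣ) : qint (qn q M (prevNode M N hM hN).1) ((ε : ℤ) * ell M (prevNode M N hM hN).1 *
      cartan M (prevNode M N hM hN).1 (oddNode M N hM hN).1) / (((ε : ℤ) : ℤ) : ℂ) = -1 := by
  have hc : cartan M (M - 1) M = -1 := by
    have := cartan_succ M (M - 1)
    rw [Nat.sub_add_cancel hM.le] at this
    simpa [ell] using this
  have hl : ell M (M - 1) = 1 := by simp [ell]
  have hδ := qn_sub_inv_ne_zero hq M (M - 1)
  change qint (qn q M (M - 1)) ((ε : ℤ) * ell M (M - 1) * cartan M (M - 1) M) / _ = -1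
  rw [hc, hl, qint]
  rcases Int.units_eq_one_or ε with rfl | rfl
  · simp only [Units.val_one, mul_one, mul_neg, neg_neg, zpow_neg, zpow_one, Int.cast_one, div_one]
    rw [div_eq_iff hδ]
    ring
  · simp only [Units.val_neg, Units.val_one, mul_one, mul_neg, neg_neg, zpow_neg, zpow_one,
      Int.cast_neg, Int.cast_one, div_neg, div_one]
    rw [div_self hδ]

variable (hq : ∀ n : ℕ, 0 < n → q ^ n ≠ 1) {D : HData M N}
  (hD2 : ∀ i (hi : i.1 ≠ M) (ε : ℤˣ) (n : ℕ), phi q D.val ε i ((ε : ℤ) * n) =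
      PowerSeries.coeff n (evenSeries (qn q M i.1) (Λ.P ⟨i, hi⟩) ε))
  (hD3 : ∀ i : Node M N, i.1 = M → D.κ i = Λ.c ∧ ∀ n, ((q : ℂ) - ((q⁻¹ : ℂˣ) : ℂ))⁻¹ *
      (phi q D.val 1 i n - phi q D.val (-1) i n) = Λ.f n)
  (hM : 1 < M) (hN : 1 ≤ N)
include hq hD2 hD3

theorem h_smul_X_smul_hwVector (ε : ℤˣ) (n : ℤ) :
    gen q (.h (prevNode M N hM hN) ⟨ε, ε.ne_zero⟩) •
        gen q (.X (-1) (oddNode M N hM hN) n) • hwVector Λ Q =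
      D.η (prevNode M N hM hN) ⟨ε, ε.ne_zero⟩ •
        gen q (.X (-1) (oddNode M N hM hN) n) • hwVector Λ Q +
      gen q (.X (-1) (oddNode M N hM hN) (n + ε)) • hwVector Λ Q := by
  have h := (cartanRels_gen q M N).h_X (-1) (prevNode M N hM hN) (oddNode M N hM hN)
    ⟨ε, ε.ne_zero⟩ n
  rw [gam_prevNode hq hM hN] at h
  rw [smul_smul, eq_add_of_sub_eq h, add_smul, smul_assoc,
    mul_smul (gen q (.X (-1) (oddNode M N hM hN) n)), h_smul_hwVector hq hD2 hD3, smul_smul_comm]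
  simp [add_comm]

/-- The case `n = 0` is a defining relation. Applying `h_{M-1,±1}` to the relation at `n` gives a
scalar multiple of it plus the relation at `n ± 1`. -/
theorem sum_X_smul_hwVector (n : ℤ) : ∑ s ∈ Finset.range (Q.natDegree + 1),
    Q.coeff (Q.natDegree - s) • gen q (.X (-1) (oddNode M N hM hN) (s + n)) • hwVector Λ Q = 0 := by
  have step : ∀ (ε : ℤˣ) (n : ℤ), ∑ s ∈ Finset.range (Q.natDegree + 1),
      Q.coeff (Q.natDegree - s) • gen q (.X (-1) (oddNode M N hM hN) (s + n)) • hwVector Λ Q = 0 →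
      ∑ s ∈ Finset.range (Q.natDegree + 1), Q.coeff (Q.natDegree - s) •
        gen q (.X (-1) (oddNode M N hM hN) (s + (n + ε))) • hwVector Λ Q = 0 := by
    intro ε n h
    have h' := congrArg (fun w => gen q (.h (prevNode M N hM hN) ⟨ε, ε.ne_zero⟩) • w) h
    simp only [Finset.smul_sum, smul_zero, smul_smul_comm,
      h_smul_X_smul_hwVector hq hD2 hD3 hM hN, smul_add, Finset.sum_add_distrib] at h'
    simp only [smul_comm _ (D.η _ _), ← Finset.smul_sum, h, smul_zero, zero_add] at h'
    simpa only [add_assoc] using h'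
  induction n using Int.induction_on with
  | zero =>
    have h := (WeylRel.lower_odd (Λ := Λ) (Q := Q) (oddNode M N hM hN) rfl 0
      (Or.inl rfl)).smul_hwVector
    simpa only [Finset.sum_smul, smul_assoc] using h
  | succ k ih => exact step 1 k ih
  | pred k ih => exact step (-1) _ ih

theorem X_smul_hwVector_mem_span (hQ0 : Q.coeff 0 = 1) (n : ℤ) :
    gen q (.X (-1) (oddNode M N hM hN) n) • hwVector Λ Q ∈
      Submodule.span ℂ (Set.range fun k : Fin Q.natDegree =>
        gen q (.X (-1) (oddNode M N hM hN) (k : ℤ)) • hwVector Λ Q) := by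
  set S := Submodule.span ℂ (Set.range fun k : Fin Q.natDegree =>
        gen q (.X (-1) (oddNode M N hM hN) (k : ℤ)) • hwVector Λ Q)
  have hlead : Q.coeff Q.natDegree ≠ 0 :=
    Polynomial.leadingCoeff_ne_zero.mpr fun h => by simp [h] at hQ0
  have rel := sum_X_smul_hwVector (Q := Q) hq hD2 hD3 hM hN
  -- The window of indices known to lie in the span grows by one at each end. The upper end uses the
  -- coefficient `a_0 = 1`, the lower end the leading coefficient `a_d ≠ 0`.
  have key : ∀ k : ℕ, ∀ n : ℤ, -(k : ℤ) ≤ n → n < Q.natDegree + k →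
      gen q (.X (-1) (oddNode M N hM hN) n) • hwVector Λ Q ∈ S := by
    intro k
    induction k with
    | zero =>
      intro n h1 h2
      have : n = ((⟨n.toNat, by omega⟩ : Fin Q.natDegree) : ℤ) := by simp; omega
      rw [this]
      exact Submodule.subset_span ⟨_, rfl⟩
    | succ k ih =>
      intro n h1 h2
      by_cases h3 : n = Q.natDegree + k
      · have h := rel k
        rw [Finset.sum_range_succ, Nat.sub_self, hQ0, one_smul, add_comm] at h
        rw [h3, eq_neg_of_add_eq_zero_left h]
        refine neg_mem (Submodule.sum_mem _ fun s hs => Submodule.smul_mem _ _ (ih _ ?_ ?_))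
        · omega
        · have := Finset.mem_range.mp hs
          omega
      by_cases h4 : n = -(k : ℤ) - 1
      · have h := rel n
        rw [Finset.sum_range_succ', Nat.sub_zero, Nat.cast_zero, zero_add, add_comm] at h
        have h5 : Q.coeff Q.natDegree • gen q (.X (-1) (oddNode M N hM hN) n) • hwVector Λ Q ∈
            S := by
          rw [eq_neg_of_add_eq_zero_left h]
          refine neg_mem (Submodule.sum_mem _ fun s hs => Submodule.smul_mem _ _ (ih _ ?_ ?_))
          · push_cast
            omega
          · have := Finset.mem_range.mp hs
            push_cast
            omega
        exact (Submodule.smul_mem_iff _ hlead).mp h5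
      · exact ih n (by push_cast at h1; omega) (by push_cast at h2; omega)
  exact key (n.natAbs + 1) n (by omega) (by omega)

theorem weightSpace_wt : weightSpace Λ Q Λ.wt = Submodule.span ℂ {hwVector Λ Q} := by
  rw [weightSpace_eq_span hq hD2 hD3]
  congr 1
  ext w
  simp only [wordWt_eq_wt hq, Set.mem_ofPred_eq, Set.mem_singleton_iff]
  exact ⟨fun ⟨x, hx, hw⟩ => by rw [← hw, hx]; rfl, fun h => ⟨[], rfl, h.symm⟩⟩

theorem weightSpace_wt_div : weightSpace Λ Q (Λ.wt / simpleRoot q (oddNode M N hM hN)) =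
    Submodule.span ℂ (Set.range fun n : ℤ =>
      gen q (.X (-1) (oddNode M N hM hN) n) • hwVector Λ Q) := by
  rw [weightSpace_eq_span hq hD2 hD3]
  congr 1
  ext w
  simp only [wordWt_eq_wt_div hq, Set.mem_ofPred_eq, Set.mem_range]
  exact ⟨fun ⟨x, ⟨n, hx⟩, hw⟩ => ⟨n, by rw [← hw, hx]; rfl⟩,
    fun ⟨n, h⟩ => ⟨_, ⟨n, rfl⟩, h⟩⟩

end MainTheorem

/-- In the power basis, multiplication by the root has the minimal polynomial of the root as
characteristic polynomial, and this is `g`, as `g` is monic. -/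
theorem charpoly_mulLeft_root {g : Polynomial ℂ} (hg : g.Monic) [Module.Finite ℂ (AdjoinRoot g)] :
    LinearMap.charpoly (LinearMap.mulLeft ℂ (AdjoinRoot.root g)) = g := by
  have hg0 := hg.ne_zero
  have h := charpoly_leftMulMatrix (AdjoinRoot.powerBasis hg0)
  rw [AdjoinRoot.minpoly_powerBasis_gen_of_monic hg] at h
  rw [← LinearMap.charpoly_toMatrix _ (AdjoinRoot.powerBasis hg0).basis]
  exact h

end QAffSuper
end

theorem mainTheorem5 (q : ℂˣ) (hq : ∀ n : ℕ, 0 < n → q ^ n ≠ 1)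
    (M N : ℕ) (hM : 1 < M) (hN : 1 ≤ N)
    (Λ : QAffSuper.HighestWeight q M N)
    (Q : Polynomial ℂ) (hQ0 : Q.coeff 0 = 1) (hQf : QAffSuper.Annihilates Q Λ.f) :
    Module.finrank ℂ (QAffSuper.weightSpace Λ Q Λ.wt) = 1 ∧
    ∃ _ : FiniteDimensional ℂ (QAffSuper.weightSpace Λ Q
        (Λ.wt / QAffSuper.simpleRoot q (QAffSuper.oddNode M N hM hN))),
      Module.finrank ℂ (QAffSuper.weightSpace Λ Q
        (Λ.wt / QAffSuper.simpleRoot q (QAffSuper.oddNode M N hM hN))) = Q.natDegree ∧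
      LinearMap.charpoly (QAffSuper.hOnWeightSpace Λ Q
          (Λ.wt / QAffSuper.simpleRoot q (QAffSuper.oddNode M N hM hN))
          (QAffSuper.prevNode M N hM hN) ⟨1, one_ne_zero⟩) =
        (∑ s ∈ Finset.range (Q.natDegree + 1),
          Polynomial.C (Q.coeff (Q.natDegree - s)) * Polynomial.X ^ s).comp
          (Polynomial.X - Polynomial.C (Λ.theta ⟨QAffSuper.prevNode M N hM hN,
            Nat.ne_of_lt (Nat.sub_lt (Nat.lt_trans Nat.zero_lt_one hM) Nat.zero_lt_one)⟩)) := by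
  open QAffSuper in
  obtain ⟨D, hD1, hD2, hD3⟩ := exists_hData hq Λ
  obtain ⟨τ, hτ0, hτ1, hτX⟩ := exists_detect hq Λ hQ0 hQf hM (oddNode M N hM hN) rfl
  have hmonic := reverse_monic hQ0
  have hprev : (prevNode M N hM hN).1 ≠ M := Nat.ne_of_lt (Nat.sub_lt (by omega) Nat.zero_lt_one)
  set o := oddNode M N hM hN
  set W' := weightSpace Λ Q (Λ.wt / simpleRoot q o)
  -- the linear form on the Weyl module induced by `τ`
  let σ : Weyl Λ Q →ₗ[ℂ] ℂ × AdjoinRoot Q.reverse :=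
    Submodule.liftQ ((weylIdeal Λ Q).restrictScalars ℂ) τ hτ0 ∘ₗ
      (Submodule.Quotient.restrictScalarsEquiv ℂ (weylIdeal Λ Q)).symm.toLinearMap
  have hσ : ∀ x : U q M N, σ (x • hwVector Λ Q) = τ x := fun x => by
    rw [smul_hwVector]
    rfl
  let ρ : W' →ₗ[ℂ] AdjoinRoot Q.reverse := LinearMap.snd ℂ ℂ _ ∘ₗ σ ∘ₗ W'.subtype
  have hspan : W' = Submodule.span ℂ (Set.range fun n : ℤ =>
      gen q (.X (-1) o n) • hwVector Λ Q) := weightSpace_wt_div hq hD2 hD3 hM hN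
  have hspan' : W' = Submodule.span ℂ (Set.range fun k : Fin Q.natDegree =>
      gen q (.X (-1) o (k : ℤ)) • hwVector Λ Q) := by
    rw [hspan]
    refine le_antisymm (Submodule.span_le.mpr ?_) (Submodule.span_le.mpr ?_)
    · rintro _ ⟨n, rfl⟩
      exact X_smul_hwVector_mem_span hq hD2 hD3 hM hN hQ0 n
    · rintro _ ⟨k, rfl⟩
      exact Submodule.subset_span ⟨k, rfl⟩
  have hfin : FiniteDimensional ℂ W' := by
    rw [hspan']
    exact FiniteDimensional.span_of_finite ℂ (Set.finite_range _)
  have hle : Module.finrank ℂ W' ≤ Q.natDegree := by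
    rw [hspan']
    exact (finrank_range_le_card _).trans (by simp)
  have hfinR : FiniteDimensional ℂ (AdjoinRoot Q.reverse) := hmonic.finite_adjoinRoot
  have hR : Module.finrank ℂ (AdjoinRoot Q.reverse) = Q.natDegree := by
    rw [(AdjoinRoot.powerBasis' hmonic).finrank, AdjoinRoot.powerBasis'_dim,
      natDegree_reverse_eq hQ0]
  have hmem : ∀ n : ℤ, gen q (.X (-1) o n) • hwVector Λ Q ∈ W' := fun n => by
    rw [hspan]
    exact Submodule.subset_span ⟨n, rfl⟩
  have hρ : ∀ n : ℤ, ρ ⟨_, hmem n⟩ =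
      ((rootUnit hQ0 ^ n : (AdjoinRoot Q.reverse)ˣ) : AdjoinRoot Q.reverse) := by
    exact fun n => congrArg Prod.snd ((hσ _).trans (hτX n))
  -- The image contains every `ζ^s`, and these powers span the quotient ring. With the bound on the
  -- dimension from the spanning set, `ρ` is an isomorphism.
  have hsurj : Function.Surjective ρ := by
    rw [← LinearMap.range_eq_top, eq_top_iff]
    intro x _
    obtain ⟨p, rfl⟩ := AdjoinRoot.mk_surjective x
    rw [← AdjoinRoot.aeval_eq, Polynomial.aeval_eq_sum_range]
    refine Submodule.sum_mem _ fun s _ => Submodule.smul_mem _ _ ⟨⟨_, hmem s⟩, ?_⟩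
    rw [hρ, zpow_natCast, Units.val_pow_eq_pow_val]
    rfl
  have hfinrank : Module.finrank ℂ W' = Q.natDegree :=
    le_antisymm hle (hR ▸ LinearMap.finrank_le_finrank_of_surjective hsurj)
  have hinj : Function.Injective ρ :=
    (LinearMap.injective_iff_surjective_of_finrank_eq_finrank (hfinrank.trans hR.symm)).mpr hsurj
  let e : W' ≃ₗ[ℂ] AdjoinRoot Q.reverse := LinearEquiv.ofBijective ρ ⟨hinj, hsurj⟩
  refine ⟨?_, hfin, hfinrank, ?_⟩
  · rw [weightSpace_wt hq hD2 hD3]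
    refine finrank_span_singleton fun h => ?_
    have h1 := hσ 1
    rw [one_smul, h, map_zero, hτ1] at h1
    exact zero_ne_one (congrArg Prod.fst h1)
  · set θ := Λ.theta ⟨prevNode M N hM hN, hprev⟩ with hθ_def
    have hθ : D.η (prevNode M N hM hN) ⟨1, one_ne_zero⟩ = θ := by
      obtain ⟨-, b, hb, hη⟩ := hD1 _ hprev
      rw [hη, rootEta_one (qn_sub_inv_ne_zero hq M _), ← hb, hθ_def, HighestWeight.theta]
    -- The shift `n ↦ n + 1` becomes multiplication by `ζ`, so `h_{M-1,1}` becomes multiplication by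
    -- `ζ + θ`. The form `- (-θ)` matches `LinearMap.charpoly_sub_smul`, which then produces
    -- composition with `X - θ`.
    have key : ∀ w ∈ W', (σ (gen q (.h (prevNode M N hM hN) ⟨1, one_ne_zero⟩) • w)).2 =
        AdjoinRoot.root Q.reverse * (σ w).2 - (-θ) • (σ w).2 := by
      intro w hw
      rw [hspan] at hw
      induction hw using Submodule.span_induction with
      | mem w hw =>
        obtain ⟨n, rfl⟩ := hw
        have h := h_smul_X_smul_hwVector (Q := Q) hq hD2 hD3 hM hN 1 n
        have h' : gen q (.h (prevNode M N hM hN) ⟨1, one_ne_zero⟩) •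
            gen q (.X (-1) o n) • hwVector Λ Q = θ • gen q (.X (-1) o n) • hwVector Λ Q +
            gen q (.X (-1) o (n + 1)) • hwVector Λ Q := by
          rw [← hθ]
          exact h
        simp only [h', map_add, map_smul, hσ, hτX, Prod.snd_add, Prod.smul_snd, zpow_add, zpow_one,
          Units.val_mul]
        rw [neg_smul, sub_neg_eq_add, add_comm, mul_comm]
        rfl
      | zero => simp
      | add w w' _ _ hw hw' =>
        rw [smul_add, map_add, map_add, Prod.snd_add, Prod.snd_add, hw, hw', mul_add]
        module
      | smul c w _ hw =>
        rw [smul_smul_comm, LinearMap.map_smul, LinearMap.map_smul, Prod.smul_snd, Prod.smul_snd, hw, mul_smul_comm]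
        module
    have hconj : e.conj (hOnWeightSpace Λ Q (Λ.wt / simpleRoot q o) (prevNode M N hM hN)
        ⟨1, one_ne_zero⟩) = LinearMap.mulLeft ℂ (AdjoinRoot.root Q.reverse) - (-θ) • 1 := by
      refine LinearMap.ext fun x => ?_
      obtain ⟨w, rfl⟩ := e.surjective x
      rw [LinearEquiv.conj_apply_apply, LinearEquiv.symm_apply_apply]
      exact key w.1 w.2
    rw [← reverse_eq_sum hQ0, ← LinearEquiv.charpoly_conj e, hconj, LinearMap.charpoly_sub_smul,
      charpoly_mulLeft_root hmonic, Polynomial.C_neg, sub_eq_add_neg]
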